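/- Let $n\ge 1$. For $L,r>0$ say that an open set $\omega\subset\mathbb{R}^n$ satisfies $(A_1)$ with parameters $(L,r)$ if there is a sequence $(I_j)_{j\ge1}$ of pairwise disjoint open cubes of side length $L$ with $\overline{\bigcup_j I_j}=\mathbb{R}^n$ such that for each $j$ there is $x_j\in I_j$ with $B_r(x_j)\subset I_j\cap\omega$. Say that $f:\mathbb{R}\to\mathbb{R}$ satisfies $(A_2)$ if $f$ is locally Lipschitz and $f(0)=0$. For $T>0$ and $y_0\in L^2(\mathbb{R}^n)\cap L^\infty(\mathbb{R}^n)$, a solution $y\in L^\infty(0,T;L^\infty(\mathbb{R}^n))$ of $$\partial_t y-\Delta y+f(y)=0\ \text{ in }\mathbb{R}^n\times(0,T],\qquad y(\cdot,0)=y_0,$$ is understood in the mild sense: $y(t)=e^{t\Delta}y_0-\int_0^te^{(t-s)\Delta}f(y(s))\,ds$ for all $t\in(0,T]$ and $y(0)=y_0$, where $e^{t\Delta}$ is the heat semigroup. The $H^{-1}$ norm is $\|u\|_{H^{-1}(\mathbb{R}^n)}^2=\langle(1-\Delta)^{-1}u,u\rangle_{L^2(\mathbb{R}^n)}$ for $u\in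 L^2(\mathbb{R}^n)$. Theorem. For all $n$ and $L,r>0$ there is $\beta=\beta(L,r)\in(0,1)$, and for all $T>0$ and $L_M\ge0$ there is $C=C(L,r,T,L_M)>0$ ($\beta$ and $C$ may also depend on the dimension $n$), such that the following holds. Let $\omega$ satisfy $(A_1)$ with parameters $(L,r)$, let $f$ satisfy $(A_2)$, let $y_1^0,y_2^0\in L^2(\mathbb{R}^n)\cap L^\infty(\mathbb{R}^n)$, and let $y_i\in L^\infty(0,T;L^\infty(\mathbb{R}^n))$ be a solution with initial value $y_i^0$ $(i=1,2)$. Put $M=\max_{i=1,2}\|y_i\|_{L^\infty(0,T;L^\infty(\mathbb{R}^n))}$ and suppose that $L_M$ is a Lipschitz constant of $f$ on $\{s\in\mathbb{R}:|s|\le M\}$. Then $y_1(\cdot,T)-y_2(\cdot,T)\in L^2(\mathbb{R}^n)$ and: (i) $$\int_{\mathbb{R}^n}|y_1-y_2|^2(x,T)\,dx\le C\Big(\int_{\mathbb{R}^n}|y_1^0-y_2^0|^2\,dx\Big)^{1-\beta}\Big(\int_\omega|y_1-y_2|^2(x,T)\,dx\Big)^{\beta};$$ (ii) if $y_1^0\ne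 y_2^0$ (as elements of $L^2(\mathbb{R}^n)$), then $$\int_{\mathbb{R}^n}|y_1^0-y_2^0|^2\,dx\le C\exp\Big(C\,\frac{\|y_1^0-y_2^0\|_{L^2(\mathbb{R}^n)}^2}{\|y_1^0-y_2^0\|_{H^{-1}(\mathbb{R}^n)}^2}\Big)\int_\omega|y_1-y_2|^2(x,T)\,dx.$$ -/

import Mathlib

open MeasureTheory Set
open scoped ENNReal NNReal FourierTransform

/-- Open cubes of side length `L` in `ℝⁿ`, in any position and orientation. -/
def IsOpenCube {n : ℕ} (L : ℝ) (I : Set (EuclideanSpace ℝ (Fin n))) : Prop :=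
  ∃ e : EuclideanSpace ℝ (Fin n) ≃ᵢ EuclideanSpace ℝ (Fin n),
    I = e '' {x | ∀ i, 0 < x i ∧ x i < L}

/-- `ω` is open and there is a sequence of pairwise disjoint open cubes of side length `L` with
dense union, each of which contains a ball of radius `r` that also lies in `ω`. -/
def IsObservationSet {n : ℕ} (L r : ℝ) (ω : Set (EuclideanSpace ℝ (Fin n))) : Prop :=
  IsOpen ω ∧ ∃ I : ℕ+ → Set (EuclideanSpace ℝ (Fin n)),
    (∀ j, IsOpenCube L (I j)) ∧
    (∀ j k, j ≠ k → I j ∩ I k = ∅) ∧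
    closure (⋃ j, I j) = univ ∧
    ∀ j, ∃ x ∈ I j, Metric.ball x r ⊆ I j ∩ ω

/-- The heat kernel `(4πt)^{-n/2} exp(-|x|²/(4t))`, for `t > 0`. -/
noncomputable def heatKernel {n : ℕ} (t : ℝ) (x : EuclideanSpace ℝ (Fin n)) : ℝ :=
  (4 * Real.pi * t) ^ (-(n : ℝ) / 2) * Real.exp (-‖x‖ ^ 2 / (4 * t))

/-- The heat semigroup `e^{tΔ}φ`, for `t > 0`. -/
noncomputable def heatSemigroup {n : ℕ} (t : ℝ) (φ : EuclideanSpace ℝ (Fin n) → ℝ)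
    (x : EuclideanSpace ℝ (Fin n)) : ℝ :=
  ∫ z, heatKernel t (x - z) * φ z

/-- The norm of `L^∞(0, T; L^∞(ℝⁿ))`. -/
noncomputable def timeSpaceSupNorm {n : ℕ} (T : ℝ)
    (y : ℝ → EuclideanSpace ℝ (Fin n) → ℝ) : ℝ≥0∞ :=
  essSup (fun t => eLpNorm (y t) ∞ volume) (volume.restrict (Ioo 0 T))

/-- `y ∈ L^∞(0, T; L^∞(ℝⁿ))` is a (mild) solution of `∂ₜy - Δy + f(y) = 0` in `ℝⁿ × (0, T]`,
`y(·, 0) = y₀`; here `y t x` is the value at time `t` and position `x`. -/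
structure IsBoundedSolution {n : ℕ} (f : ℝ → ℝ) (T : ℝ)
    (y₀ : EuclideanSpace ℝ (Fin n) → ℝ) (y : ℝ → EuclideanSpace ℝ (Fin n) → ℝ) : Prop where
  aestronglyMeasurable : AEStronglyMeasurable (fun p : ℝ × EuclideanSpace ℝ (Fin n) => y p.1 p.2)
    ((volume.restrict (Ioo 0 T)).prod volume)
  bounded : timeSpaceSupNorm T y < ∞
  initial : y 0 =ᵐ[volume] y₀
  duhamel : ∀ t ∈ Ioc 0 T, ∀ᵐ x ∂volume,
    y t x = heatSemigroup t y₀ x -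
      ∫ s in (0 : ℝ)..t, heatSemigroup (t - s) (fun z => f (y s z)) x

/-- The norm of `H^{-1}(ℝⁿ)` of a function in `L²(ℝⁿ)`, i.e. the square root of
`⟨(1 - Δ)⁻¹ u, u⟩`. With the Fourier transform normalized as `∫ e^{-2πi⟨x, ξ⟩} u(x) dx`,
the symbol of `1 - Δ` is `1 + 4π²|ξ|²`. -/
noncomputable def hNegOneNorm {n : ℕ} {u : EuclideanSpace ℝ (Fin n) → ℝ}
    (hu : MemLp u 2 volume) : ℝ :=
  Real.sqrt (∫ ξ, ‖(𝓕 (MemLp.toLp (fun x => (u x : ℂ)) hu.ofReal) :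
      Lp ℂ 2 (volume : Measure (EuclideanSpace ℝ (Fin n)))) ξ‖ ^ 2 / (1 + 4 * Real.pi ^ 2 * ‖ξ‖ ^ 2))

/-! Write w = y₁ - y₂ and K = L_M. The source f(y₂) - f(y₁) is at most K|w| in absolute value, so
Duhamel's formula and Gronwall's lemma give |w(t) - e^{(t-s)Δ}w(s)| ≤ (e^{K(t-s)} - 1)
e^{(t-s)Δ}|w(s)| for all s < t (`isHeatPerturbation_duhamelFlow`). Both estimates rest on this
inequality alone. No derivative of w is taken: the usual monotonicity formulas are replaced by
discrete versions over many short time steps.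

For (i), fix a center and weigh w(T + h - l)² with the heat kernel of time l, as in Poon's parabolic
frequency function. Let l run through a geometric progression of ratio c; let b_k be the weighted
norms and a_k the norms after one step of the free heat flow. For the free flow b_{k+1} = a_k, and
the adjoint of a step is the next step up to a dilation, so a_k² ≤ a_{k+1} b_k: the ratio a_k / b_k
is nondecreasing. The perturbation costs only the square of its relative size per step
(`frequency_propagation`). Hence, if the norm does not collapse between two early scales, the last
step, at scale h, is nearly isometric. A heat step loses the mass far from the center, so the
weighted mass at time T must sit in the ball of radius r
(`integral_heatKernel_le_setIntegral_ball`), and the energy in B_R is at most 3e^{R²/4h} times the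
energy in B_r.

The collapse is excluded once h is small against 1/(1 + Z), where Z is the logarithm of the quotient
of the initial energy and the final energy in B_R. Taking h of the order 1/(1 + Z) turns e^{R²/4h}
into a power of that quotient, which is Hölder interpolation (`exists_local_interpolation`). The
balls of radius r in ω are disjoint and their enlargements to radius √n L + 1 cover the space.
Hölder's inequality sums the local estimates, because Gaussians at separated centers have a bounded
sum (`exists_interpolation`).

For (ii), a heat step is on the Fourier side a multiplication by e^{-4π²δ|ξ|²}, which cannot raise
the quotient of the squared L² and H^{-1} norms; the perturbation raises its bound by a factor
e^{8K²δ} at most (`frequency_step`). While the quotient is bounded, the H^{-1} norm decays at most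
exponentially, at a rate linear in the initial quotient R. Thus ‖w(0)‖² ≤ e^{DR}‖w(T)‖²
(`integral_sq_zero_le`); inserting (i) and solving for ‖w(0)‖² gives (ii). -/

variable {n : ℕ}

/-! ### The heat kernel and its Gaussian algebra -/

theorem heatKernel_pos {t : ℝ} (ht : 0 < t) (x : EuclideanSpace ℝ (Fin n)) :
    0 < heatKernel t x := by
  unfold heatKernel
  positivity

theorem heatKernel_nonneg {t : ℝ} (ht : 0 < t) (x : EuclideanSpace ℝ (Fin n)) :
    0 ≤ heatKernel t x :=
  (heatKernel_pos ht x).le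

theorem heatKernel_zero (t : ℝ) :
    heatKernel t (0 : EuclideanSpace ℝ (Fin n)) = (4 * Real.pi * t) ^ (-(n : ℝ) / 2) := by
  simp [heatKernel]

theorem heatKernel_le_heatKernel_zero {t : ℝ} (ht : 0 < t) (x : EuclideanSpace ℝ (Fin n)) :
    heatKernel t x ≤ heatKernel t (0 : EuclideanSpace ℝ (Fin n)) := by
  rw [heatKernel_zero]
  refine mul_le_of_le_one_right (by positivity) (Real.exp_le_one_iff.2 ?_)
  rw [neg_div]
  exact neg_nonpos.2 (by positivity)

theorem heatKernel_neg (t : ℝ) (x : EuclideanSpace ℝ (Fin n)) :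
    heatKernel t (-x) = heatKernel t x := by
  simp [heatKernel]

theorem heatKernel_sub_comm (t : ℝ) (x y : EuclideanSpace ℝ (Fin n)) :
    heatKernel t (x - y) = heatKernel t (y - x) := by
  rw [← heatKernel_neg, neg_sub]

theorem measurable_heatKernel_prod :
    Measurable (fun p : ℝ × EuclideanSpace ℝ (Fin n) => heatKernel p.1 p.2) := by
  unfold heatKernel
  fun_prop

theorem continuous_heatKernel (t : ℝ) :
    Continuous (heatKernel t : EuclideanSpace ℝ (Fin n) → ℝ) := by
  unfold heatKernel
  fun_prop

theorem measurable_heatKernel (t : ℝ) :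
    Measurable (heatKernel t : EuclideanSpace ℝ (Fin n) → ℝ) :=
  (continuous_heatKernel t).measurable

theorem integral_heatKernel {t : ℝ} (ht : 0 < t) :
    ∫ x : EuclideanSpace ℝ (Fin n), heatKernel t x = 1 := by
  have h := GaussianFourier.integral_rexp_neg_mul_sq_norm (V := EuclideanSpace ℝ (Fin n))
    (b := 1 / (4 * t)) (by positivity)
  unfold heatKernel
  rw [integral_const_mul]
  have e : (fun x : EuclideanSpace ℝ (Fin n) => Real.exp (-‖x‖ ^ 2 / (4 * t))) =
      fun x => Real.exp (-(1 / (4 * t)) * ‖x‖ ^ 2) := by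
    ext x; congr 1; field_simp
  rw [e, h, show Real.pi / (1 / (4 * t)) = 4 * Real.pi * t by field_simp,
    ← Real.rpow_add (by positivity)]
  simp [neg_div]

theorem integrable_heatKernel {t : ℝ} (ht : 0 < t) :
    Integrable (heatKernel t : EuclideanSpace ℝ (Fin n) → ℝ) :=
  .of_integral_ne_zero (by rw [integral_heatKernel ht]; exact one_ne_zero)

theorem integrable_heatKernel_sub {t : ℝ} (ht : 0 < t) (x : EuclideanSpace ℝ (Fin n)) :
    Integrable (fun z => heatKernel t (x - z)) :=
  (integrable_heatKernel ht).comp_sub_left x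

theorem integral_heatKernel_sub {t : ℝ} (ht : 0 < t) (x : EuclideanSpace ℝ (Fin n)) :
    ∫ z, heatKernel t (x - z) = 1 := by
  rw [integral_sub_left_eq_self (heatKernel t) volume x, integral_heatKernel ht]

/-- Completing the square in a product of two heat kernels. -/
theorem heatKernel_mul_heatKernel {s t : ℝ} (hs : 0 < s) (ht : 0 < t)
    (x y : EuclideanSpace ℝ (Fin n)) :
    heatKernel s x * heatKernel t (x - y) =
      heatKernel (s + t) y * heatKernel (s * t / (s + t)) (x - (s / (s + t)) • y) := by
  unfold heatKernel
  have hst : 0 < s + t := add_pos hs ht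
  have e1 : (4 * Real.pi * s) ^ (-(n : ℝ) / 2) * (4 * Real.pi * t) ^ (-(n : ℝ) / 2) =
      (4 * Real.pi * (s + t)) ^ (-(n : ℝ) / 2) *
        (4 * Real.pi * (s * t / (s + t))) ^ (-(n : ℝ) / 2) := by
    rw [← Real.mul_rpow (by positivity) (by positivity),
      ← Real.mul_rpow (by positivity) (by positivity)]
    congr 1; field_simp
  have e2 : -‖x‖ ^ 2 / (4 * s) + -‖x - y‖ ^ 2 / (4 * t) =
      -‖y‖ ^ 2 / (4 * (s + t)) +
        -‖x - (s / (s + t)) • y‖ ^ 2 / (4 * (s * t / (s + t))) := by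
    rw [@norm_sub_sq_real, @norm_sub_sq_real, inner_smul_right, norm_smul, mul_pow,
      Real.norm_eq_abs, sq_abs]
    field_simp
    ring
  have e3 : Real.exp (-‖x‖ ^ 2 / (4 * s)) * Real.exp (-‖x - y‖ ^ 2 / (4 * t)) =
      Real.exp (-‖y‖ ^ 2 / (4 * (s + t))) *
        Real.exp (-‖x - (s / (s + t)) • y‖ ^ 2 / (4 * (s * t / (s + t)))) := by
    rw [← Real.exp_add, ← Real.exp_add, e2]
  rw [mul_mul_mul_comm, e1, e3, mul_mul_mul_comm]

theorem heatKernel_smul {c t : ℝ} (hc : 0 < c) (ht : 0 < t) (x : EuclideanSpace ℝ (Fin n)) :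
    c ^ n * heatKernel (c ^ 2 * t) (c • x) = heatKernel t x := by
  unfold heatKernel
  have e1 : c ^ n * (4 * Real.pi * (c ^ 2 * t)) ^ (-(n : ℝ) / 2) =
      (4 * Real.pi * t) ^ (-(n : ℝ) / 2) := by
    rw [show 4 * Real.pi * (c ^ 2 * t) = c ^ 2 * (4 * Real.pi * t) by ring,
      Real.mul_rpow (by positivity) (by positivity), ← Real.rpow_natCast c 2, ← Real.rpow_mul hc.le,
      ← mul_assoc, ← Real.rpow_natCast c n, ← Real.rpow_add hc]
    rw [show (n : ℝ) + ((2 : ℕ) : ℝ) * (-n / 2) = 0 by push_cast; ring]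
    simp
  rw [← mul_assoc, e1, norm_smul, mul_pow, Real.norm_eq_abs, sq_abs]
  congr 2
  field_simp

/-- The Chapman–Kolmogorov equation for the heat kernel. -/
theorem integral_heatKernel_mul_heatKernel {s t : ℝ} (hs : 0 < s) (ht : 0 < t)
    (x y : EuclideanSpace ℝ (Fin n)) :
    ∫ z, heatKernel s (x - z) * heatKernel t (z - y) = heatKernel (s + t) (x - y) := by
  have h : ∀ z, heatKernel s (x - z) * heatKernel t (z - y) =
      heatKernel (s + t) (x - y) *
        heatKernel (s * t / (s + t)) ((x - (s / (s + t)) • (x - y)) - z) := by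
    intro z
    have := heatKernel_mul_heatKernel hs ht (x - z) (x - y)
    rw [show x - z - (x - y) = -(z - y) by abel, heatKernel_neg] at this
    rw [this]; congr 2; abel
  simp_rw [h]
  rw [integral_const_mul, integral_heatKernel_sub (by positivity), mul_one]

/-! ### Cauchy–Schwarz with weights -/

section CauchySchwarz

variable {α : Type*} [MeasurableSpace α] {μ : Measure α}

/-- The Cauchy–Schwarz inequality for real integrals. -/
theorem sq_integral_mul_le {f g : α → ℝ} (hf : Integrable (fun x => f x ^ 2) μ)
    (hg : Integrable (fun x => g x ^ 2) μ) (hfg : Integrable (fun x => f x * g x) μ) :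
    (∫ x, f x * g x ∂μ) ^ 2 ≤ (∫ x, f x ^ 2 ∂μ) * ∫ x, g x ^ 2 ∂μ := by
  have key : ∀ s : ℝ, 0 ≤ (∫ x, g x ^ 2 ∂μ) * (s * s) + 2 * (∫ x, f x * g x ∂μ) * s +
      ∫ x, f x ^ 2 ∂μ := by
    intro s
    have h0 : 0 ≤ ∫ x, (f x + s * g x) ^ 2 ∂μ := integral_nonneg fun x => sq_nonneg _
    have h1 : ∫ x, (f x + s * g x) ^ 2 ∂μ =
        ∫ x, (f x ^ 2 + 2 * s * (f x * g x)) + s ^ 2 * g x ^ 2 ∂μ := by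
      congr 1; ext x; ring
    have i1 : Integrable (fun x => f x ^ 2 + 2 * s * (f x * g x)) μ := hf.add (hfg.const_mul _)
    rw [h1, integral_add i1 (hg.const_mul _),
      integral_add hf (hfg.const_mul _), integral_const_mul, integral_const_mul] at h0
    linarith
  have := discrim_le_zero key
  unfold discrim at this
  nlinarith

/-- The Cauchy–Schwarz inequality for real integrals with a weight. -/
theorem sq_integral_weight_mul_le {k f g : α → ℝ} (hk : ∀ x, 0 ≤ k x)
    (hf : Integrable (fun x => k x * f x ^ 2) μ) (hg : Integrable (fun x => k x * g x ^ 2) μ)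
    (hfg : Integrable (fun x => k x * (f x * g x)) μ) :
    (∫ x, k x * (f x * g x) ∂μ) ^ 2 ≤ (∫ x, k x * f x ^ 2 ∂μ) * ∫ x, k x * g x ^ 2 ∂μ := by
  have e1 : ∀ v : α → ℝ, (fun x => (√(k x) * v x) ^ 2) = fun x => k x * v x ^ 2 := fun v => by
    ext x; rw [mul_pow, Real.sq_sqrt (hk x)]
  have e2 : (fun x => (√(k x) * f x) * (√(k x) * g x)) = fun x => k x * (f x * g x) := by
    ext x; rw [mul_mul_mul_comm, Real.mul_self_sqrt (hk x)]
  have := sq_integral_mul_le (μ := μ) (f := fun x => √(k x) * f x) (g := fun x => √(k x) * g x)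
    (by rwa [e1]) (by rwa [e1]) (by rwa [e2])
  rwa [e1, e1, e2] at this

theorem integral_weight_sub_sq {k f g : α → ℝ} (hf : Integrable (fun x => k x * f x ^ 2) μ)
    (hg : Integrable (fun x => k x * g x ^ 2) μ)
    (hfg : Integrable (fun x => k x * (f x * g x)) μ) :
    ∫ x, k x * (f x - g x) ^ 2 ∂μ = (∫ x, k x * f x ^ 2 ∂μ) - 2 * (∫ x, k x * (f x * g x) ∂μ) +
      ∫ x, k x * g x ^ 2 ∂μ := by
  have h1 : ∫ x, k x * (f x - g x) ^ 2 ∂μ =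
      ∫ x, (k x * f x ^ 2 - 2 * (k x * (f x * g x))) + k x * g x ^ 2 ∂μ := by
    congr 1; ext x; ring
  have i1 : Integrable (fun x => k x * f x ^ 2 - 2 * (k x * (f x * g x))) μ :=
    hf.sub (hfg.const_mul _)
  rw [h1, integral_add i1 hg, integral_sub hf (hfg.const_mul _), integral_const_mul]

/-- The reverse triangle inequality in a weighted `L²` space, in the form
`(‖f‖ - ‖g‖)² ≤ ‖f - g‖²`. -/
theorem sq_sqrt_integral_weight_sub_le {k f g : α → ℝ} (hk : ∀ x, 0 ≤ k x)
    (hf : Integrable (fun x => k x * f x ^ 2) μ) (hg : Integrable (fun x => k x * g x ^ 2) μ)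
    (hfg : Integrable (fun x => k x * (f x * g x)) μ) :
    (√(∫ x, k x * f x ^ 2 ∂μ) - √(∫ x, k x * g x ^ 2 ∂μ)) ^ 2 ≤
      ∫ x, k x * (f x - g x) ^ 2 ∂μ := by
  have hf0 : 0 ≤ ∫ x, k x * f x ^ 2 ∂μ :=
    integral_nonneg fun x => mul_nonneg (hk x) (sq_nonneg _)
  have hg0 : 0 ≤ ∫ x, k x * g x ^ 2 ∂μ :=
    integral_nonneg fun x => mul_nonneg (hk x) (sq_nonneg _)
  have h2 : ∫ x, k x * (f x * g x) ∂μ ≤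
      √(∫ x, k x * f x ^ 2 ∂μ) * √(∫ x, k x * g x ^ 2 ∂μ) := by
    rw [← Real.sqrt_mul hf0]
    exact Real.le_sqrt_of_sq_le (sq_integral_weight_mul_le hk hf hg hfg)
  rw [integral_weight_sub_sq hf hg hfg, sub_sq, Real.sq_sqrt hf0, Real.sq_sqrt hg0]
  linarith

end CauchySchwarz

/-! ### The heat semigroup on bounded functions -/

section Bounded

variable {u : EuclideanSpace ℝ (Fin n) → ℝ} {M t : ℝ}

theorem integrable_mul_of_abs_le {α : Type*} [MeasurableSpace α] {μ : Measure α} {g v : α → ℝ}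
    (hg : Integrable g μ) (hv : Measurable v) (hM : ∀ x, |v x| ≤ M) :
    Integrable (fun x => g x * v x) μ :=
  hg.mul_bdd (c := M) hv.aestronglyMeasurable (.of_forall hM)

theorem integrable_heatKernel_mul (ht : 0 < t) (hu : Measurable u) (hM : ∀ x, |u x| ≤ M)
    (x : EuclideanSpace ℝ (Fin n)) : Integrable (fun z => heatKernel t (x - z) * u z) :=
  integrable_mul_of_abs_le (integrable_heatKernel_sub ht x) hu hM

theorem measurable_heatSemigroup (t : ℝ) (hu : Measurable u) : Measurable (heatSemigroup t u) := by
  have h : StronglyMeasurable (fun p : EuclideanSpace ℝ (Fin n) × EuclideanSpace ℝ (Fin n) =>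
      heatKernel t (p.1 - p.2) * u p.2) :=
    (((measurable_heatKernel t).comp (measurable_fst.sub measurable_snd)).mul
      (hu.comp measurable_snd)).stronglyMeasurable
  exact h.integral_prod_right'.measurable

theorem abs_heatSemigroup_le_heatSemigroup_abs (ht : 0 < t)
    (u : EuclideanSpace ℝ (Fin n) → ℝ) (x : EuclideanSpace ℝ (Fin n)) :
    |heatSemigroup t u x| ≤ heatSemigroup t (fun z => |u z|) x := by
  unfold heatSemigroup
  refine (abs_integral_le_integral_abs).trans_eq ?_
  congr 1; ext z
  rw [abs_mul, abs_of_nonneg (heatKernel_nonneg ht _)]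

theorem heatSemigroup_mono (ht : 0 < t) {v : EuclideanSpace ℝ (Fin n) → ℝ} {M' : ℝ}
    (hu : Measurable u) (hM : ∀ x, |u x| ≤ M) (hv : Measurable v) (hM' : ∀ x, |v x| ≤ M')
    (h : ∀ x, u x ≤ v x) (x : EuclideanSpace ℝ (Fin n)) :
    heatSemigroup t u x ≤ heatSemigroup t v x :=
  integral_mono (integrable_heatKernel_mul ht hu hM x) (integrable_heatKernel_mul ht hv hM' x)
    fun z => mul_le_mul_of_nonneg_left (h z) (heatKernel_nonneg ht _)

theorem heatSemigroup_nonneg (ht : 0 < t) (h : ∀ x, 0 ≤ u x) (x : EuclideanSpace ℝ (Fin n)) :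
    0 ≤ heatSemigroup t u x :=
  integral_nonneg fun z => mul_nonneg (heatKernel_nonneg ht _) (h z)

theorem heatSemigroup_const (ht : 0 < t) (a : ℝ) (x : EuclideanSpace ℝ (Fin n)) :
    heatSemigroup t (fun _ => a) x = a := by
  unfold heatSemigroup
  rw [integral_mul_const, integral_heatKernel_sub ht, one_mul]

theorem abs_heatSemigroup_le (ht : 0 < t) (hu : Measurable u) (hM : ∀ x, |u x| ≤ M)
    (x : EuclideanSpace ℝ (Fin n)) : |heatSemigroup t u x| ≤ M :=
  (abs_heatSemigroup_le_heatSemigroup_abs ht u x).trans <|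
    (heatSemigroup_mono ht (M' := |M|) hu.abs (by simpa using hM) measurable_const
      (fun _ => le_rfl) hM x).trans_eq (heatSemigroup_const ht M x)

theorem integrable_prod_mul_heatKernel {g : EuclideanSpace ℝ (Fin n) → ℝ} (hg : Integrable g)
    (ht : 0 < t) : Integrable (fun p : EuclideanSpace ℝ (Fin n) × EuclideanSpace ℝ (Fin n) =>
      g p.1 * heatKernel t (p.1 - p.2)) := by
  have hm : AEStronglyMeasurable (fun p : EuclideanSpace ℝ (Fin n) × EuclideanSpace ℝ (Fin n) =>
      g p.1 * heatKernel t (p.1 - p.2)) :=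
    hg.aestronglyMeasurable.comp_fst.mul
      ((measurable_heatKernel t).comp (measurable_fst.sub measurable_snd)).aestronglyMeasurable
  refine (integrable_prod_iff hm).2 ⟨.of_forall fun x =>
    (integrable_heatKernel_sub ht x).const_mul (g x), ?_⟩
  convert hg.norm using 2 with x
  simp_rw [norm_mul, Real.norm_of_nonneg (heatKernel_nonneg ht _)]
  rw [integral_const_mul, integral_heatKernel_sub ht, mul_one]

theorem integrable_prod_mul_heatKernel_mul {g : EuclideanSpace ℝ (Fin n) → ℝ} (hg : Integrable g)
    (ht : 0 < t) (hu : Measurable u) (hM : ∀ x, |u x| ≤ M) :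
    Integrable (fun p : EuclideanSpace ℝ (Fin n) × EuclideanSpace ℝ (Fin n) =>
      g p.1 * (heatKernel t (p.1 - p.2) * u p.2)) := by
  simp_rw [← mul_assoc]
  exact integrable_mul_of_abs_le (integrable_prod_mul_heatKernel hg ht)
    (hu.comp measurable_snd) fun p => hM p.2

/-- The heat semigroup is symmetric. -/
theorem integral_mul_heatSemigroup {g : EuclideanSpace ℝ (Fin n) → ℝ} (hg : Integrable g)
    (ht : 0 < t) (hu : Measurable u) (hM : ∀ x, |u x| ≤ M) :
    ∫ x, g x * heatSemigroup t u x = ∫ z, heatSemigroup t g z * u z := by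
  unfold heatSemigroup
  simp_rw [← integral_const_mul, ← integral_mul_const]
  rw [integral_integral_swap (integrable_prod_mul_heatKernel_mul hg ht hu hM)]
  congr 1; ext z; congr 1; ext x
  rw [heatKernel_sub_comm]; ring

theorem heatSemigroup_heatKernel {s : ℝ} (hs : 0 < s) (ht : 0 < t)
    (x y : EuclideanSpace ℝ (Fin n)) :
    heatSemigroup s (fun z => heatKernel t (z - y)) x = heatKernel (s + t) (x - y) :=
  integral_heatKernel_mul_heatKernel hs ht x y

/-- Symmetry moves the inner semigroup onto the outer kernel, which is integrable; there the
Chapman–Kolmogorov equation applies. -/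
theorem heatSemigroup_heatSemigroup {s : ℝ} (hs : 0 < s) (ht : 0 < t) (hu : Measurable u)
    (hM : ∀ x, |u x| ≤ M) (x : EuclideanSpace ℝ (Fin n)) :
    heatSemigroup s (heatSemigroup t u) x = heatSemigroup (s + t) u x := by
  change ∫ z, heatKernel s (x - z) * heatSemigroup t u z = _
  rw [integral_mul_heatSemigroup (integrable_heatKernel_sub hs x) ht hu hM]
  change _ = ∫ z, heatKernel (s + t) (x - z) * u z
  congr 1; ext z; congr 1
  rw [heatKernel_sub_comm, add_comm, ← heatSemigroup_heatKernel ht hs]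
  congr 1; ext y; rw [heatKernel_sub_comm]

theorem abs_sq_le_of_abs_le {a : ℝ} (h : |a| ≤ M) : |a ^ 2| ≤ M ^ 2 := by
  rw [abs_pow]
  exact pow_le_pow_left₀ (abs_nonneg a) h 2

/-- Jensen's inequality: the heat kernel is a probability density. -/
theorem sq_heatSemigroup_le (ht : 0 < t) (hu : Measurable u) (hM : ∀ x, |u x| ≤ M)
    (x : EuclideanSpace ℝ (Fin n)) :
    heatSemigroup t u x ^ 2 ≤ heatSemigroup t (fun z => u z ^ 2) x := by
  have h := sq_integral_weight_mul_le (μ := volume) (f := fun _ => 1) (g := u)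
    (fun z => heatKernel_nonneg (n := n) ht (x - z))
    (by simpa using integrable_heatKernel_sub ht x)
    (integrable_heatKernel_mul ht (hu.pow_const 2) (fun z => abs_sq_le_of_abs_le (hM z)) x)
    (by simpa using integrable_heatKernel_mul ht hu hM x)
  simp only [one_pow, mul_one, one_mul, integral_heatKernel_sub ht] at h
  exact h

end Bounded

/-! ### Duhamel flows and Gronwall's lemma -/

/-- A bounded function on `[0, T] × ℝⁿ` which, on each time interval, differs from the heat flow by
at most what Gronwall's lemma allows for a potential bounded by `K`. -/
structure IsHeatPerturbation (K T : ℝ) (w : ℝ → EuclideanSpace ℝ (Fin n) → ℝ) : Prop where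
  measurable : ∀ t ∈ Icc 0 T, Measurable (w t)
  bounded : ∃ M, ∀ t ∈ Icc 0 T, ∀ x, |w t x| ≤ M
  abs_sub_le : ∀ s t, 0 ≤ s → s < t → t ≤ T → ∀ x,
    |w t x - heatSemigroup (t - s) (w s) x| ≤
      (Real.exp (K * (t - s)) - 1) * heatSemigroup (t - s) (fun z => |w s z|) x

open Classical in
/-- The right-hand side of Duhamel's formula with initial value `w₀` and source term `F`. -/
noncomputable def duhamelFlow (w₀ : EuclideanSpace ℝ (Fin n) → ℝ)
    (F : ℝ → EuclideanSpace ℝ (Fin n) → ℝ) (t : ℝ) (x : EuclideanSpace ℝ (Fin n)) : ℝ :=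
  -- Time 0 is separate because `heatKernel 0` is a default value and not a Dirac mass.
  if t = 0 then w₀ x else
    heatSemigroup t w₀ x + ∫ s in (0 : ℝ)..t, heatSemigroup (t - s) (F s) x

section Duhamel

variable {w₀ : EuclideanSpace ℝ (Fin n) → ℝ} {F : ℝ → EuclideanSpace ℝ (Fin n) → ℝ} {M₀ M₁ : ℝ}

theorem duhamelFlow_of_pos {t : ℝ} (ht : 0 < t) (x : EuclideanSpace ℝ (Fin n)) :
    duhamelFlow w₀ F t x =
      heatSemigroup t w₀ x + ∫ s in (0 : ℝ)..t, heatSemigroup (t - s) (F s) x := by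
  simp [duhamelFlow, ht.ne']

theorem duhamelFlow_zero : duhamelFlow w₀ F 0 = w₀ := by
  ext x; simp [duhamelFlow]

theorem measurable_heatSemigroup_source
    (hF : Measurable (fun p : ℝ × EuclideanSpace ℝ (Fin n) => F p.1 p.2)) (t : ℝ) :
    Measurable (fun p : EuclideanSpace ℝ (Fin n) × ℝ => heatSemigroup (t - p.2) (F p.2) p.1) := by
  have h : StronglyMeasurable (fun p : (EuclideanSpace ℝ (Fin n) × ℝ) × EuclideanSpace ℝ (Fin n) =>
      heatKernel (t - p.1.2) (p.1.1 - p.2) * F p.1.2 p.2) := by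
    refine Measurable.stronglyMeasurable (Measurable.mul ?_ ?_)
    · exact measurable_heatKernel_prod.comp (by fun_prop :
        Measurable fun p : (EuclideanSpace ℝ (Fin n) × ℝ) × EuclideanSpace ℝ (Fin n) =>
          (t - p.1.2, p.1.1 - p.2))
    · exact hF.comp (by fun_prop :
        Measurable fun p : (EuclideanSpace ℝ (Fin n) × ℝ) × EuclideanSpace ℝ (Fin n) =>
          (p.1.2, p.2))
  exact h.integral_prod_right'.measurable

/-- The open interval excludes r = t, where `heatSemigroup (t - r)` would have no meaning. -/
theorem integral_source_eq_setIntegral {s t : ℝ} (hst : s ≤ t) (x : EuclideanSpace ℝ (Fin n)) :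
    ∫ r in s..t, heatSemigroup (t - r) (F r) x =
      ∫ r in Ioo s t, heatSemigroup (t - r) (F r) x := by
  rw [intervalIntegral.integral_of_le hst, integral_Ioc_eq_integral_Ioo]

theorem abs_integral_source_le (hF : Measurable (fun p : ℝ × EuclideanSpace ℝ (Fin n) => F p.1 p.2))
    (hM₁ : ∀ s x, |F s x| ≤ M₁) {s t : ℝ} (hst : s ≤ t) (x : EuclideanSpace ℝ (Fin n)) :
    |∫ r in s..t, heatSemigroup (t - r) (F r) x| ≤ M₁ * (t - s) := by
  rw [integral_source_eq_setIntegral hst]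
  have := norm_setIntegral_le_of_norm_le_const (μ := volume) (s := Ioo s t) (C := M₁)
    (f := fun r => heatSemigroup (t - r) (F r) x) (by simp) (fun r hr => by
      exact abs_heatSemigroup_le (sub_pos.2 hr.2) (hF.comp measurable_prodMk_left) (hM₁ r) x)
  simpa [Real.volume_real_Ioo_of_le hst] using this

theorem integrableOn_source (hF : Measurable (fun p : ℝ × EuclideanSpace ℝ (Fin n) => F p.1 p.2))
    (hM₁ : ∀ s x, |F s x| ≤ M₁) {s s' t : ℝ} (hst : s' ≤ t) (x : EuclideanSpace ℝ (Fin n)) :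
    IntegrableOn (fun r => heatSemigroup (t - r) (F r) x) (Ioo s s') := by
  refine Measure.integrableOn_of_bounded (M := M₁) (by simp)
    ((measurable_heatSemigroup_source hF t).comp measurable_prodMk_left).aestronglyMeasurable ?_
  filter_upwards [ae_restrict_mem measurableSet_Ioo] with r hr
  exact abs_heatSemigroup_le (sub_pos.2 (hr.2.trans_le hst)) (hF.comp measurable_prodMk_left)
    (hM₁ r) x

theorem measurable_integral_source
    (hF : Measurable (fun p : ℝ × EuclideanSpace ℝ (Fin n) => F p.1 p.2)) {t : ℝ} (ht : 0 ≤ t) :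
    Measurable (fun x => ∫ s in (0 : ℝ)..t, heatSemigroup (t - s) (F s) x) := by
  simp_rw [integral_source_eq_setIntegral ht]
  exact ((measurable_heatSemigroup_source hF t).stronglyMeasurable.integral_prod_right'
    (ν := volume.restrict (Ioo 0 t))).measurable

theorem measurable_duhamelFlow (hw₀ : Measurable w₀)
    (hF : Measurable (fun p : ℝ × EuclideanSpace ℝ (Fin n) => F p.1 p.2)) {t : ℝ} (ht : 0 ≤ t) :
    Measurable (duhamelFlow w₀ F t) := by
  rcases ht.eq_or_lt with rfl | ht
  · rwa [duhamelFlow_zero]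
  · rw [funext (duhamelFlow_of_pos ht)]
    exact (measurable_heatSemigroup t hw₀).add (measurable_integral_source hF ht.le)

theorem abs_duhamelFlow_le (hw₀ : Measurable w₀) (hM₀ : ∀ x, |w₀ x| ≤ M₀)
    (hF : Measurable (fun p : ℝ × EuclideanSpace ℝ (Fin n) => F p.1 p.2))
    (hM₁ : ∀ s x, |F s x| ≤ M₁) {t : ℝ} (ht : 0 ≤ t) (x : EuclideanSpace ℝ (Fin n)) :
    |duhamelFlow w₀ F t x| ≤ M₀ + M₁ * t := by
  rcases ht.eq_or_lt with rfl | ht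
  · simpa [duhamelFlow_zero] using hM₀ x
  · rw [duhamelFlow_of_pos ht]
    refine (abs_add_le _ _).trans (add_le_add (abs_heatSemigroup_le ht hw₀ hM₀ x) ?_)
    simpa using abs_integral_source_le hF hM₁ ht.le x

theorem heatSemigroup_integral_source
    (hF : Measurable (fun p : ℝ × EuclideanSpace ℝ (Fin n) => F p.1 p.2))
    (hM₁ : ∀ s x, |F s x| ≤ M₁) {s t : ℝ} (hs : 0 ≤ s) (hst : s < t)
    (x : EuclideanSpace ℝ (Fin n)) :
    heatSemigroup (t - s) (fun z => ∫ r in (0 : ℝ)..s, heatSemigroup (s - r) (F r) z) x =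
      ∫ r in Ioo 0 s, heatSemigroup (t - r) (F r) x := by
  have hts : 0 < t - s := sub_pos.2 hst
  simp_rw [integral_source_eq_setIntegral hs]
  change ∫ z, heatKernel (t - s) (x - z) * _ = _
  simp_rw [← integral_const_mul]
  rw [integral_integral_swap]
  · refine setIntegral_congr_fun measurableSet_Ioo fun r hr => ?_
    have := heatSemigroup_heatSemigroup hts (sub_pos.2 hr.2)
      (hF.comp measurable_prodMk_left : Measurable (F r)) (hM₁ r) x
    rw [sub_add_sub_cancel] at this
    exact this
  · have h1 : Integrable (fun p : EuclideanSpace ℝ (Fin n) × ℝ => heatKernel (t - s) (x - p.1))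
        (volume.prod (volume.restrict (Ioo 0 s))) := (integrable_heatKernel_sub hts x).comp_fst _
    refine h1.mul_bdd (c := M₁) (measurable_heatSemigroup_source hF s).aestronglyMeasurable ?_
    have e : (volume : Measure (EuclideanSpace ℝ (Fin n))).prod (volume.restrict (Ioo 0 s)) =
        (volume.prod volume).restrict (univ ×ˢ Ioo 0 s) := by
      rw [← Measure.prod_restrict, Measure.restrict_univ]
    rw [e]
    filter_upwards [ae_restrict_mem (MeasurableSet.univ.prod measurableSet_Ioo)] with p hp
    exact abs_heatSemigroup_le (sub_pos.2 hp.2.2) (hF.comp measurable_prodMk_left) (hM₁ p.2) p.1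

/-- Fubini and the semigroup law let the flow be restarted at any time s, so that Gronwall's
argument can begin at s instead of 0. -/
theorem duhamelFlow_restart (hw₀ : Measurable w₀) (hM₀ : ∀ x, |w₀ x| ≤ M₀)
    (hF : Measurable (fun p : ℝ × EuclideanSpace ℝ (Fin n) => F p.1 p.2))
    (hM₁ : ∀ s x, |F s x| ≤ M₁) {s t : ℝ} (hs : 0 ≤ s) (hst : s < t)
    (x : EuclideanSpace ℝ (Fin n)) :
    duhamelFlow w₀ F t x = heatSemigroup (t - s) (duhamelFlow w₀ F s) x +
      ∫ r in s..t, heatSemigroup (t - r) (F r) x := by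
  have ht := hs.trans_lt hst
  have hts : 0 < t - s := sub_pos.2 hst
  rcases hs.eq_or_lt with rfl | hs
  · rw [duhamelFlow_zero, duhamelFlow_of_pos ht, sub_zero]
  · have e : heatSemigroup (t - s) (duhamelFlow w₀ F s) x =
        heatSemigroup (t - s) (heatSemigroup s w₀) x +
        heatSemigroup (t - s) (fun z => ∫ r in (0 : ℝ)..s, heatSemigroup (s - r) (F r) z) x := by
      rw [funext (duhamelFlow_of_pos hs)]
      unfold heatSemigroup
      simp_rw [mul_add]
      exact integral_add
        (integrable_heatKernel_mul hts (measurable_heatSemigroup s hw₀)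
          (abs_heatSemigroup_le hs hw₀ hM₀) x)
        (integrable_heatKernel_mul hts (measurable_integral_source hF hs.le)
          (fun z => abs_integral_source_le hF hM₁ hs.le z) x)
    rw [e, heatSemigroup_heatSemigroup hts hs hw₀ hM₀, sub_add_cancel,
      heatSemigroup_integral_source hF hM₁ hs.le hst, duhamelFlow_of_pos ht,
      ← integral_Ioc_eq_integral_Ioo, ← intervalIntegral.integral_of_le hs.le, add_assoc,
      intervalIntegral.integral_add_adjacent_intervals]
    · rw [intervalIntegrable_iff_integrableOn_Ioo_of_le hs.le]
      exact integrableOn_source hF hM₁ hst.le x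
    · rw [intervalIntegrable_iff_integrableOn_Ioo_of_le hst.le]
      exact integrableOn_source hF hM₁ le_rfl x

/-- The time integral of one Gronwall iteration: the exponential term reproduces itself, while the
remainder gains a power and a factorial. -/
theorem integral_exp_add_pow (K Q M s t : ℝ) (m : ℕ) :
    ∫ r in s..t, (K * Real.exp (K * (r - s)) * Q + K * (M * (K * (r - s)) ^ m / m.factorial)) =
      (Real.exp (K * (t - s)) - 1) * Q + M * (K * (t - s)) ^ (m + 1) / (m + 1).factorial := by
  have h : ∀ r ∈ uIcc s t, HasDerivAt
      (fun r => Real.exp (K * (r - s)) * Q + M * (K * (r - s)) ^ (m + 1) / (m + 1).factorial)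
      (K * Real.exp (K * (r - s)) * Q + K * (M * (K * (r - s)) ^ m / m.factorial)) r := by
    intro r _
    have h1 : HasDerivAt (fun r => K * (r - s)) K r := by
      simpa using ((hasDerivAt_id r).sub_const s).const_mul K
    refine (((h1.exp).mul_const Q).add
      (((h1.pow (m + 1)).const_mul M).div_const ((m + 1).factorial : ℝ))).congr_deriv ?_
    have : (m.factorial : ℝ) ≠ 0 := by positivity
    rw [Nat.factorial_succ]
    push_cast
    field_simp
  rw [intervalIntegral.integral_eq_sub_of_hasDerivAt h
    (Continuous.intervalIntegrable (by fun_prop) _ _)]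
  simp
  ring

/-- One Gronwall iteration, starting at s. The source at time r is dominated by K|w(r)|, hence by
the assumed bound at r. By the semigroup law the heat flow from r to t carries e^{(r-s)Δ}|w(s)| to
e^{(t-s)Δ}|w(s)|, which no longer depends on r. -/
theorem abs_duhamelFlow_sub_le_of_bound {K T M s : ℝ} (hw₀ : Measurable w₀)
    (hM₀ : ∀ x, |w₀ x| ≤ M₀)
    (hF : Measurable (fun p : ℝ × EuclideanSpace ℝ (Fin n) => F p.1 p.2))
    (hM₁ : ∀ s x, |F s x| ≤ M₁) (hK : 0 ≤ K)
    (hFK : ∀ᵐ s ∂volume.restrict (Ioo 0 T), ∀ᵐ z, |F s z| ≤ K * |duhamelFlow w₀ F s z|)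
    (hs : 0 ≤ s) (m : ℕ)
    (hbound : ∀ t, s < t → t ≤ T → ∀ x, |duhamelFlow w₀ F t x| ≤
      Real.exp (K * (t - s)) * heatSemigroup (t - s) (fun z => |duhamelFlow w₀ F s z|) x +
        M * (K * (t - s)) ^ m / m.factorial)
    {t : ℝ} (hst : s < t) (htT : t ≤ T) (x : EuclideanSpace ℝ (Fin n)) :
    |duhamelFlow w₀ F t x - heatSemigroup (t - s) (duhamelFlow w₀ F s) x| ≤
      (Real.exp (K * (t - s)) - 1) *
        heatSemigroup (t - s) (fun z => |duhamelFlow w₀ F s z|) x +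
      M * (K * (t - s)) ^ (m + 1) / (m + 1).factorial := by
  set D := duhamelFlow w₀ F with hD
  have hDm : Measurable (fun z => |D s z|) := (measurable_duhamelFlow hw₀ hF hs).abs
  have hDb : ∀ z, |(fun z => |D s z|) z| ≤ M₀ + M₁ * s := fun z => by
    rw [abs_abs]; exact abs_duhamelFlow_le hw₀ hM₀ hF hM₁ hs z
  rw [hD, duhamelFlow_restart hw₀ hM₀ hF hM₁ hs hst x, ← hD, add_sub_cancel_left,
    ← integral_exp_add_pow, ← Real.norm_eq_abs]
  refine intervalIntegral.norm_integral_le_of_norm_le (μ := volume) hst.le ?_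
    (Continuous.intervalIntegrable ?_ _ _)
  swap
  · fun_prop
  have h1 := ae_restrict_iff' (μ := volume) measurableSet_Ioo |>.1 hFK
  filter_upwards [h1, Measure.ae_ne volume t] with r hr hrt' hrst
  have hrt : r < t := lt_of_le_of_ne hrst.2 hrt'
  have h2 := hr ⟨hs.trans_lt hrst.1, hrt.trans_le htT⟩
  have htr : 0 < t - r := sub_pos.2 hrt
  have hrs : 0 < r - s := sub_pos.2 hrst.1
  set Q := heatSemigroup (r - s) (fun z => |D s z|) with hQ
  have hQm : Measurable Q := measurable_heatSemigroup _ hDm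
  have hQb : ∀ z, |Q z| ≤ M₀ + M₁ * s := abs_heatSemigroup_le hrs hDm hDb
  set a := K * Real.exp (K * (r - s))
  set b := K * (M * (K * (r - s)) ^ m / m.factorial)
  rw [Real.norm_eq_abs]
  refine (abs_heatSemigroup_le_heatSemigroup_abs htr _ _).trans ?_
  have hint := integrable_heatKernel_mul htr hQm hQb x
  have e : heatSemigroup (t - s) (fun z => |D s z|) x = heatSemigroup (t - r) Q x := by
    rw [hQ, heatSemigroup_heatSemigroup htr hrs hDm hDb, sub_add_sub_cancel]
  have e2 : a * heatSemigroup (t - r) Q x + b =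
      ∫ z, (heatKernel (t - r) (x - z) * (a * Q z + b)) := by
    have : ∀ z, heatKernel (t - r) (x - z) * (a * Q z + b) =
      a * (heatKernel (t - r) (x - z) * Q z) + heatKernel (t - r) (x - z) * b := fun z => by ring
    simp_rw [this]
    rw [integral_add (hint.const_mul _) ((integrable_heatKernel_sub htr x).mul_const _),
      integral_const_mul, integral_mul_const, integral_heatKernel_sub htr, one_mul]
    rfl
  rw [e, e2]
  refine integral_mono_ae ?_ ?_ ?_
  · exact integrable_heatKernel_mul htr (hF.comp measurable_prodMk_left).abs
      (M := M₁) (fun z => by rw [abs_abs]; exact hM₁ r z) x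
  · refine ((hint.const_mul a).add ((integrable_heatKernel_sub htr x).mul_const b)).congr
      (.of_forall fun z => ?_)
    simp only [Pi.add_apply]; ring
  · filter_upwards [h2] with z hz
    refine mul_le_mul_of_nonneg_left ?_ (heatKernel_nonneg htr _)
    refine hz.trans ((mul_le_mul_of_nonneg_left
      (hbound r hrst.1 (hrt.le.trans htT) z) hK).trans_eq ?_)
    simp only [a, b, hQ]; ring

/-- A Duhamel flow whose source is dominated by `K` times the flow itself is a perturbation of the
heat flow. -/
theorem isHeatPerturbation_duhamelFlow {K T : ℝ} (hw₀ : Measurable w₀)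
    (hM₀ : ∀ x, |w₀ x| ≤ M₀)
    (hF : Measurable (fun p : ℝ × EuclideanSpace ℝ (Fin n) => F p.1 p.2))
    (hM₁ : ∀ s x, |F s x| ≤ M₁) (hK : 0 ≤ K)
    (hFK : ∀ᵐ s ∂volume.restrict (Ioo 0 T), ∀ᵐ z, |F s z| ≤ K * |duhamelFlow w₀ F s z|) :
    IsHeatPerturbation K T (duhamelFlow w₀ F) := by
  have hM₁0 : 0 ≤ M₁ := (abs_nonneg _).trans (hM₁ 0 0)
  have hM₀0 : 0 ≤ M₀ := (abs_nonneg _).trans (hM₀ 0)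
  have hb : ∀ t ∈ Icc 0 T, ∀ x, |duhamelFlow w₀ F t x| ≤ M₀ + M₁ * T := fun t ht x =>
    (abs_duhamelFlow_le hw₀ hM₀ hF hM₁ ht.1 x).trans (by gcongr; exact ht.2)
  refine ⟨fun t ht => measurable_duhamelFlow hw₀ hF ht.1, ⟨_, hb⟩, fun s t hs hst htT x => ?_⟩
  -- For m = 0 the remainder is the uniform bound of the flow. Each iteration improves it, and in
  -- the limit the factorial removes it.
  have hbound : ∀ m : ℕ, ∀ t, s < t → t ≤ T → ∀ x, |duhamelFlow w₀ F t x| ≤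
      Real.exp (K * (t - s)) * heatSemigroup (t - s) (fun z => |duhamelFlow w₀ F s z|) x +
        (M₀ + M₁ * T) * (K * (t - s)) ^ m / m.factorial := by
    intro m
    induction m with
    | zero =>
      intro t hst htT x
      have := heatSemigroup_nonneg (sub_pos.2 hst) (fun z => abs_nonneg (duhamelFlow w₀ F s z)) x
      have h2 := hb t ⟨hs.trans hst.le, htT⟩ x
      have h3 := mul_nonneg (Real.exp_pos (K * (t - s))).le this
      simp only [pow_zero, Nat.factorial_zero, Nat.cast_one, mul_one, div_one]
      linarith
    | succ m ih =>
      intro t hst htT x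
      have h := abs_duhamelFlow_sub_le_of_bound hw₀ hM₀ hF hM₁ hK hFK hs m ih hst htT x
      have h2 := abs_heatSemigroup_le_heatSemigroup_abs (sub_pos.2 hst) (duhamelFlow w₀ F s) x
      have h3 := abs_sub_abs_le_abs_sub (duhamelFlow w₀ F t x)
        (heatSemigroup (t - s) (duhamelFlow w₀ F s) x)
      linarith
  have hlim : Filter.Tendsto (fun m : ℕ => (Real.exp (K * (t - s)) - 1) *
        heatSemigroup (t - s) (fun z => |duhamelFlow w₀ F s z|) x +
      (M₀ + M₁ * T) * (K * (t - s)) ^ (m + 1) / (m + 1).factorial) Filter.atTop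
      (nhds ((Real.exp (K * (t - s)) - 1) *
        heatSemigroup (t - s) (fun z => |duhamelFlow w₀ F s z|) x + (M₀ + M₁ * T) * 0)) := by
    refine tendsto_const_nhds.add ?_
    simp_rw [mul_div_assoc]
    exact ((Filter.tendsto_add_atTop_iff_nat 1).2
      (FloorSemiring.tendsto_pow_div_factorial_atTop (K * (t - s)))).const_mul _
  rw [mul_zero, add_zero] at hlim
  exact ge_of_tendsto' hlim fun m =>
    abs_duhamelFlow_sub_le_of_bound hw₀ hM₀ hF hM₁ hK hFK hs m (hbound m) hst htT x

end Duhamel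

/-! ### The heat flow in Gaussian weighted norms -/

section Weighted

variable {u v : EuclideanSpace ℝ (Fin n) → ℝ} {M M' c l : ℝ}

/-- With times cl and (1 - c)l the completed square is centered at c • y, and its time c(1 - c)l is
the length of the step that follows in the progression l, cl, c²l. -/
theorem heatKernel_mul_heatKernel_sub (hc : 0 < c) (hc1 : c < 1) (hl : 0 < l)
    (x y : EuclideanSpace ℝ (Fin n)) :
    heatKernel (c * l) x * heatKernel ((1 - c) * l) (x - y) =
      heatKernel l y * heatKernel (c * (1 - c) * l) (c • y - x) := by
  have h1 : 0 < 1 - c := sub_pos.2 hc1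
  rw [heatKernel_mul_heatKernel (by positivity) (by positivity), ← add_mul,
    heatKernel_sub_comm _ x]
  have e1 : (c + (1 - c)) * l = l := by ring
  rw [e1, show c * l * ((1 - c) * l) / l = c * (1 - c) * l by field_simp,
    show c * l / l = c by field_simp]

theorem integrable_heatKernel_mul_of_abs_le (hl : 0 < l) (hu : Measurable u)
    (hM : ∀ x, |u x| ≤ M) : Integrable (fun x => heatKernel l x * u x) :=
  integrable_mul_of_abs_le (integrable_heatKernel hl) hu hM

theorem integrable_heatKernel_mul_sq (hl : 0 < l) (hu : Measurable u)
    (hM : ∀ x, |u x| ≤ M) : Integrable (fun x => heatKernel l x * u x ^ 2) :=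
  integrable_heatKernel_mul_of_abs_le hl (hu.pow_const 2) fun x => abs_sq_le_of_abs_le (hM x)

theorem integrable_heatKernel_mul_mul (hl : 0 < l) (hu : Measurable u)
    (hM : ∀ x, |u x| ≤ M) (hv : Measurable v) (hM' : ∀ x, |v x| ≤ M') :
    Integrable (fun x => heatKernel l x * (u x * v x)) :=
  integrable_heatKernel_mul_of_abs_le (M := M * M') hl (hu.mul hv) fun x => by
    rw [abs_mul]
    exact mul_le_mul (hM x) (hM' x) (abs_nonneg _) ((abs_nonneg _).trans (hM x))

theorem integral_heatKernel_mul_sq_nonneg (hl : 0 < l) (u : EuclideanSpace ℝ (Fin n) → ℝ) :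
    0 ≤ ∫ x, heatKernel l x * u x ^ 2 :=
  integral_nonneg fun x => mul_nonneg (heatKernel_nonneg hl x) (sq_nonneg _)

/-- With Gaussian weights of widths in geometric progression, the adjoint of a heat flow step is the
next heat flow step up to scaling. -/
theorem sq_integral_mul_heatSemigroup_le (hc : 0 < c) (hc1 : c < 1) (hl : 0 < l)
    (hu : Measurable u) (hM : ∀ x, |u x| ≤ M) (hv : Measurable v) (hM' : ∀ x, |v x| ≤ M') :
    (∫ x, heatKernel (c * l) x * (v x * heatSemigroup ((1 - c) * l) u x)) ^ 2 ≤
      (∫ x, heatKernel (c * (c * l)) x * heatSemigroup ((1 - c) * (c * l)) v x ^ 2) *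
        ∫ x, heatKernel l x * u x ^ 2 := by
  have h1 : 0 < 1 - c := sub_pos.2 hc1
  have hd : 0 < (1 - c) * (c * l) := by positivity
  have hS := abs_heatSemigroup_le hd hv hM'
  have hSm := measurable_heatSemigroup ((1 - c) * (c * l)) hv
  -- The semigroup is moved onto the weighted function; regrouping the two kernels leaves the weight
  -- of time l and the next step evaluated at c • z.
  have e1 : ∫ x, heatKernel (c * l) x * (v x * heatSemigroup ((1 - c) * l) u x) =
      ∫ z, heatKernel l z * (heatSemigroup ((1 - c) * (c * l)) v (c • z) * u z) := by
    rw [show (fun x => heatKernel (c * l) x * (v x * heatSemigroup ((1 - c) * l) u x)) =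
        fun x => (heatKernel (c * l) x * v x) * heatSemigroup ((1 - c) * l) u x from
          funext fun x => (mul_assoc _ _ _).symm, integral_mul_heatSemigroup
      (integrable_heatKernel_mul_of_abs_le (by positivity) hv hM') (by positivity) hu hM]
    congr 1; ext z
    rw [← mul_assoc]
    congr 1
    unfold heatSemigroup
    rw [← integral_const_mul]
    congr 1; ext x
    have := heatKernel_mul_heatKernel_sub hc hc1 hl x z
    rw [show c * (1 - c) * l = (1 - c) * (c * l) by ring] at this
    rw [heatKernel_sub_comm]
    linear_combination v x * this
  -- The dilation by c turns the weight of time c²l into that of time l, so the first Cauchy–Schwarz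
  -- factor is the norm after the next step.
  have e2 : ∫ x, heatKernel (c * (c * l)) x * heatSemigroup ((1 - c) * (c * l)) v x ^ 2 =
      ∫ z, heatKernel l z * heatSemigroup ((1 - c) * (c * l)) v (c • z) ^ 2 := by
    have := Measure.integral_comp_smul (volume : Measure (EuclideanSpace ℝ (Fin n)))
      (fun x => heatKernel (c * (c * l)) x * heatSemigroup ((1 - c) * (c * l)) v x ^ 2) c
    rw [finrank_euclideanSpace_fin, abs_of_pos (by positivity), smul_eq_mul,
      eq_inv_mul_iff_mul_eq₀ (by positivity), ← integral_const_mul] at this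
    rw [← this]
    congr 1; ext z
    rw [← mul_assoc, show c * (c * l) = c ^ 2 * l by ring, heatKernel_smul hc hl]
  rw [e1, e2]
  exact sq_integral_weight_mul_le (heatKernel_nonneg hl)
    (integrable_heatKernel_mul_sq hl (hSm.comp (measurable_const_smul c)) fun x => hS _)
    (integrable_heatKernel_mul_sq hl hu hM)
    (integrable_heatKernel_mul_mul hl (hSm.comp (measurable_const_smul c)) (fun x => hS _) hu hM)

theorem integral_heatKernel_mul_heatSemigroup {s t : ℝ} (hs : 0 < s) (ht : 0 < t)
    (hu : Measurable u) (hM : ∀ x, |u x| ≤ M) :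
    ∫ x, heatKernel s x * heatSemigroup t u x = ∫ x, heatKernel (s + t) x * u x := by
  rw [integral_mul_heatSemigroup (integrable_heatKernel hs) ht hu hM]
  congr 1; ext z; congr 1
  simpa [add_comm t] using heatSemigroup_heatKernel ht hs z 0

/-- The heat flow is a contraction between the Gaussian weighted spaces. -/
theorem integral_heatKernel_mul_sq_heatSemigroup_le {s t : ℝ} (hs : 0 < s) (ht : 0 < t)
    (hu : Measurable u) (hM : ∀ x, |u x| ≤ M) :
    ∫ x, heatKernel s x * heatSemigroup t u x ^ 2 ≤ ∫ x, heatKernel (s + t) x * u x ^ 2 := by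
  have hM2 : ∀ x, |u x ^ 2| ≤ M ^ 2 := fun x => abs_sq_le_of_abs_le (hM x)
  rw [← integral_heatKernel_mul_heatSemigroup hs ht (hu.pow_const 2) hM2]
  refine integral_mono ?_ ?_ fun x =>
    mul_le_mul_of_nonneg_left (sq_heatSemigroup_le ht hu hM x) (heatKernel_nonneg hs x)
  · exact integrable_heatKernel_mul_sq hs (measurable_heatSemigroup t hu)
      (abs_heatSemigroup_le ht hu hM)
  · exact integrable_heatKernel_mul_of_abs_le hs (measurable_heatSemigroup t (hu.pow_const 2))
      (abs_heatSemigroup_le ht (hu.pow_const 2) hM2)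

/-- The inverse Gaussian grows more slowly than the kernel of time t decays, because s + t > t;
completing the square makes the integral explicit. -/
theorem heatSemigroup_inv_heatKernel {s t : ℝ} (hs : 0 < s) (ht : 0 < t)
    (x : EuclideanSpace ℝ (Fin n)) :
    heatSemigroup t (fun z => (heatKernel (s + t) z)⁻¹) x =
      ((s / (s + t)) ^ n)⁻¹ * (heatKernel s x)⁻¹ := by
  have hst : 0 < s + t := add_pos hs ht
  unfold heatSemigroup
  have e : ∀ z, heatKernel t (x - z) * (heatKernel (s + t) z)⁻¹ =
      (heatKernel s x)⁻¹ * heatKernel (s * t / (s + t)) (x - (s / (s + t)) • z) := by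
    intro z
    have h1 := (heatKernel_pos hs x).ne'
    have h2 := (heatKernel_pos hst z).ne'
    have := heatKernel_mul_heatKernel hs ht x z
    field_simp
    linarith
  simp_rw [e]
  rw [integral_const_mul, Measure.integral_comp_smul volume
    (fun y => heatKernel (s * t / (s + t)) (x - y)), integral_heatKernel_sub (by positivity),
    finrank_euclideanSpace_fin, abs_of_pos (by positivity), smul_eq_mul, mul_one, mul_comm]

/-- Cauchy–Schwarz after splitting u into √G u and 1/√G with G the kernel of time s + t. Unlike
Jensen's inequality it leaves a Gaussian factor on u², the source of the gain at infinity. -/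
theorem sq_heatSemigroup_le_mul {s t : ℝ} (hs : 0 < s) (ht : 0 < t)
    (hu : Measurable u) (hM : ∀ x, |u x| ≤ M) (x : EuclideanSpace ℝ (Fin n)) :
    heatSemigroup t u x ^ 2 ≤ heatSemigroup t (fun z => heatKernel (s + t) z * u z ^ 2) x *
      (((s / (s + t)) ^ n)⁻¹ * (heatKernel s x)⁻¹) := by
  have hst : 0 < s + t := add_pos hs ht
  have hk := fun z => heatKernel_pos (n := n) hst z
  have e1 : ∀ z, √(heatKernel (s + t) z) * u z * √(heatKernel (s + t) z)⁻¹ = u z := fun z => by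
    rw [Real.sqrt_inv]
    have := (Real.sqrt_pos.2 (hk z)).ne'
    field_simp
  have e2 : ∀ z, (√(heatKernel (s + t) z) * u z) ^ 2 = heatKernel (s + t) z * u z ^ 2 := fun z => by
    rw [mul_pow, Real.sq_sqrt (hk z).le]
  have e3 : ∀ z, (√(heatKernel (s + t) z)⁻¹) ^ 2 = (heatKernel (s + t) z)⁻¹ := fun z =>
    Real.sq_sqrt (inv_pos.2 (hk z)).le
  have h3 := heatSemigroup_inv_heatKernel hs ht x
  have hpos : 0 < ((s / (s + t)) ^ n)⁻¹ * (heatKernel s x)⁻¹ := by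
    have := heatKernel_pos hs x
    positivity
  have hi1 : Integrable fun z => heatKernel t (x - z) * (heatKernel (s + t) z * u z ^ 2) := by
    refine integrable_heatKernel_mul ht 
      (M := heatKernel (s + t) (0 : EuclideanSpace ℝ (Fin n)) * M ^ 2)
      ((measurable_heatKernel (s + t)).mul (hu.pow_const 2)) (fun z => ?_) x
    rw [Pi.mul_apply, abs_mul, abs_of_pos (hk z)]
    exact mul_le_mul (heatKernel_le_heatKernel_zero hst z) (abs_sq_le_of_abs_le (hM z))
      (abs_nonneg _) (hk 0).le
  have h := sq_integral_weight_mul_le (μ := volume)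
    (f := fun z => √(heatKernel (s + t) z) * u z) (g := fun z => √(heatKernel (s + t) z)⁻¹)
    (fun z => heatKernel_nonneg (n := n) ht (x - z))
    (by simp_rw [e2]; exact hi1)
    (by simp_rw [e3]
        exact .of_integral_ne_zero (h3.trans_ne hpos.ne'))
    (by simp_rw [e1]; exact integrable_heatKernel_mul ht hu hM x)
  simp_rw [e1, e2, e3] at h
  exact h.trans_eq (congrArg _ h3)

/-- The exponents compare because 1/(1 + c²) + 1/2 ≥ 1 + (1 - c)/2, with difference c(1 - c)²/(2(1 +
c²)). The prefactors collapse to ((1 + c²)/2)^{-n/2}, and (1 + c²)/2 ≥ c. -/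
theorem heatKernel_constant_le (hc : 0 < c) (hl : 0 < l) (x : EuclideanSpace ℝ (Fin n)) :
    (((1 + c) * l / (2 * l)) ^ n)⁻¹ * (heatKernel ((1 + c) ^ 2 * l)
        (0 : EuclideanSpace ℝ (Fin n)))⁻¹ *
      (heatKernel ((1 + c ^ 2) * l) x * heatKernel (2 * l) x) ≤
    c ^ (-(n : ℝ) / 2) * (heatKernel l x * Real.exp (-((1 - c) * ‖x‖ ^ 2 / (8 * l)))) := by
  have e0 : (((1 + c) * l / (2 * l)) ^ n)⁻¹ = (((1 + c) / 2) ^ 2) ^ (-(n : ℝ) / 2) := by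
    rw [← Real.rpow_natCast _ 2, ← Real.rpow_mul (by positivity),
      show ((2 : ℕ) : ℝ) * (-n / 2) = -(n : ℝ) by push_cast; ring, Real.rpow_neg (by positivity),
      Real.rpow_natCast, mul_div_mul_right _ _ hl.ne']
  have e1 : (((1 + c) / 2) ^ 2) ^ (-(n : ℝ) / 2) *
      ((4 * Real.pi * ((1 + c) ^ 2 * l)) ^ (-(n : ℝ) / 2))⁻¹ *
      ((4 * Real.pi * ((1 + c ^ 2) * l)) ^ (-(n : ℝ) / 2) *
        (4 * Real.pi * (2 * l)) ^ (-(n : ℝ) / 2)) =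
      ((1 + c ^ 2) / 2) ^ (-(n : ℝ) / 2) * (4 * Real.pi * l) ^ (-(n : ℝ) / 2) := by
    rw [← Real.inv_rpow (by positivity), ← Real.mul_rpow (by positivity) (by positivity),
      ← Real.mul_rpow (by positivity) (by positivity),
      ← Real.mul_rpow (by positivity) (by positivity),
      ← Real.mul_rpow (by positivity) (by positivity)]
    congr 1
    field_simp
  have e2 : ((1 + c ^ 2) / 2) ^ (-(n : ℝ) / 2) ≤ c ^ (-(n : ℝ) / 2) := by
    refine Real.rpow_le_rpow_of_nonpos hc (by nlinarith [sq_nonneg (1 - c)]) ?_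
    rw [neg_div]
    exact neg_nonpos.2 (by positivity)
  have e3 : -‖x‖ ^ 2 / (4 * ((1 + c ^ 2) * l)) + -‖x‖ ^ 2 / (4 * (2 * l)) ≤
      -‖x‖ ^ 2 / (4 * l) + -((1 - c) * ‖x‖ ^ 2 / (8 * l)) := by
    have h : (-‖x‖ ^ 2 / (4 * l) + -((1 - c) * ‖x‖ ^ 2 / (8 * l))) -
        (-‖x‖ ^ 2 / (4 * ((1 + c ^ 2) * l)) + -‖x‖ ^ 2 / (4 * (2 * l))) =
        ‖x‖ ^ 2 * (c * (1 - c) ^ 2) / (8 * l * (1 + c ^ 2)) := by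
      field_simp
      ring
    have : 0 ≤ ‖x‖ ^ 2 * (c * (1 - c) ^ 2) / (8 * l * (1 + c ^ 2)) := by positivity
    linarith
  rw [e0, heatKernel_zero]
  unfold heatKernel
  calc _ = (((1 + c) / 2) ^ 2) ^ (-(n : ℝ) / 2) *
      ((4 * Real.pi * ((1 + c) ^ 2 * l)) ^ (-(n : ℝ) / 2))⁻¹ *
      ((4 * Real.pi * ((1 + c ^ 2) * l)) ^ (-(n : ℝ) / 2) *
        (4 * Real.pi * (2 * l)) ^ (-(n : ℝ) / 2)) *
        (Real.exp (-‖x‖ ^ 2 / (4 * ((1 + c ^ 2) * l))) * Real.exp (-‖x‖ ^ 2 / (4 * (2 * l)))) := by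
        ring
    _ ≤ c ^ (-(n : ℝ) / 2) * (4 * Real.pi * l) ^ (-(n : ℝ) / 2) *
        (Real.exp (-‖x‖ ^ 2 / (4 * l)) * Real.exp (-((1 - c) * ‖x‖ ^ 2 / (8 * l)))) := by
        rw [e1, ← Real.exp_add, ← Real.exp_add]
        gcongr
    _ = _ := by ring

/-- A heat flow step diminishes the part of the weighted norm that lies far from the center. -/
theorem integral_heatKernel_mul_sq_heatSemigroup_le_gaussian (hc : 0 < c) (hc1 : c < 1)
    (hl : 0 < l) (hu : Measurable u) (hM : ∀ x, |u x| ≤ M) :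
    ∫ x, heatKernel (c * l) x * heatSemigroup ((1 - c) * l) u x ^ 2 ≤
      c ^ (-(n : ℝ) / 2) * ∫ x, heatKernel l x *
        (Real.exp (-((1 - c) * ‖x‖ ^ 2 / (8 * l))) * u x ^ 2) := by
  have h1 : 0 < 1 - c := sub_pos.2 hc1
  set A := (((1 + c) * l / (2 * l)) ^ n)⁻¹ *
    (heatKernel ((1 + c) ^ 2 * l) (0 : EuclideanSpace ℝ (Fin n)))⁻¹ with hA
  have hA0 : 0 ≤ A := mul_nonneg (by positivity)
    (inv_nonneg.2 (heatKernel_nonneg (by positivity) _))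
  have hvm : Measurable (fun z => heatKernel (2 * l) z * u z ^ 2) :=
    (measurable_heatKernel (2 * l)).mul (hu.pow_const 2)
  have hvM : ∀ z, |heatKernel (2 * l) z * u z ^ 2| ≤
      heatKernel (2 * l) (0 : EuclideanSpace ℝ (Fin n)) * M ^ 2 := fun z => by
    rw [abs_mul, abs_of_pos (heatKernel_pos (by positivity) z)]
    exact mul_le_mul (heatKernel_le_heatKernel_zero (by positivity) z)
      (abs_sq_le_of_abs_le (hM z)) (abs_nonneg _) (heatKernel_nonneg (by positivity) _)
  have hd : 0 < (1 - c) * l := by positivity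
  -- The choice s = (1 + c)l makes s + t = 2l, and the quotient of the kernels of times cl and (1 +
  -- c)l is again a Gaussian, of time c(1 + c)l.
  have step1 : ∀ x, heatKernel (c * l) x * heatSemigroup ((1 - c) * l) u x ^ 2 ≤
      A * (heatKernel (c * (1 + c) * l) x *
        heatSemigroup ((1 - c) * l) (fun z => heatKernel (2 * l) z * u z ^ 2) x) := by
    intro x
    have h := sq_heatSemigroup_le_mul (s := (1 + c) * l) (t := (1 - c) * l) (by positivity) hd
      hu hM x
    rw [show (1 + c) * l + (1 - c) * l = 2 * l by ring] at h
    have h2 := heatKernel_mul_heatKernel (s := (1 + c) * l) (t := c * (1 + c) * l)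
      (by positivity) (by positivity) x 0
    rw [show (1 + c) * l + c * (1 + c) * l = (1 + c) ^ 2 * l by ring,
      show (1 + c) * l * (c * (1 + c) * l) / ((1 + c) ^ 2 * l) = c * l by field_simp, sub_zero,
      smul_zero, sub_zero] at h2
    have p1 := (heatKernel_pos (show 0 < (1 + c) * l by positivity) x).ne'
    have p2 := (heatKernel_pos (show 0 < (1 + c) ^ 2 * l by positivity)
      (0 : EuclideanSpace ℝ (Fin n))).ne'
    have h3 : heatKernel (c * l) x * (heatKernel ((1 + c) * l) x)⁻¹ =
      (heatKernel ((1 + c) ^ 2 * l) (0 : EuclideanSpace ℝ (Fin n)))⁻¹ *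
        heatKernel (c * (1 + c) * l) x := by
      rw [← div_eq_mul_inv, inv_mul_eq_div, div_eq_div_iff p1 p2]
      linarith
    refine (mul_le_mul_of_nonneg_left h (heatKernel_nonneg (by positivity) x)).trans_eq ?_
    rw [hA]
    linear_combination (heatSemigroup ((1 - c) * l) (fun z => heatKernel (2 * l) z * u z ^ 2) x *
      (((1 + c) * l / (2 * l)) ^ n)⁻¹) * h3
  -- Moving the step onto the weight adds the times: c(1 + c)l + (1 - c)l = (1 + c²)l.
  have step2 : ∫ x, heatKernel (c * l) x * heatSemigroup ((1 - c) * l) u x ^ 2 ≤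
      ∫ x, A * (heatKernel ((1 + c ^ 2) * l) x * (heatKernel (2 * l) x * u x ^ 2)) := by
    have e := integral_heatKernel_mul_heatSemigroup (s := c * (1 + c) * l) (by positivity) hd
      hvm hvM
    rw [show c * (1 + c) * l + (1 - c) * l = (1 + c ^ 2) * l by ring] at e
    rw [integral_const_mul, ← e, ← integral_const_mul]
    refine integral_mono ?_ ?_ step1
    · exact integrable_heatKernel_mul_sq (by positivity) (measurable_heatSemigroup _ hu)
        (abs_heatSemigroup_le hd hu hM)
    · exact (integrable_heatKernel_mul_of_abs_le (by positivity)
        (measurable_heatSemigroup _ hvm) (abs_heatSemigroup_le hd hvm hvM)).const_mul _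
  refine step2.trans ?_
  rw [← integral_const_mul]
  refine integral_mono ?_ ?_ fun x => ?_
  · exact (integrable_heatKernel_mul_of_abs_le (by positivity) hvm hvM).const_mul _
  · refine (integrable_heatKernel_mul_of_abs_le hl (M := M ^ 2) (by fun_prop) fun x => ?_).const_mul _
    rw [abs_mul, Real.abs_exp]
    refine (mul_le_of_le_one_left (abs_nonneg _) (Real.exp_le_one_iff.2 ?_)).trans
      (abs_sq_le_of_abs_le (hM x))
    exact neg_nonpos.2 (by positivity)
  · have := mul_le_mul_of_nonneg_right (heatKernel_constant_le hc hl x) (sq_nonneg (u x))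
    simp only
    linarith

end Weighted

/-! ### Discrete monotonicity of the frequency -/

section Sequence

/-- A discrete form of the monotonicity of the frequency function: if the norms `b k` do not
decrease too much over the first `m'` steps, then the last contraction factor `a m / b m` is close
to one. -/
theorem frequency_propagation {a b : ℕ → ℝ} {m m' : ℕ} {x ε : ℝ} (hm : m' ≤ m)
    (hx : 0 ≤ x) (hε : 0 ≤ ε) (hsmall : x + ε + m * ε ^ 2 ≤ 1 / 8)
    (ha : ∀ k ≤ m, 0 ≤ a k) (hb : ∀ k ≤ m, 0 ≤ b k) (hab : ∀ k ≤ m, a k ≤ b k)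
    (h1 : ∀ k < m, |b (k + 1) - a k| ≤ ε * b k)
    (h2 : ∀ k < m, (b (k + 1) ^ 2 + a k ^ 2 - ε ^ 2 * b k ^ 2) / 2 ≤ a (k + 1) * b k)
    (h3 : b 0 ≤ Real.exp (x * m') * b m') (hm' : 0 < m') :
    7 / 8 * b m ≤ a m := by
  rcases (hb m le_rfl).eq_or_lt with hbm | hbm
  · rw [← hbm]; simpa using ha m le_rfl
  -- Downwards from m: if b k vanished, then so would a k, and the perturbation bound would force b
  -- (k + 1) = 0.
  have hpos : ∀ k ≤ m, 0 < b k := by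
    intro k hk
    induction hk using Nat.decreasingInduction with
    | self => exact hbm
    | of_succ k hk ih =>
      have h := abs_le.1 (h1 k hk)
      have := hab k hk.le
      have h0 := hb k hk.le
      by_contra hcon
      have : b k = 0 := le_antisymm (not_lt.1 hcon) h0
      rw [this] at h
      linarith
  have hmε : 0 ≤ m * ε ^ 2 := by positivity
  -- If each of the first m' steps contracted by more than 1 - x - ε, then b m' would be less than
  -- (1 - x)^{m'} b 0 ≤ e^{-xm'} b 0, against the assumption.
  obtain ⟨k, hk, hak⟩ : ∃ k < m', (1 - x - ε) * b k ≤ a k := by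
    by_contra! hcon
    have key : ∀ k ≤ m', 0 < k → b k < (1 - x) ^ k * b 0 := by
      intro k hk hk0
      induction k with
      | zero => exact absurd hk0 (lt_irrefl 0)
      | succ k ih =>
        have hk' : k < m' := hk
        have e1 := (abs_le.1 (h1 k (hk'.trans_le hm))).2
        have e2 := hcon k hk'
        have e3 : b k ≤ (1 - x) ^ k * b 0 := by
          rcases Nat.eq_zero_or_pos k with rfl | hkp
          · simp
          · exact (ih hk'.le hkp).le
        have : b (k + 1) < (1 - x) * b k := by linarith
        refine this.trans_le ?_
        rw [pow_succ', mul_assoc]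
        exact mul_le_mul_of_nonneg_left e3 (by linarith)
    have e1 := key m' le_rfl hm'
    have e2 : (1 - x) ^ m' ≤ Real.exp (-(x * m')) := by
      have : 1 - x ≤ Real.exp (-x) := by linarith [Real.add_one_le_exp (-x)]
      calc (1 - x) ^ m' ≤ Real.exp (-x) ^ m' := pow_le_pow_left₀ (by linarith) this _
        _ = Real.exp (-(x * m')) := by rw [← Real.exp_nat_mul]; congr 1; ring
    have e3 : b m' < Real.exp (-(x * m')) * (Real.exp (x * m') * b m') :=
      e1.trans_le (mul_le_mul e2 h3 (hb 0 (Nat.zero_le _)) (Real.exp_pos _).le)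
    rw [← mul_assoc, ← Real.exp_add] at e3
    simp at e3
  -- The ratio a / b loses at most ε² per step: the arithmetic-geometric mean inequality in `h2`
  -- gives b (j + 1) a j - ε² b j² / 2 ≤ a (j + 1) b j, and b j ≤ 2 b (j + 1). A loss of order ε
  -- would not be summable, as ε is of order 1/m.
  have key : ∀ j, k ≤ j → j ≤ m → (1 - x - ε - (j - k : ℕ) * ε ^ 2) * b j ≤ a j := by
    intro j hj
    induction j, hj using Nat.le_induction with
    | base => intro _; simpa using hak
    | succ j hj ih =>
      intro hjm
      have ihj := ih (Nat.le_of_succ_le hjm)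
      have bj := hpos j (Nat.le_of_succ_le hjm)
      have bj1 := hpos (j + 1) hjm
      have e1 := (abs_le.1 (h1 j hjm)).1
      have e2 := h2 j hjm
      have hle : ((j - k : ℕ) : ℝ) * ε ^ 2 ≤ m * ε ^ 2 := by
        gcongr
        omega
      set y := 1 - x - ε - (j - k : ℕ) * ε ^ 2 with hy
      have hy7 : 7 / 8 ≤ y := by linarith
      have e3 : b j / 2 ≤ b (j + 1) := by nlinarith
      rw [show j + 1 - k = (j - k) + 1 by omega]
      push_cast
      have e4 : b (j + 1) * a j - ε ^ 2 * b j ^ 2 / 2 ≤ a (j + 1) * b j := by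
        nlinarith [sq_nonneg (b (j + 1) - a j)]
      have e5 : (y - ε ^ 2) * b (j + 1) * b j ≤ a (j + 1) * b j := by
        refine le_trans ?_ e4
        have f1 : b (j + 1) * (y * b j) ≤ b (j + 1) * a j := by gcongr
        have f2 : ε ^ 2 * b j * (b j / 2) ≤ ε ^ 2 * b j * b (j + 1) := by gcongr
        nlinarith
      have e6 := le_of_mul_le_mul_right e5 bj
      rw [hy] at e6
      linarith
  have := key m (hk.le.trans hm) le_rfl
  have hle : ((m - k : ℕ) : ℝ) * ε ^ 2 ≤ m * ε ^ 2 := by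
    gcongr
    omega
  refine le_trans ?_ this
  gcongr
  linarith

end Sequence

/-! ### One step of a perturbed flow in weighted norms -/

namespace IsHeatPerturbation

variable {K T : ℝ} {w : ℝ → EuclideanSpace ℝ (Fin n) → ℝ}

/-- The squared Gronwall bound, followed by the contraction estimate that widens the weight by t -
s. -/
theorem integral_heatKernel_mul_sub_sq_le (hw : IsHeatPerturbation K T w) (hK : 0 ≤ K)
    {s t l ε : ℝ} (hl : 0 < l) (hs : 0 ≤ s) (hst : s < t) (ht : t ≤ T)
    (hε : Real.exp (K * (t - s)) - 1 ≤ ε) :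
    ∫ x, heatKernel l x * (w t x - heatSemigroup (t - s) (w s) x) ^ 2 ≤
      ε ^ 2 * ∫ x, heatKernel (l + (t - s)) x * w s x ^ 2 := by
  obtain ⟨M, hM⟩ := hw.bounded
  have hts : 0 < t - s := sub_pos.2 hst
  have hsI : s ∈ Icc 0 T := ⟨hs, hst.le.trans ht⟩
  have htI : t ∈ Icc 0 T := ⟨hs.trans hst.le, ht⟩
  have ms := hw.measurable s hsI
  have mt := hw.measurable t htI
  have hMa : ∀ x, |(fun z => |w s z|) x| ≤ M := fun x => by rw [abs_abs]; exact hM s hsI x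
  have hε0 : 0 ≤ Real.exp (K * (t - s)) - 1 := by
    linarith [Real.add_one_le_exp (K * (t - s)), mul_nonneg hK hts.le]
  have h := integral_heatKernel_mul_sq_heatSemigroup_le hl hts ms.abs hMa
  simp_rw [sq_abs] at h
  refine le_trans ?_ (mul_le_mul_of_nonneg_left h (sq_nonneg ε))
  rw [← integral_const_mul]
  refine integral_mono ?_ ?_ fun x => ?_
  · refine integrable_heatKernel_mul_sq hl (M := M + M)
      (mt.sub (measurable_heatSemigroup _ ms)) fun x => ?_
    exact (abs_sub _ _).trans (add_le_add (hM t htI x) (abs_heatSemigroup_le hts ms (hM s hsI) x))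
  · exact (integrable_heatKernel_mul_sq hl (measurable_heatSemigroup _ ms.abs)
      (abs_heatSemigroup_le hts ms.abs hMa)).const_mul _
  · have h1 := hw.abs_sub_le s t hs hst ht x
    have h0 := heatSemigroup_nonneg hts (fun z => abs_nonneg (w s z)) x
    have h2 := h1.trans (mul_le_mul_of_nonneg_right hε h0)
    have h3 := sq_le_sq' (neg_le_of_abs_le h2) (le_of_abs_le h2)
    have := mul_le_mul_of_nonneg_left h3 (heatKernel_nonneg hl x)
    simp only
    linarith

variable (w) in
/-- The weighted norm of `w` at time `t`. -/
noncomputable def gaussianNorm (t l : ℝ) : ℝ := √(∫ x, heatKernel l x * w t x ^ 2)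

variable (w) in
/-- The weighted norm after a step of the unperturbed heat flow. -/
noncomputable def gaussianStepNorm (t c l : ℝ) : ℝ :=
  √(∫ x, heatKernel (c * l) x * heatSemigroup ((1 - c) * l) (w t) x ^ 2)

section Step

variable {t c l ε : ℝ}

theorem gaussianStepNorm_le (hw : IsHeatPerturbation K T w) (hc : 0 < c) (hc1 : c < 1)
    (hl : 0 < l) (ht : t ∈ Icc 0 T) :
    gaussianStepNorm w t c l ≤ gaussianNorm w t l := by
  obtain ⟨M, hM⟩ := hw.bounded
  have h1 : 0 < 1 - c := sub_pos.2 hc1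
  refine Real.sqrt_le_sqrt ?_
  have := integral_heatKernel_mul_sq_heatSemigroup_le (s := c * l) (t := (1 - c) * l)
    (by positivity) (by positivity) (hw.measurable t ht) (hM t ht)
  rwa [show c * l + (1 - c) * l = l by ring] at this

/-- The two hypotheses of `frequency_propagation`. The first is the reverse triangle inequality. For
the second, expanding the squared error expresses the scalar product of w and the free step by their
squared norms, with a loss of only ε²; the adjoint estimate bounds it from above. -/
theorem abs_gaussianNorm_sub_le (hw : IsHeatPerturbation K T w) (hK : 0 ≤ K) (hc : 0 < c)
    (hc1 : c < 1) (hl : 0 < l) (ht : 0 ≤ t) (ht' : t + (1 - c) * l ≤ T)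
    (hε : Real.exp (K * ((1 - c) * l)) - 1 ≤ ε) :
    |gaussianNorm w (t + (1 - c) * l) (c * l) - gaussianStepNorm w t c l| ≤
      ε * gaussianNorm w t l ∧
    (gaussianNorm w (t + (1 - c) * l) (c * l) ^ 2 + gaussianStepNorm w t c l ^ 2 -
      ε ^ 2 * gaussianNorm w t l ^ 2) / 2 ≤
      gaussianStepNorm w (t + (1 - c) * l) c (c * l) * gaussianNorm w t l := by
  obtain ⟨M, hM⟩ := hw.bounded
  have h1 : 0 < 1 - c := sub_pos.2 hc1
  have hd : 0 < (1 - c) * l := by positivity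
  have hcl : 0 < c * l := by positivity
  have htI : t ∈ Icc 0 T := ⟨ht, by linarith⟩
  have htI' : t + (1 - c) * l ∈ Icc 0 T := ⟨by linarith, ht'⟩
  have m1 := hw.measurable t htI
  have m2 := hw.measurable _ htI'
  have mS := measurable_heatSemigroup ((1 - c) * l) m1
  have bS := abs_heatSemigroup_le hd m1 (hM t htI)
  have hε0 : 0 ≤ ε := by
    linarith [Real.add_one_le_exp (K * ((1 - c) * l)), mul_nonneg hK hd.le]
  have herr := hw.integral_heatKernel_mul_sub_sq_le hK hcl ht (t := t + (1 - c) * l)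
    (ε := ε) (by linarith) ht' (by simpa using hε)
  rw [add_sub_cancel_left, show c * l + (1 - c) * l = l by ring] at herr
  have i1 := integrable_heatKernel_mul_sq hcl m2 (hM _ htI')
  have i2 := integrable_heatKernel_mul_sq hcl mS bS
  have i3 := integrable_heatKernel_mul_mul hcl m2 (hM _ htI') mS bS
  have tri := sq_sqrt_integral_weight_sub_le (heatKernel_nonneg hcl) i1 i2 i3
  have expd := integral_weight_sub_sq i1 i2 i3
  have cs := sq_integral_mul_heatSemigroup_le hc hc1 hl m1 (hM t htI) m2 (hM _ htI')
  have n1 := integral_heatKernel_mul_sq_nonneg hcl (w (t + (1 - c) * l))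
  have n2 := integral_heatKernel_mul_sq_nonneg hcl (heatSemigroup ((1 - c) * l) (w t))
  have n3 := integral_heatKernel_mul_sq_nonneg hl (w t)
  have n4 := integral_heatKernel_mul_sq_nonneg (l := c * (c * l)) (by positivity)
    (heatSemigroup ((1 - c) * (c * l)) (w (t + (1 - c) * l)))
  unfold gaussianNorm gaussianStepNorm
  constructor
  · refine abs_le_of_sq_le_sq (tri.trans ?_) (mul_nonneg hε0 (Real.sqrt_nonneg _))
    rwa [mul_pow, Real.sq_sqrt n3]
  · rw [Real.sq_sqrt n1, Real.sq_sqrt n2, Real.sq_sqrt n3, ← Real.sqrt_mul n4]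
    refine le_trans ?_ (Real.le_sqrt_of_sq_le cs)
    linarith

end Step

end IsHeatPerturbation

/-! ### Concentration of the weighted mass at the final time -/

/-- The ratio c = 2^{-1/m}, for which m steps halve the time parameter of the weight. Bernoulli's
inequality and 1/e < 1/2 show that 1 - c is comparable to 1/m. -/
theorem exists_pow_eq_half {m : ℕ} (hm : 0 < m) :
    ∃ c : ℝ, 0 < c ∧ c < 1 ∧ c ^ m = 1 / 2 ∧ 1 / (2 * m) ≤ 1 - c ∧ 1 - c ≤ 1 / m := by
  have hm' : (0 : ℝ) < m := by exact_mod_cast hm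
  have hpow : ((1 / 2 : ℝ) ^ (1 / (m : ℝ))) ^ m = 1 / 2 := by
    rw [← Real.rpow_natCast, ← Real.rpow_mul (by norm_num)]
    field_simp
    simp
  have hc0 : 0 < (1 / 2 : ℝ) ^ (1 / (m : ℝ)) := by positivity
  refine ⟨(1 / 2 : ℝ) ^ (1 / (m : ℝ)), hc0,
    Real.rpow_lt_one (by norm_num) (by norm_num) (by positivity), hpow, ?_, ?_⟩
  · by_contra! hcon
    have h1 : 1 - 1 / (2 * (m : ℝ)) < (1 / 2 : ℝ) ^ (1 / (m : ℝ)) := by linarith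
    have h0 : (0 : ℝ) ≤ 1 - 1 / (2 * m) := by
      have : 1 / (2 * (m : ℝ)) ≤ 1 := by
        rw [div_le_one (by positivity)]
        have : (1 : ℝ) ≤ m := by exact_mod_cast hm
        linarith
      linarith
    have h2 := pow_lt_pow_left₀ h1 h0 hm.ne'
    have h3 := one_add_mul_le_pow (a := -(1 / (2 * (m : ℝ)))) (by linarith) m
    rw [hpow] at h2
    rw [← sub_eq_add_neg] at h3
    have : 1 + (m : ℝ) * -(1 / (2 * (m : ℝ))) = 1 / 2 := by field_simp; norm_num
    linarith
  · by_contra! hcon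
    have h1 : (1 / 2 : ℝ) ^ (1 / (m : ℝ)) < 1 - 1 / m := by linarith
    have h2 := pow_lt_pow_left₀ h1 hc0.le hm.ne'
    have h3 : 1 - 1 / (m : ℝ) ≤ Real.exp (-(1 / m)) := by
      linarith [Real.add_one_le_exp (-(1 / (m : ℝ)))]
    have h4 := pow_le_pow_left₀ (hc0.le.trans h1.le) h3 m
    rw [← Real.exp_nat_mul, show (m : ℝ) * -(1 / m) = -1 by field_simp, Real.exp_neg] at h4
    have h5 : (Real.exp 1)⁻¹ < 1 / 2 := by
      rw [inv_lt_comm₀ (Real.exp_pos 1) (by norm_num)]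
      have := Real.exp_one_gt_d9
      norm_num
      linarith
    rw [hpow] at h2
    linarith

/-- The left side is at most c^{-m/4} = 2^{1/4}; so the dimensional loss of the last step is
harmless once m ≥ 2n. -/
theorem rpow_neg_div_two_le {c : ℝ} {m : ℕ} (hc : 0 < c) (hcm : c ^ m = 1 / 2)
    (hc1 : c < 1) (hm : 2 * n ≤ m) : c ^ (-(n : ℝ) / 2) ≤ 5 / 4 := by
  have h1 : c ^ (-(n : ℝ) / 2) ≤ c ^ (-(m : ℝ) / 4) := by
    refine Real.rpow_le_rpow_of_exponent_ge hc hc1.le ?_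
    have : (2 * n : ℝ) ≤ m := by exact_mod_cast hm
    linarith
  refine h1.trans ?_
  have h2 : (c ^ (-(m : ℝ) / 4)) ^ 4 = 2 := by
    rw [← Real.rpow_natCast, ← Real.rpow_mul hc.le,
      show -(m : ℝ) / 4 * ((4 : ℕ) : ℝ) = -(m : ℝ) by push_cast; ring, Real.rpow_neg hc.le,
      Real.rpow_natCast, hcm]
    norm_num
  by_contra! hcon
  have := pow_lt_pow_left₀ hcon (by norm_num) (n := 4) (by norm_num)
  rw [h2] at this
  norm_num at this

theorem exp_sub_one_le_two_mul {y : ℝ} (hy : 0 ≤ y) (hy1 : y ≤ 1) : Real.exp y - 1 ≤ 2 * y := by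
  have := Real.abs_exp_sub_one_sub_id_le (x := y) (by rwa [abs_of_nonneg hy])
  have h := le_of_abs_le this
  nlinarith

namespace IsHeatPerturbation

variable {K T : ℝ} {w : ℝ → EuclideanSpace ℝ (Fin n) → ℝ}

/-- If the weighted norm does not decrease too much from a first to a second earlier time, then the
last step of the heat flow is nearly isometric. -/
theorem gaussianStepNorm_ge (hw : IsHeatPerturbation K T w) (hK : 0 ≤ K)
    {h c x ε : ℝ} {p m : ℕ} (hm : 0 < m) (hh : 0 < h) (hc : 0 < c) (hc1 : c < 1)
    (hcm : c ^ m = 1 / 2) (hT : 2 ^ (p + 1) * h ≤ T + h) (hx : 0 ≤ x)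
    (hε : Real.exp (K * ((1 - c) * (2 ^ (p + 1) * h))) - 1 ≤ ε)
    (hsmall : x + ε + ((p + 1) * m : ℕ) * ε ^ 2 ≤ 1 / 8)
    (hdec : gaussianNorm w (T + h - 2 ^ (p + 1) * h) (2 ^ (p + 1) * h) ≤
      Real.exp (x * m) * gaussianNorm w (T + h - 2 ^ p * h) (2 ^ p * h)) :
    7 / 8 * gaussianNorm w T h ≤ gaussianStepNorm w T c h := by
  have h1 : 0 < 1 - c := sub_pos.2 hc1
  -- The pole of the weight is at time T + h. The scale l k is 2^{p+1}h for k = 0 and 2^p h for k =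
  -- m; it is h, which means time T, for k = (p + 1)m.
  set l : ℕ → ℝ := fun k => 2 ^ (p + 1) * h * c ^ k with hl
  have lpos : ∀ k, 0 < l k := fun k => by positivity
  have lsucc : ∀ k, l (k + 1) = c * l k := fun k => by simp only [hl, pow_succ]; ring
  have l0 : l 0 = 2 ^ (p + 1) * h := by simp [hl]
  have lm' : l m = 2 ^ p * h := by simp only [hl, hcm, pow_succ]; ring
  have lm : l ((p + 1) * m) = h := by
    simp only [hl, mul_comm (p + 1) m, pow_mul, hcm]
    rw [div_pow, one_pow]
    field_simp
  have lanti : Antitone l := antitone_nat_of_succ_le fun k => by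
    rw [lsucc]; exact mul_le_of_le_one_left (lpos k).le hc1.le
  have tpos : ∀ k, 0 ≤ T + h - l k := fun k => by
    have := lanti (Nat.zero_le k)
    rw [l0] at this
    linarith
  have tle : ∀ k ≤ (p + 1) * m, T + h - l k ≤ T := fun k hk => by
    have := lanti hk
    rw [lm] at this
    linarith
  have tsucc : ∀ k, T + h - l (k + 1) = T + h - l k + (1 - c) * l k := fun k => by
    rw [lsucc]; ring
  have hεk : ∀ k, Real.exp (K * ((1 - c) * l k)) - 1 ≤ ε := fun k => by
    refine le_trans ?_ hε
    rw [← l0]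
    have := lanti (Nat.zero_le k)
    gcongr
  have hε0 : 0 ≤ ε := by
    have := hεk 0
    have h2 : 0 ≤ K * ((1 - c) * l 0) := by
      have := lpos 0
      positivity
    linarith [Real.add_one_le_exp (K * ((1 - c) * l 0))]
  have := frequency_propagation (a := fun k => gaussianStepNorm w (T + h - l k) c (l k))
    (b := fun k => gaussianNorm w (T + h - l k) (l k)) (m := (p + 1) * m) (m' := m)
    (x := x) (ε := ε) (Nat.le_mul_of_pos_left m (Nat.succ_pos p)) hx hε0 hsmall
    (fun k _ => Real.sqrt_nonneg _) (fun k _ => Real.sqrt_nonneg _)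
    (fun k hk => hw.gaussianStepNorm_le hc hc1 (lpos k) ⟨tpos k, tle k hk⟩)
    (fun k hk => by
      have := hw.abs_gaussianNorm_sub_le hK hc hc1 (lpos k) (tpos k)
        (by rw [← tsucc]; exact tle _ hk) (hεk k)
      rw [← tsucc, ← lsucc] at this
      exact this.1)
    (fun k hk => by
      have := hw.abs_gaussianNorm_sub_le hK hc hc1 (lpos k) (tpos k)
        (by rw [← tsucc]; exact tle _ hk) (hεk k)
      rw [← tsucc, ← lsucc] at this
      exact this.2)
    (by simp only [l0, lm']; exact hdec) hm
  simpa only [lm, add_sub_cancel_right] using this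

/-- If the weighted norm does not decrease too much between two earlier times, then at time `T` the
weighted mass is concentrated in the ball of radius `r`. -/
theorem integral_heatKernel_le_setIntegral_ball (hw : IsHeatPerturbation K T w) (hK : 0 ≤ K)
    (hT : 0 < T) {h r Λ : ℝ} {p : ℕ} (hh : 0 < h) (hhT : 2 ^ (p + 1) * h ≤ T + h)
    (hh1 : h ≤ T) (hΛ : 0 ≤ Λ) (hr : 0 < r)
    (hrh : 48 * h * (8 * Λ + (32 * (K * T) + 128 * (p + 1) * (K * T) ^ 2 + 2 * n + 1) + 1) ≤ r ^ 2)
    (hdec : ∫ x, heatKernel (2 ^ (p + 1) * h) x * w (T + h - 2 ^ (p + 1) * h) x ^ 2 ≤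
      Real.exp (2 * Λ) * ∫ x, heatKernel (2 ^ p * h) x * w (T + h - 2 ^ p * h) x ^ 2) :
    ∫ x, heatKernel h x * w T x ^ 2 ≤
      3 * ∫ x in Metric.ball 0 r, heatKernel h x * w T x ^ 2 := by
  -- With x = Λ/m and ε = 4KT/m, the bound m ≥ 8Λ + Γ makes x + ε + (p + 1)mε² ≤ 1/8; the term 2n
  -- serves `rpow_neg_div_two_le`, and the 1 makes m positive.
  set Γ := 32 * (K * T) + 128 * (p + 1) * (K * T) ^ 2 + 2 * (n : ℝ) + 1 with hΓ
  have hKT : 0 ≤ K * T := mul_nonneg hK hT.le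
  have hq : 0 ≤ 128 * ((p : ℝ) + 1) * (K * T) ^ 2 := by positivity
  have hn0 : (0 : ℝ) ≤ n := Nat.cast_nonneg n
  set m := ⌈8 * Λ + Γ⌉₊ with hm
  have hm1 : 8 * Λ + Γ ≤ m := Nat.le_ceil _
  have hm2 : (m : ℝ) ≤ 8 * Λ + Γ + 1 := (Nat.ceil_lt_add_one (by linarith)).le
  have hm0R : (0 : ℝ) < m := by linarith
  have hm0 : 0 < m := by exact_mod_cast hm0R
  obtain ⟨c, hc, hc1, hcm, hcl, hcu⟩ := exists_pow_eq_half hm0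
  have h1c : 0 < 1 - c := sub_pos.2 hc1
  have hTI : T ∈ Icc 0 T := ⟨hT.le, le_rfl⟩
  obtain ⟨M, hM⟩ := hw.bounded
  have mw := hw.measurable T hTI
  have hMT := hM T hTI
  have hstep : 7 / 8 * gaussianNorm w T h ≤ gaussianStepNorm w T c h := by
    refine hw.gaussianStepNorm_ge hK (x := Λ / m) (ε := 4 * (K * T) / m) (p := p) hm0 hh hc hc1
      hcm hhT (by positivity) ?_ ?_ ?_
    · have e1 : K * ((1 - c) * (2 ^ (p + 1) * h)) ≤ 2 * (K * T) / m := by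
        calc K * ((1 - c) * (2 ^ (p + 1) * h)) ≤ K * (1 / m * (T + h)) := by gcongr
          _ ≤ K * (1 / m * (2 * T)) := by gcongr; linarith
          _ = 2 * (K * T) / m := by ring
      have e2 : 2 * (K * T) / m ≤ 1 := by
        rw [div_le_one hm0R]
        linarith
      calc _ ≤ Real.exp (2 * (K * T) / m) - 1 := by gcongr
        _ ≤ 2 * (2 * (K * T) / m) := exp_sub_one_le_two_mul (by positivity) e2
        _ = 4 * (K * T) / m := by ring
    · have e : Λ / m + 4 * (K * T) / m + (((p + 1) * m : ℕ) : ℝ) * (4 * (K * T) / m) ^ 2 =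
          (Λ + 4 * (K * T) + 16 * (p + 1) * (K * T) ^ 2) / m := by
        push_cast
        field_simp
        ring
      rw [e, div_le_iff₀ hm0R]
      linarith
    · have e : Λ / m * m = Λ := by field_simp
      rw [e]
      unfold gaussianNorm
      rw [Real.sqrt_le_left (by positivity), mul_pow, Real.sq_sqrt
        (integral_heatKernel_mul_sq_nonneg (by positivity) _), ← Real.exp_nat_mul]
      exact_mod_cast hdec
  have hA := integral_heatKernel_mul_sq_heatSemigroup_le_gaussian hc hc1 hh mw hMT
  set H := ∫ x, heatKernel h x * w T x ^ 2 with hH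
  set Y := ∫ x in Metric.ball 0 r, heatKernel h x * w T x ^ 2 with hY
  have hH0 : 0 ≤ H := integral_heatKernel_mul_sq_nonneg hh _
  have h49 : 49 / 64 * H ≤ ∫ x, heatKernel (c * h) x * heatSemigroup ((1 - c) * h) (w T) x ^ 2 := by
    unfold gaussianNorm gaussianStepNorm at hstep
    have := pow_le_pow_left₀ (by positivity) hstep 2
    rw [mul_pow, Real.sq_sqrt hH0, Real.sq_sqrt
      (integral_heatKernel_mul_sq_nonneg (by positivity) _)] at this
    linarith
  have hc54 : c ^ (-(n : ℝ) / 2) ≤ 5 / 4 := by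
    refine rpow_neg_div_two_le hc hcm hc1 ?_
    have : (2 * n : ℝ) ≤ m := by linarith
    exact_mod_cast this
  have hint := integrable_heatKernel_mul_sq hh mw hMT
  have hsplit : ∫ x, heatKernel h x * (Real.exp (-((1 - c) * ‖x‖ ^ 2 / (8 * h))) * w T x ^ 2) ≤
      Y + 1 / 8 * H := by
    rw [hY, hH, ← integral_indicator Metric.isOpen_ball.measurableSet, ← integral_const_mul,
      ← integral_add (hint.indicator Metric.isOpen_ball.measurableSet) (hint.const_mul _)]
    refine integral_mono ?_ ?_ fun x => ?_
    · refine integrable_heatKernel_mul_of_abs_le hh (M := M ^ 2) (by fun_prop) fun x => ?_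
      rw [abs_mul, Real.abs_exp]
      refine (mul_le_of_le_one_left (abs_nonneg _) (Real.exp_le_one_iff.2 ?_)).trans
        (abs_sq_le_of_abs_le (hMT x))
      exact neg_nonpos.2 (by positivity)
    · exact (hint.indicator Metric.isOpen_ball.measurableSet).add (hint.const_mul _)
    · have hk := mul_nonneg (heatKernel_nonneg hh x) (sq_nonneg (w T x))
      by_cases hx : x ∈ Metric.ball (0 : EuclideanSpace ℝ (Fin n)) r
      · simp only [indicator_of_mem hx]
        have : Real.exp (-((1 - c) * ‖x‖ ^ 2 / (8 * h))) ≤ 1 :=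
          Real.exp_le_one_iff.2 (neg_nonpos.2 (by positivity))
        nlinarith
      · simp only [indicator_of_notMem hx, zero_add]
        have hxr : r ≤ ‖x‖ := by simpa using hx
        -- Outside the ball 1 - c ≥ 1/(2m) and 48hm ≤ r² make the exponent at least 3, and e^{-3} ≤
        -- 1/8.
        have e1 : 3 ≤ (1 - c) * ‖x‖ ^ 2 / (8 * h) := by
          rw [le_div_iff₀ (by positivity)]
          calc 3 * (8 * h) = 1 / (2 * m) * (48 * h * m) := by field_simp; norm_num
            _ ≤ 1 / (2 * m) * r ^ 2 := by
              gcongr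
              refine le_trans ?_ hrh
              gcongr
            _ ≤ (1 - c) * ‖x‖ ^ 2 := by gcongr
        have e2 : Real.exp (-((1 - c) * ‖x‖ ^ 2 / (8 * h))) ≤ 1 / 8 := by
          have : Real.exp 3 ≥ 8 := by
            have h2 : (2 : ℝ) ≤ Real.exp 1 := by linarith [Real.exp_one_gt_d9]
            have := pow_le_pow_left₀ (by norm_num) h2 3
            rw [← Real.exp_nat_mul] at this
            norm_num at this
            exact this
          calc _ ≤ Real.exp (-3) := Real.exp_le_exp.2 (by linarith)
            _ ≤ 1 / 8 := by
              rw [Real.exp_neg, inv_le_comm₀ (Real.exp_pos _) (by norm_num)]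
              norm_num
              exact this
        nlinarith
  have hY0 : 0 ≤ Y := integral_nonneg fun x => mul_nonneg (heatKernel_nonneg hh x) (sq_nonneg _)
  -- Absorbing the H on the right gives H ≤ (80/39) Y.
  have : 49 / 64 * H ≤ 5 / 4 * (Y + 1 / 8 * H) :=
    (h49.trans hA).trans (mul_le_mul hc54 hsplit (integral_nonneg fun x =>
      mul_nonneg (heatKernel_nonneg hh x) (by positivity)) (by norm_num))
  linarith

end IsHeatPerturbation

/-! ### Localization of the energy -/

theorem heatKernel_le_rpow_mul {s t : ℝ} (hs : 0 < s) (hst : s ≤ t)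
    (x : EuclideanSpace ℝ (Fin n)) :
    heatKernel s x ≤ (t / s) ^ ((n : ℝ) / 2) * heatKernel t x := by
  have ht := hs.trans_le hst
  unfold heatKernel
  have e1 : (t / s) ^ ((n : ℝ) / 2) * (4 * Real.pi * t) ^ (-(n : ℝ) / 2) =
      (4 * Real.pi * s) ^ (-(n : ℝ) / 2) := by
    rw [show (n : ℝ) / 2 = -(-(n : ℝ) / 2) by ring, Real.rpow_neg (by positivity),
      ← Real.inv_rpow (by positivity), ← Real.mul_rpow (by positivity) (by positivity)]
    congr 1
    field_simp
  rw [← mul_assoc, e1]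
  refine mul_le_mul_of_nonneg_left (Real.exp_le_exp.2 ?_) (by positivity)
  rw [neg_div, neg_div]
  gcongr

theorem exp_neg_sq_div_eq {t : ℝ} (ht : 0 < t) (x : EuclideanSpace ℝ (Fin n)) :
    Real.exp (-‖x‖ ^ 2 / (4 * t)) =
      (heatKernel t (0 : EuclideanSpace ℝ (Fin n)))⁻¹ * heatKernel t x := by
  have : 0 < (4 * Real.pi * t) ^ (-(n : ℝ) / 2) := by positivity
  rw [heatKernel_zero]
  unfold heatKernel
  field_simp

theorem integrable_indicator_ball (R : ℝ) :
    Integrable (indicator (Metric.ball (0 : EuclideanSpace ℝ (Fin n)) R) (fun _ => (1 : ℝ))) :=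
  (integrable_indicator_iff Metric.isOpen_ball.measurableSet).2
    (integrableOn_const Metric.isBounded_ball.measure_lt_top.ne)

/-- The heat flow of the indicator function of a ball decays like a Gaussian. -/
theorem heatSemigroup_indicator_ball_le {τ T R : ℝ} (hτ : 0 < τ) (hτT : τ ≤ T) (hR : 0 < R)
    (y : EuclideanSpace ℝ (Fin n)) :
    heatSemigroup τ (indicator (Metric.ball 0 R) (fun _ => (1 : ℝ))) y ≤
      indicator (Metric.ball 0 (2 * R)) (fun _ => (1 : ℝ)) y +
        2 ^ ((n : ℝ) / 2) * (heatKernel (16 * T) (0 : EuclideanSpace ℝ (Fin n)))⁻¹ *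
          Real.exp (-(R ^ 2 / (16 * τ))) * heatKernel (16 * T) y := by
  have hT := hτ.trans_le hτT
  have hm : Measurable (indicator (Metric.ball (0 : EuclideanSpace ℝ (Fin n)) R)
      (fun _ => (1 : ℝ))) := measurable_const.indicator Metric.isOpen_ball.measurableSet
  have hb : ∀ x, |indicator (Metric.ball (0 : EuclideanSpace ℝ (Fin n)) R)
      (fun _ => (1 : ℝ)) x| ≤ 1 := fun x => by
    by_cases hx : x ∈ Metric.ball (0 : EuclideanSpace ℝ (Fin n)) R <;> simp [hx]
  have hk0 := heatKernel_pos (show 0 < 16 * T by positivity) (0 : EuclideanSpace ℝ (Fin n))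
  have hky := heatKernel_pos (show 0 < 16 * T by positivity) y
  by_cases hy : y ∈ Metric.ball (0 : EuclideanSpace ℝ (Fin n)) (2 * R)
  · rw [indicator_of_mem hy]
    have := le_of_abs_le (abs_heatSemigroup_le hτ hm hb y)
    have : 0 ≤ 2 ^ ((n : ℝ) / 2) * (heatKernel (16 * T) (0 : EuclideanSpace ℝ (Fin n)))⁻¹ *
          Real.exp (-(R ^ 2 / (16 * τ))) * heatKernel (16 * T) y := by positivity
    linarith
  · rw [indicator_of_notMem hy, zero_add]
    have hyR : 2 * R ≤ ‖y‖ := by simpa using hy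
    -- For ‖y‖ ≥ 2R and z in the ball, ‖y - z‖ ≥ ‖y‖/2. Half of the exponent stays in a kernel of
    -- time 2τ with integral 1; the other half yields e^{-‖y‖²/(32τ)}, shared below between the
    -- factor in R and a Gaussian of time 16T.
    have e1 : heatSemigroup τ (indicator (Metric.ball 0 R) (fun _ => (1 : ℝ))) y ≤
        ∫ z, 2 ^ ((n : ℝ) / 2) * Real.exp (-(‖y‖ ^ 2 / (32 * τ))) * heatKernel (2 * τ) (y - z) := by
      refine integral_mono (integrable_heatKernel_mul hτ hm hb y)
        ((integrable_heatKernel_sub (by positivity) y).const_mul _) fun z => ?_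
      have hk2 := heatKernel_pos (show 0 < 2 * τ by positivity) (y - z)
      by_cases hz : z ∈ Metric.ball (0 : EuclideanSpace ℝ (Fin n)) R
      · simp only [indicator_of_mem hz, mul_one]
        have hzR : ‖z‖ < R := by simpa using hz
        have hyz : ‖y‖ / 2 ≤ ‖y - z‖ := by
          have := norm_sub_norm_le y z
          linarith
        have e2 : heatKernel τ (y - z) = 2 ^ ((n : ℝ) / 2) * heatKernel (2 * τ) (y - z) *
            Real.exp (-(‖y - z‖ ^ 2 / (8 * τ))) := by
          have f1 : (4 * Real.pi * τ) ^ (-(n : ℝ) / 2) =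
              2 ^ ((n : ℝ) / 2) * (4 * Real.pi * (2 * τ)) ^ (-(n : ℝ) / 2) := by
            rw [show (n : ℝ) / 2 = -(-(n : ℝ) / 2) by ring, Real.rpow_neg (by positivity),
              ← Real.inv_rpow (by positivity), ← Real.mul_rpow (by positivity) (by positivity)]
            congr 1
            ring
          have f2 : Real.exp (-‖y - z‖ ^ 2 / (4 * τ)) = Real.exp (-‖y - z‖ ^ 2 / (4 * (2 * τ))) *
              Real.exp (-(‖y - z‖ ^ 2 / (8 * τ))) := by
            rw [← Real.exp_add]
            congr 1
            field_simp
            ring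
          unfold heatKernel
          rw [f1, f2]
          ring
        rw [e2, mul_right_comm]
        gcongr _ * Real.exp ?_ * _
        rw [neg_le_neg_iff]
        calc ‖y‖ ^ 2 / (32 * τ) = (‖y‖ / 2) ^ 2 / (8 * τ) := by ring
          _ ≤ _ := by gcongr
      · simp only [indicator_of_notMem hz, mul_zero]
        positivity
    rw [integral_const_mul, integral_heatKernel_sub (by positivity), mul_one] at e1
    refine e1.trans ?_
    have e3 : Real.exp (-(‖y‖ ^ 2 / (32 * τ))) ≤
        Real.exp (-(R ^ 2 / (16 * τ))) * Real.exp (-‖y‖ ^ 2 / (4 * (16 * T))) := by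
      rw [← Real.exp_add]
      refine Real.exp_le_exp.2 ?_
      have f1 : R ^ 2 / (16 * τ) ≤ ‖y‖ ^ 2 / (64 * τ) := by
        calc R ^ 2 / (16 * τ) = (2 * R) ^ 2 / (64 * τ) := by field_simp; norm_num
          _ ≤ _ := by gcongr
      have f2 : ‖y‖ ^ 2 / (64 * T) ≤ ‖y‖ ^ 2 / (64 * τ) := by gcongr
      have f3 : ‖y‖ ^ 2 / (32 * τ) = ‖y‖ ^ 2 / (64 * τ) + ‖y‖ ^ 2 / (64 * τ) := by
        ring
      have f4 : -‖y‖ ^ 2 / (4 * (16 * T)) = -(‖y‖ ^ 2 / (64 * T)) := by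
        rw [neg_div]; congr 2; ring
      rw [f3, f4]
      linarith
    calc _ ≤ 2 ^ ((n : ℝ) / 2) *
        (Real.exp (-(R ^ 2 / (16 * τ))) * Real.exp (-‖y‖ ^ 2 / (4 * (16 * T)))) := by gcongr
      _ = _ := by rw [exp_neg_sq_div_eq (by positivity)]; ring

namespace IsHeatPerturbation

variable {K T : ℝ} {w : ℝ → EuclideanSpace ℝ (Fin n) → ℝ}

theorem abs_le_exp_mul_heatSemigroup (hw : IsHeatPerturbation K T w) {s t : ℝ} (hs : 0 ≤ s)
    (hst : s < t) (ht : t ≤ T) (x : EuclideanSpace ℝ (Fin n)) :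
    |w t x| ≤ Real.exp (K * (t - s)) * heatSemigroup (t - s) (fun z => |w s z|) x := by
  have h := hw.abs_sub_le s t hs hst ht x
  have h2 := abs_heatSemigroup_le_heatSemigroup_abs (sub_pos.2 hst) (w s) x
  have h3 := abs_sub_abs_le_abs_sub (w t x) (heatSemigroup (t - s) (w s) x)
  linarith

theorem sq_le_exp_mul_heatSemigroup_sq (hw : IsHeatPerturbation K T w) {s t : ℝ} (hs : 0 ≤ s)
    (hst : s < t) (ht : t ≤ T) (x : EuclideanSpace ℝ (Fin n)) :
    w t x ^ 2 ≤ Real.exp (2 * K * (t - s)) * heatSemigroup (t - s) (fun z => w s z ^ 2) x := by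
  obtain ⟨M, hM⟩ := hw.bounded
  have hsI : s ∈ Icc 0 T := ⟨hs, hst.le.trans ht⟩
  have h := pow_le_pow_left₀ (abs_nonneg _) (hw.abs_le_exp_mul_heatSemigroup hs hst ht x) 2
  have h2 := sq_heatSemigroup_le (sub_pos.2 hst) (hw.measurable s hsI).abs
    (M := M) (fun x => by rw [abs_abs]; exact hM s hsI x) x
  simp_rw [sq_abs] at h h2
  rw [mul_pow, ← Real.exp_nat_mul] at h
  refine h.trans ?_
  rw [show ((2 : ℕ) : ℝ) * (K * (t - s)) = 2 * K * (t - s) by push_cast; ring]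
  gcongr

theorem integral_heatKernel_mul_sq_le (hw : IsHeatPerturbation K T w) {s t l : ℝ}
    (hs : 0 ≤ s) (hst : s ≤ t) (ht : t ≤ T) (hl : 0 < l) :
    ∫ x, heatKernel l x * w t x ^ 2 ≤
      Real.exp (2 * K * (t - s)) * ∫ x, heatKernel (l + (t - s)) x * w s x ^ 2 := by
  rcases hst.eq_or_lt with rfl | hst
  · simp
  obtain ⟨M, hM⟩ := hw.bounded
  have hsI : s ∈ Icc 0 T := ⟨hs, hst.le.trans ht⟩
  have htI : t ∈ Icc 0 T := ⟨hs.trans hst.le, ht⟩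
  have m2 := (hw.measurable s hsI).pow_const 2
  have b2 : ∀ x, |w s x ^ 2| ≤ M ^ 2 := fun x => abs_sq_le_of_abs_le (hM s hsI x)
  rw [← integral_heatKernel_mul_heatSemigroup hl (sub_pos.2 hst) m2 b2, ← integral_const_mul]
  refine integral_mono (integrable_heatKernel_mul_sq hl (hw.measurable t htI) (hM t htI))
    ((integrable_heatKernel_mul_of_abs_le hl (measurable_heatSemigroup _ m2)
      (abs_heatSemigroup_le (sub_pos.2 hst) m2 b2)).const_mul _) fun x => ?_
  have := mul_le_mul_of_nonneg_left (hw.sq_le_exp_mul_heatSemigroup_sq hs hst ht x)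
    (heatKernel_nonneg hl x)
  simp only
  linarith

theorem integrableOn_ball_sq (hw : IsHeatPerturbation K T w) {t : ℝ} (ht : t ∈ Icc 0 T)
    (y : EuclideanSpace ℝ (Fin n)) (R : ℝ) :
    IntegrableOn (fun x => w t x ^ 2) (Metric.ball y R) := by
  obtain ⟨M, hM⟩ := hw.bounded
  exact Measure.integrableOn_of_bounded (M := M ^ 2) Metric.isBounded_ball.measure_lt_top.ne
    ((hw.measurable t ht).pow_const 2).aestronglyMeasurable
    (.of_forall fun x => abs_sq_le_of_abs_le (hM t ht x))

theorem setIntegral_ball_sq_le_heatKernel (hw : IsHeatPerturbation K T w) {t l R : ℝ}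
    (ht : t ∈ Icc 0 T) (hl : 0 < l) :
    ∫ x in Metric.ball 0 R, w t x ^ 2 ≤
      (heatKernel l (0 : EuclideanSpace ℝ (Fin n)))⁻¹ * Real.exp (R ^ 2 / (4 * l)) *
        ∫ x, heatKernel l x * w t x ^ 2 := by
  obtain ⟨M, hM⟩ := hw.bounded
  have hint := integrable_heatKernel_mul_sq hl (hw.measurable t ht) (hM t ht)
  have hk0 := heatKernel_pos hl (0 : EuclideanSpace ℝ (Fin n))
  rw [← integral_const_mul]
  calc _ ≤ ∫ x in Metric.ball 0 R, (heatKernel l (0 : EuclideanSpace ℝ (Fin n)))⁻¹ *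
        Real.exp (R ^ 2 / (4 * l)) * (heatKernel l x * w t x ^ 2) := by
        refine setIntegral_mono_on (hw.integrableOn_ball_sq ht 0 R)
          (hint.const_mul _).integrableOn Metric.isOpen_ball.measurableSet fun x hx => ?_
        have hxR : ‖x‖ < R := by simpa using hx
        have e := exp_neg_sq_div_eq hl x
        have : 1 ≤ Real.exp (R ^ 2 / (4 * l)) * Real.exp (-‖x‖ ^ 2 / (4 * l)) := by
          rw [← Real.exp_add, neg_div]
          refine Real.one_le_exp ?_
          have : ‖x‖ ^ 2 / (4 * l) ≤ R ^ 2 / (4 * l) := by gcongr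
          linarith
        rw [e] at this
        have := mul_le_mul_of_nonneg_right this (sq_nonneg (w t x))
        linarith
    _ ≤ _ := by
        refine setIntegral_le_integral (hint.const_mul _) (.of_forall fun x => ?_)
        have := heatKernel_nonneg hl x
        simp only [Pi.zero_apply]
        positivity

/-- By duality the heat flow acts on the indicator function of the ball: energy in B_R at time T
comes from B_{2R} at time t, up to a tail that is small if R² is large against T - t. -/
theorem setIntegral_ball_sq_le (hw : IsHeatPerturbation K T w) (hK : 0 ≤ K) {t R : ℝ}
    (ht : 0 ≤ t) (htT : t < T) (hR : 0 < R) :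
    ∫ x in Metric.ball 0 R, w T x ^ 2 ≤
      Real.exp (2 * (K * T)) * (∫ x in Metric.ball 0 (2 * R), w t x ^ 2) +
      Real.exp (2 * (K * T)) *
        (2 ^ ((n : ℝ) / 2) * (heatKernel (16 * T) (0 : EuclideanSpace ℝ (Fin n)))⁻¹ *
          Real.exp (-(R ^ 2 / (16 * (T - t))))) * ∫ x, heatKernel (16 * T) x * w t x ^ 2 := by
  obtain ⟨M, hM⟩ := hw.bounded
  have hτ : 0 < T - t := sub_pos.2 htT
  have hT : 0 < T := ht.trans_lt htT
  have htI : t ∈ Icc 0 T := ⟨ht, htT.le⟩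
  have hTI : T ∈ Icc 0 T := ⟨hT.le, le_rfl⟩
  have m2 := (hw.measurable t htI).pow_const 2
  have b2 : ∀ x, |w t x ^ 2| ≤ M ^ 2 := fun x => abs_sq_le_of_abs_le (hM t htI x)
  set χ : EuclideanSpace ℝ (Fin n) → ℝ := indicator (Metric.ball 0 R) (fun _ => (1 : ℝ)) with hχ
  have hχi : Integrable χ := integrable_indicator_ball R
  set B := 2 ^ ((n : ℝ) / 2) * (heatKernel (16 * T) (0 : EuclideanSpace ℝ (Fin n)))⁻¹ *
          Real.exp (-(R ^ 2 / (16 * (T - t)))) with hB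
  have hint := integrable_heatKernel_mul_sq (show 0 < 16 * T by positivity)
    (hw.measurable t htI) (hM t htI)
  have e1 : ∫ x in Metric.ball 0 R, w T x ^ 2 = ∫ x, χ x * w T x ^ 2 := by
    rw [← integral_indicator Metric.isOpen_ball.measurableSet]
    congr 1; ext x
    by_cases hx : x ∈ Metric.ball (0 : EuclideanSpace ℝ (Fin n)) R <;> simp [hχ, hx]
  have hχ0 : ∀ x, 0 ≤ χ x := fun x => indicator_nonneg (fun _ _ => zero_le_one) x
  have e2 : ∫ x, χ x * w T x ^ 2 ≤ Real.exp (2 * (K * T)) *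
      ∫ x, χ x * heatSemigroup (T - t) (fun z => w t z ^ 2) x := by
    rw [← integral_const_mul]
    refine integral_mono ?_ ?_ fun x => ?_
    · exact integrable_mul_of_abs_le hχi ((hw.measurable T hTI).pow_const 2)
        (fun x => abs_sq_le_of_abs_le (hM T hTI x))
    · exact (integrable_mul_of_abs_le hχi (measurable_heatSemigroup _ m2)
        (abs_heatSemigroup_le hτ m2 b2)).const_mul _
    · have h1 := hw.sq_le_exp_mul_heatSemigroup_sq ht htT le_rfl x
      have h0 := heatSemigroup_nonneg hτ (fun z => sq_nonneg (w t z)) x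
      have h3 : Real.exp (2 * K * (T - t)) ≤ Real.exp (2 * (K * T)) := by
        refine Real.exp_le_exp.2 ?_
        nlinarith
      have h4 := mul_le_mul_of_nonneg_left
        (h1.trans (mul_le_mul_of_nonneg_right h3 h0)) (hχ0 x)
      simp only
      linarith
  rw [e1]
  refine e2.trans ?_
  rw [integral_mul_heatSemigroup hχi hτ m2 b2, mul_assoc, ← mul_add]
  refine mul_le_mul_of_nonneg_left ?_ (Real.exp_pos _).le
  have hball := (integrable_indicator_iff Metric.isOpen_ball.measurableSet).2
    (hw.integrableOn_ball_sq htI 0 (2 * R))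
  rw [← integral_indicator Metric.isOpen_ball.measurableSet, ← integral_const_mul,
    ← integral_add hball (hint.const_mul _)]
  refine integral_mono_of_nonneg (.of_forall fun x => ?_)
    (hball.add (hint.const_mul _)) (.of_forall fun x => ?_)
  · exact mul_nonneg (heatSemigroup_nonneg hτ hχ0 x) (sq_nonneg _)
  · have h1 := heatSemigroup_indicator_ball_le hτ (by linarith : T - t ≤ T) hR x
    rw [← hB] at h1
    have h2 := mul_le_mul_of_nonneg_right h1 (sq_nonneg (w t x))
    by_cases hx : x ∈ Metric.ball (0 : EuclideanSpace ℝ (Fin n)) (2 * R)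
    · simp only [indicator_of_mem hx] at h2 ⊢
      linarith
    · simp only [indicator_of_notMem hx] at h2 ⊢
      linarith

end IsHeatPerturbation

/-! ### The local interpolation inequality -/

/-- Multiplying by X^θ gives X^{1+θ} ≤ A D^θ E^θ Y; the interpolation exponent is therefore 1/(1 +
θ). -/
theorem le_rpow_mul_rpow_of_le {X E Y A D θ : ℝ} (hX : 0 < X) (hE : 0 < E) (hY : 0 ≤ Y)
    (hA : 0 < A) (hD : 0 < D) (hθ : 0 < θ) (h : X ≤ A * (D * E / X) ^ θ * Y) :
    X ≤ (A * D ^ θ) ^ (1 / (1 + θ)) * E ^ (1 - 1 / (1 + θ)) * Y ^ (1 / (1 + θ)) := by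
  have h1 : X ^ (1 + θ) ≤ A * D ^ θ * E ^ θ * Y := by
    rw [Real.div_rpow (by positivity) hX.le, Real.mul_rpow hD.le hE.le] at h
    rw [Real.rpow_add hX, Real.rpow_one]
    have hXθ : 0 < X ^ θ := by positivity
    calc X * X ^ θ ≤ (A * (D ^ θ * E ^ θ / X ^ θ) * Y) * X ^ θ := by gcongr
      _ = _ := by field_simp
  have h2 := Real.rpow_le_rpow (by positivity) h1 (show 0 ≤ 1 / (1 + θ) by positivity)
  rw [← Real.rpow_mul hX.le, mul_one_div_cancel (by positivity), Real.rpow_one,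
    Real.mul_rpow (by positivity) hY, Real.mul_rpow (by positivity) (by positivity),
    ← Real.rpow_mul hE.le] at h2
  rwa [show 1 - 1 / (1 + θ) = θ * (1 / (1 + θ)) by field_simp; ring]

namespace IsHeatPerturbation

variable {K T : ℝ} {w : ℝ → EuclideanSpace ℝ (Fin n) → ℝ}

/-- One reference quantity for all weighted energies. The time 17T is 16T, the width of the tail
weight, plus the longest possible evolution T. -/
theorem integral_heatKernel_mul_sq_le_initial (hw : IsHeatPerturbation K T w) (hK : 0 ≤ K)
    (hT : 0 < T) {t l : ℝ} (ht : t ∈ Icc 0 T) (hl : 0 < l) (h1 : T ≤ l + t) (h2 : l + t ≤ 17 * T) :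
    ∫ x, heatKernel l x * w t x ^ 2 ≤ Real.exp (2 * (K * T)) * 17 ^ ((n : ℝ) / 2) *
      ∫ x, heatKernel (17 * T) x * w 0 x ^ 2 := by
  obtain ⟨M, hM⟩ := hw.bounded
  have h0I : (0 : ℝ) ∈ Icc 0 T := ⟨le_rfl, hT.le⟩
  have m0 := hw.measurable 0 h0I
  have b0 := hM 0 h0I
  have h := hw.integral_heatKernel_mul_sq_le le_rfl ht.1 ht.2 hl
  rw [sub_zero] at h
  refine h.trans ?_
  rw [mul_assoc (Real.exp (2 * (K * T)))]
  have hexp : Real.exp (2 * K * t) ≤ Real.exp (2 * (K * T)) := by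
    refine Real.exp_le_exp.2 ?_
    nlinarith [ht.2]
  refine mul_le_mul hexp ?_ (integral_heatKernel_mul_sq_nonneg (by linarith) _)
    (Real.exp_pos _).le
  rw [← integral_const_mul]
  refine integral_mono (integrable_heatKernel_mul_sq (by linarith) m0 b0)
    ((integrable_heatKernel_mul_sq (by linarith) m0 b0).const_mul _) fun x => ?_
  have e1 := heatKernel_le_rpow_mul (by linarith : 0 < l + t) h2 x
  have e2 : (17 * T / (l + t)) ^ ((n : ℝ) / 2) ≤ 17 ^ ((n : ℝ) / 2) := by
    refine Real.rpow_le_rpow (div_nonneg (by linarith) (by linarith)) ?_ (by positivity)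
    rw [div_le_iff₀ (by linarith)]
    linarith
  have e3 := e1.trans (mul_le_mul_of_nonneg_right e2 (heatKernel_nonneg (by linarith) x))
  have := mul_le_mul_of_nonneg_right e3 (sq_nonneg (w 0 x))
  simp only
  linarith

/-- The local energy at time `T` is bounded by the weighted energy at a slightly earlier time, if the
time difference is small in terms of the logarithm `Z` of the quotient of the initial energy and the
local energy. -/
theorem setIntegral_ball_le_of_exp_mul_eq (hw : IsHeatPerturbation K T w) (hK : 0 ≤ K)
    {R t q Z D : ℝ} (hR : 0 < R) (ht : 0 ≤ t) (htT : t < T) (hq : 0 < q) (hqT : q ≤ T)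
    (htq : T - t ≤ q) (hZ0 : 0 ≤ Z) (hZq : 16 * q * Z ≤ R ^ 2)
    (hZ : Real.exp Z * (∫ x in Metric.ball 0 R, w T x ^ 2) =
      D * ∫ x, heatKernel (17 * T) x * w 0 x ^ 2)
    (hD : 2 * (Real.exp (2 * (K * T)) * (2 ^ ((n : ℝ) / 2) *
      (heatKernel (16 * T) (0 : EuclideanSpace ℝ (Fin n)))⁻¹) *
      (Real.exp (2 * (K * T)) * 17 ^ ((n : ℝ) / 2))) ≤ D) :
    ∫ x in Metric.ball 0 R, w T x ^ 2 ≤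
      2 * (Real.exp (2 * (K * T)) * ((heatKernel T (0 : EuclideanSpace ℝ (Fin n)))⁻¹ *
        Real.exp (R ^ 2 / q) * ∫ x, heatKernel q x * w t x ^ 2)) := by
  have hT : 0 < T := hq.trans_le hqT
  have htI : t ∈ Icc 0 T := ⟨ht, htT.le⟩
  have hκ := inv_pos.2 (heatKernel_pos (show 0 < 16 * T by positivity)
    (0 : EuclideanSpace ℝ (Fin n)))
  have hκ' := heatKernel_pos hT (0 : EuclideanSpace ℝ (Fin n))
  have e1 := hw.integral_heatKernel_mul_sq_le_initial hK hT htI (l := 16 * T) (by positivity)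
    (by linarith) (by linarith)
  have hE0 : 0 ≤ ∫ x, heatKernel (17 * T) x * w 0 x ^ 2 :=
    integral_heatKernel_mul_sq_nonneg (by positivity) _
  have s1 := hw.setIntegral_ball_sq_le hK ht htT hR
  have s2 := hw.setIntegral_ball_sq_le_heatKernel htI hq (R := 2 * R)
  have hH0 : 0 ≤ ∫ x, heatKernel q x * w t x ^ 2 := integral_heatKernel_mul_sq_nonneg hq _
  have e2 : Real.exp (-(R ^ 2 / (16 * (T - t)))) ≤ Real.exp (-Z) := by
    refine Real.exp_le_exp.2 (neg_le_neg ?_)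
    rw [le_div_iff₀ (by linarith)]
    refine le_trans ?_ hZq
    calc Z * (16 * (T - t)) ≤ Z * (16 * q) := by gcongr
      _ = _ := by ring
  have e3 : (heatKernel q (0 : EuclideanSpace ℝ (Fin n)))⁻¹ ≤
      (heatKernel T (0 : EuclideanSpace ℝ (Fin n)))⁻¹ := by
    refine inv_anti₀ hκ' ?_
    rw [heatKernel_zero, heatKernel_zero]
    refine Real.rpow_le_rpow_of_nonpos (by positivity) (by gcongr) ?_
    rw [neg_div]
    exact neg_nonpos.2 (by positivity)
  rw [show (2 * R) ^ 2 / (4 * q) = R ^ 2 / q by field_simp; norm_num] at s2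
  have hy := Real.exp_pos (-Z)
  have e4 : Real.exp (-Z) * (D * ∫ x, heatKernel (17 * T) x * w 0 x ^ 2) =
      ∫ x in Metric.ball 0 R, w T x ^ 2 := by
    rw [← hZ, ← mul_assoc, ← Real.exp_add]
    simp
  have hI0 : 0 ≤ ∫ x, heatKernel (16 * T) x * w t x ^ 2 :=
    integral_heatKernel_mul_sq_nonneg (by positivity) _
  have hc0 : 0 < (2 : ℝ) ^ ((n : ℝ) / 2) := by positivity
  have hG0 : 0 < Real.exp (2 * (K * T)) * 17 ^ ((n : ℝ) / 2) := by positivity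
  have ha0 := Real.exp_pos (2 * (K * T))
  have hκ'0 := inv_pos.2 hκ'
  have hv0 := Real.exp_pos (R ^ 2 / q)
  generalize Real.exp (2 * (K * T)) * 17 ^ ((n : ℝ) / 2) = G at *
  generalize Real.exp (2 * (K * T)) = a at *
  generalize (heatKernel (16 * T) (0 : EuclideanSpace ℝ (Fin n)))⁻¹ = κ at *
  generalize (heatKernel T (0 : EuclideanSpace ℝ (Fin n)))⁻¹ = κ' at *
  generalize (heatKernel q (0 : EuclideanSpace ℝ (Fin n)))⁻¹ = κ'' at *
  generalize (2 : ℝ) ^ ((n : ℝ) / 2) = c at *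
  generalize ∫ x in Metric.ball 0 R, w T x ^ 2 = X at *
  generalize ∫ x in Metric.ball 0 (2 * R), w t x ^ 2 = X' at *
  generalize ∫ x, heatKernel (17 * T) x * w 0 x ^ 2 = E at *
  generalize ∫ x, heatKernel (16 * T) x * w t x ^ 2 = I at *
  generalize ∫ x, heatKernel q x * w t x ^ 2 = H at *
  generalize Real.exp (-Z) = y at *
  generalize Real.exp (-(R ^ 2 / (16 * (T - t)))) = z at *
  generalize Real.exp (R ^ 2 / q) = v at *
  -- The tail is at most half of X since e^{-Z} D E = X, so it can be absorbed.
  have hfar : a * (c * κ * z) * I ≤ X / 2 :=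
    calc a * (c * κ * z) * I ≤ a * (c * κ * y) * (G * E) := by gcongr
      _ = y * ((2 * (a * (c * κ) * G)) * E) / 2 := by ring
      _ ≤ y * (D * E) / 2 := by gcongr
      _ = X / 2 := by rw [e4]
  have hnear : a * X' ≤ a * (κ' * v * H) := by
    gcongr
    exact s2.trans (by gcongr)
  linarith

/-- The conditional form of the local interpolation inequality: `h` is small in terms of the
logarithm `Z` of the quotient of the initial energy and the final local energy. -/
theorem setIntegral_ball_le_exp_mul (hw : IsHeatPerturbation K T w) (hK : 0 ≤ K) (hT : 0 < T)
    {R r h Z D : ℝ} {p : ℕ} (hR : 0 < R) (hr : 0 < r) (hp : 1 ≤ p)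
    (hpr : 384 * R ^ 2 ≤ 2 ^ p * r ^ 2) (hh : 0 < h) (hhT : 2 ^ (p + 1) * h ≤ T) (hZ0 : 0 ≤ Z)
    (hX : 0 < ∫ x in Metric.ball 0 R, w T x ^ 2)
    (hZ : Real.exp Z * (∫ x in Metric.ball 0 R, w T x ^ 2) =
      D * ∫ x, heatKernel (17 * T) x * w 0 x ^ 2)
    (hD₁ : 2 * (Real.exp (2 * (K * T)) * (2 ^ ((n : ℝ) / 2) *
      (heatKernel (16 * T) (0 : EuclideanSpace ℝ (Fin n)))⁻¹) *
      (Real.exp (2 * (K * T)) * 17 ^ ((n : ℝ) / 2))) ≤ D)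
    (hD₂ : 2 * (Real.exp (2 * (K * T)) * (heatKernel T (0 : EuclideanSpace ℝ (Fin n)))⁻¹ *
      (Real.exp (2 * (K * T)) * 17 ^ ((n : ℝ) / 2))) ≤ D)
    (hZh : 16 * 2 ^ p * h * Z ≤ R ^ 2)
    (hrh : 96 * h * (4 * Z +
      (32 * (K * T) + 128 * (p + 1) * (K * T) ^ 2 + 2 * n + 1) + 1) ≤ r ^ 2) :
    ∫ x in Metric.ball 0 R, w T x ^ 2 ≤
      3 * Real.exp (R ^ 2 / (4 * h)) * ∫ x in Metric.ball 0 r, w T x ^ 2 := by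
  have hTI : T ∈ Icc 0 T := ⟨hT.le, le_rfl⟩
  have hp2 : (2 : ℝ) ≤ 2 ^ p := by
    calc (2 : ℝ) = 2 ^ 1 := by norm_num
      _ ≤ 2 ^ p := pow_le_pow_right₀ (by norm_num) hp
  have hl : 0 < 2 ^ p * h := by positivity
  have hq : 2 ^ p * h ≤ T := by
    rw [pow_succ] at hhT
    linarith
  have hqh : 2 * h ≤ 2 ^ p * h := by gcongr
  have hnear := hw.setIntegral_ball_le_of_exp_mul_eq hK (t := T + h - 2 ^ p * h) hR
    (by linarith) (by linarith) hl hq (by linarith) hZ0 (by linarith) hZ hD₁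
  -- At the earlier scale the weighted energy is at most a constant times E = e^Z X / D; at the
  -- later one it is at least a constant times e^{-R²/(2^p h)} X, because the tail has been
  -- absorbed. The constants cancel by `hD₂`.
  have hdec : ∫ x, heatKernel (2 ^ (p + 1) * h) x * w (T + h - 2 ^ (p + 1) * h) x ^ 2 ≤
      Real.exp (2 * ((Z + R ^ 2 / (2 ^ p * h)) / 2)) *
        ∫ x, heatKernel (2 ^ p * h) x * w (T + h - 2 ^ p * h) x ^ 2 := by
    have e1 := hw.integral_heatKernel_mul_sq_le_initial hK hT (t := T + h - 2 ^ (p + 1) * h)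
      (l := 2 ^ (p + 1) * h) ⟨by linarith, by rw [pow_succ]; linarith⟩ (by positivity)
      (by linarith) (by linarith)
    refine e1.trans ?_
    rw [mul_div_cancel₀ _ (two_ne_zero), Real.exp_add]
    refine le_of_mul_le_mul_right ?_ hX
    have hE0 : 0 ≤ ∫ x, heatKernel (17 * T) x * w 0 x ^ 2 :=
      integral_heatKernel_mul_sq_nonneg (by positivity) _
    have hH0 := integral_heatKernel_mul_sq_nonneg hl (w (T + h - 2 ^ p * h))
    have hG0 : 0 < Real.exp (2 * (K * T)) * 17 ^ ((n : ℝ) / 2) := by positivity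
    have hv0 := Real.exp_pos (R ^ 2 / (2 ^ p * h))
    clear e1 hrh hZh hpr hD₁ hX
    generalize Real.exp (2 * (K * T)) * 17 ^ ((n : ℝ) / 2) = G at *
    generalize Real.exp (2 * (K * T)) = a at *
    generalize (heatKernel T (0 : EuclideanSpace ℝ (Fin n)))⁻¹ = κ' at *
    generalize ∫ x in Metric.ball 0 R, w T x ^ 2 = X at *
    generalize ∫ x, heatKernel (17 * T) x * w 0 x ^ 2 = E at *
    generalize ∫ x, heatKernel (2 ^ p * h) x * w (T + h - 2 ^ p * h) x ^ 2 = H at *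
    generalize Real.exp (R ^ 2 / (2 ^ p * h)) = v at *
    calc G * E * X ≤ G * E * (2 * (a * (κ' * v * H))) := by gcongr
      _ = (2 * (a * κ' * G)) * E * (v * H) := by ring
      _ ≤ D * E * (v * H) := by gcongr
      _ = _ := by rw [← hZ]; ring
  have hconc := hw.integral_heatKernel_le_setIntegral_ball hK hT (r := r)
    (Λ := (Z + R ^ 2 / (2 ^ p * h)) / 2) (p := p) hh (by linarith) (by linarith)
    (by positivity) hr ?_ hdec
  · have hkh := heatKernel_pos hh (0 : EuclideanSpace ℝ (Fin n))
    have e1 := hw.setIntegral_ball_sq_le_heatKernel hTI hh (R := R)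
    have e2 : ∫ x in Metric.ball 0 r, heatKernel h x * w T x ^ 2 ≤
        heatKernel h (0 : EuclideanSpace ℝ (Fin n)) * ∫ x in Metric.ball 0 r, w T x ^ 2 := by
      rw [← integral_const_mul]
      obtain ⟨M, hM⟩ := hw.bounded
      exact setIntegral_mono
        (integrable_heatKernel_mul_sq hh (hw.measurable T hTI) (hM T hTI)).integrableOn
        ((hw.integrableOn_ball_sq hTI 0 r).const_mul _) fun x =>
          mul_le_mul_of_nonneg_right (heatKernel_le_heatKernel_zero hh x) (sq_nonneg _)
    have e3 := hconc.trans (mul_le_mul_of_nonneg_left e2 (by norm_num))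
    have e4 := mul_le_mul_of_nonneg_left e3 (show 0 ≤ (heatKernel h
      (0 : EuclideanSpace ℝ (Fin n)))⁻¹ * Real.exp (R ^ 2 / (4 * h)) by positivity)
    refine (e1.trans e4).trans_eq ?_
    field_simp
  -- The part R²/(2^p h) of the decrease is paid for by p alone: after multiplication by h it no
  -- longer depends on h, and 2^p r² ≥ 384 R² makes it at most r²/2.
  · have e1 : 48 * h * (4 * (R ^ 2 / (2 ^ p * h))) ≤ r ^ 2 / 2 := by
      calc 48 * h * (4 * (R ^ 2 / (2 ^ p * h))) = 384 * R ^ 2 / 2 ^ p / 2 := by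
            field_simp; norm_num
        _ ≤ _ := by
            gcongr
            rw [div_le_iff₀ (by positivity)]
            linarith
    linarith

/-- The local interpolation inequality, around the origin. -/
theorem exists_local_interpolation (n : ℕ) {R r : ℝ} (hR : 0 < R) (hr : 0 < r) :
    ∃ β ∈ Ioo (0 : ℝ) 1, ∀ K T : ℝ, 0 ≤ K → 0 < T → ∃ C : ℝ, 0 < C ∧
      ∀ w : ℝ → EuclideanSpace ℝ (Fin n) → ℝ, IsHeatPerturbation K T w →
        ∫ x in Metric.ball 0 R, w T x ^ 2 ≤
          C * (∫ x, heatKernel (17 * T) x * w 0 x ^ 2) ^ (1 - β) *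
            (∫ x in Metric.ball 0 r, w T x ^ 2) ^ β := by
  obtain ⟨q, hq⟩ := pow_unbounded_of_one_lt (384 * R ^ 2 / r ^ 2) (one_lt_two : (1 : ℝ) < 2)
  set p := q + 1 with hp
  have hpr : 384 * R ^ 2 ≤ 2 ^ p * r ^ 2 := by
    rw [div_lt_iff₀ (by positivity)] at hq
    rw [hp, pow_succ (2 : ℝ) q]
    have := mul_pos (pow_pos (two_pos : (0 : ℝ) < 2) q) (pow_pos hr 2)
    linarith
  -- The scale will be h = 1/(a + bZ). The two summands of b serve the constraints on hZ, those of a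
  -- below the constraints on h alone. Only a involves K and T, so θ = R²b/4 and the exponent β
  -- depend on R and r only.
  set b := 16 * 2 ^ p / R ^ 2 + 384 / r ^ 2 with hb
  have hb0 : 0 < b := by positivity
  set θ := R ^ 2 * b / 4 with hθ
  have hθ0 : 0 < θ := by positivity
  refine ⟨1 / (1 + θ), ⟨by positivity, ?_⟩, fun K T hK hT => ?_⟩
  · rw [div_lt_one (by positivity)]
    linarith
  have hKT : 0 ≤ K * T := mul_nonneg hK hT.le
  have hκ := heatKernel_pos (show 0 < 16 * T by positivity) (0 : EuclideanSpace ℝ (Fin n))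
  have hκ' := heatKernel_pos hT (0 : EuclideanSpace ℝ (Fin n))
  set Γ := 32 * (K * T) + 128 * (p + 1) * (K * T) ^ 2 + 2 * (n : ℝ) + 1 with hΓ
  have hΓ0 : 0 ≤ Γ := by positivity
  set G := Real.exp (2 * (K * T)) * 17 ^ ((n : ℝ) / 2) with hG
  set D₁ := 2 * (Real.exp (2 * (K * T)) * (2 ^ ((n : ℝ) / 2) *
      (heatKernel (16 * T) (0 : EuclideanSpace ℝ (Fin n)))⁻¹) * G) with hD₁
  set D₂ := 2 * (Real.exp (2 * (K * T)) *
    (heatKernel T (0 : EuclideanSpace ℝ (Fin n)))⁻¹ * G) with hD₂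
  set D₃ := (heatKernel (16 * T) (0 : EuclideanSpace ℝ (Fin n)))⁻¹ *
    Real.exp (R ^ 2 / (4 * (16 * T))) * G with hD₃
  have hD₁0 : 0 < D₁ := by positivity
  have hD₂0 : 0 < D₂ := by positivity
  have hD₃0 : 0 < D₃ := by positivity
  -- The summands absorb the tail, bound the decrease of the weighted energy, and ensure X ≤ D E, so
  -- that Z ≥ 0.
  set D := D₁ + D₂ + D₃ with hD
  have hD0 : 0 < D := by positivity
  set a := 2 ^ (p + 1) / T + 96 * (Γ + 1) / r ^ 2 with ha
  have ha0 : 0 < a := by positivity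
  set A := 3 * Real.exp (R ^ 2 * a / 4) with hA
  refine ⟨(A * D ^ θ) ^ (1 / (1 + θ)), by positivity, fun w hw => ?_⟩
  have hTI : T ∈ Icc 0 T := ⟨hT.le, le_rfl⟩
  set X := ∫ x in Metric.ball 0 R, w T x ^ 2 with hXdef
  set E := ∫ x, heatKernel (17 * T) x * w 0 x ^ 2 with hEdef
  set Y := ∫ x in Metric.ball 0 r, w T x ^ 2 with hYdef
  have hE0 : 0 ≤ E := integral_heatKernel_mul_sq_nonneg (by positivity) _
  have hY0 : 0 ≤ Y := integral_nonneg fun x => sq_nonneg _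
  have hX0 : 0 ≤ X := integral_nonneg fun x => sq_nonneg _
  rcases hX0.eq_or_lt with hX | hX
  · rw [← hX]
    positivity
  have hXE : X ≤ D₃ * E := by
    have e1 := hw.setIntegral_ball_sq_le_heatKernel hTI (show 0 < 16 * T by positivity) (R := R)
    have e2 := hw.integral_heatKernel_mul_sq_le_initial hK hT hTI (show 0 < 16 * T by positivity)
      (by linarith) (by linarith)
    refine e1.trans ?_
    rw [hD₃, mul_assoc _ G E]
    gcongr
  have hXD : X ≤ D * E := hXE.trans (by gcongr; rw [hD]; linarith)
  have hE : 0 < E := by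
    by_contra hcon
    have : E = 0 := le_antisymm (not_lt.1 hcon) hE0
    rw [this, mul_zero] at hXE
    linarith
  have hquot : 0 < D * E / X := by positivity
  set Z := Real.log (D * E / X) with hZ
  have hZ0 : 0 ≤ Z := Real.log_nonneg (by rwa [le_div_iff₀ hX, one_mul])
  have hexpZ : Real.exp Z = D * E / X := Real.exp_log hquot
  have hden : 0 < a + b * Z := by positivity
  refine le_rpow_mul_rpow_of_le hX hE hY0 (by positivity) hD0 hθ0 ?_
  have main := hw.setIntegral_ball_le_exp_mul hK hT (h := 1 / (a + b * Z)) (Z := Z) (D := D)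
    (p := p) hR hr (by omega) hpr (by positivity) ?_ hZ0 hX ?_ (by rw [hD]; linarith)
    (by rw [hD]; linarith) ?_ ?_
  -- Here R²/(4h) = R²a/4 + θZ, so the exponential is a constant times (D E / X)^θ.
  · refine main.trans_eq ?_
    rw [← hexpZ, ← Real.exp_mul]
    rw [hA, mul_assoc 3 (Real.exp _) (Real.exp _), ← Real.exp_add]
    congr 3
    rw [hθ]
    field_simp
  · rw [mul_one_div, div_le_iff₀ hden]
    have : T * (2 ^ (p + 1) / T) = 2 ^ (p + 1) := by field_simp
    have h2 : 0 ≤ T * (96 * (Γ + 1) / r ^ 2) := by positivity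
    have h3 : 0 ≤ T * (b * Z) := by positivity
    rw [ha]
    linarith
  · rw [hexpZ]
    exact div_mul_cancel₀ _ hX.ne'
  · rw [mul_one_div, div_mul_eq_mul_div, div_le_iff₀ hden]
    have : R ^ 2 * (16 * 2 ^ p / R ^ 2) = 16 * 2 ^ p := by field_simp
    have h2 : 0 ≤ R ^ 2 * (384 / r ^ 2) * Z := by positivity
    have h3 : 0 ≤ R ^ 2 * a := by positivity
    calc 16 * 2 ^ p * Z = R ^ 2 * (16 * 2 ^ p / R ^ 2) * Z := by rw [this]
      _ ≤ R ^ 2 * (a + b * Z) := by rw [hb]; linarith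
  · rw [mul_one_div, div_mul_eq_mul_div, div_le_iff₀ hden]
    have e1 : r ^ 2 * (384 / r ^ 2) = 384 := by field_simp
    have e2 : r ^ 2 * (96 * (Γ + 1) / r ^ 2) = 96 * (Γ + 1) := by field_simp
    have h2 : 0 ≤ r ^ 2 * (16 * 2 ^ p / R ^ 2) * Z := by positivity
    have h3 : 0 ≤ r ^ 2 * (2 ^ (p + 1) / T) := by positivity
    calc 96 * (4 * Z + Γ + 1) = r ^ 2 * (96 * (Γ + 1) / r ^ 2) + r ^ 2 * (384 / r ^ 2) * Z := by
          rw [e1, e2]; ring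
      _ ≤ r ^ 2 * (a + b * Z) := by rw [ha, hb]; linarith

end IsHeatPerturbation

/-! ### Summation over the balls in the observation set -/

theorem heatSemigroup_translate (t : ℝ) (u : EuclideanSpace ℝ (Fin n) → ℝ)
    (a x : EuclideanSpace ℝ (Fin n)) :
    heatSemigroup t (fun z => u (a + z)) x = heatSemigroup t u (a + x) := by
  unfold heatSemigroup
  rw [← integral_add_left_eq_self (fun z => heatKernel t (a + x - z) * u z) a]
  simp_rw [add_sub_add_left_eq_sub]

/-- The heat semigroup is a contraction on `L²`. -/
theorem integrable_sq_heatSemigroup {u : EuclideanSpace ℝ (Fin n) → ℝ} {M t : ℝ} (ht : 0 < t)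
    (hu : Measurable u) (hM : ∀ x, |u x| ≤ M) (hu2 : Integrable (fun x => u x ^ 2)) :
    Integrable (fun x => heatSemigroup t u x ^ 2) ∧
      ∫ x, heatSemigroup t u x ^ 2 ≤ ∫ x, u x ^ 2 := by
  have hprod := integrable_prod_mul_heatKernel hu2 ht
  have hi : Integrable (heatSemigroup t (fun z => u z ^ 2)) := by
    refine hprod.integral_prod_right.congr (.of_forall fun x => ?_)
    change ∫ z, u z ^ 2 * heatKernel t (z - x) = ∫ z, heatKernel t (x - z) * u z ^ 2
    congr 1; ext z
    rw [heatKernel_sub_comm, mul_comm]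
  have he : ∫ x, heatSemigroup t (fun z => u z ^ 2) x = ∫ x, u x ^ 2 := by
    have := integral_mul_heatSemigroup hu2 ht (u := fun _ => 1) (M := 1) measurable_const (by simp)
    simp_rw [heatSemigroup_const ht, mul_one] at this
    exact this.symm
  have hle := sq_heatSemigroup_le ht hu hM
  have hi2 : Integrable (fun x => heatSemigroup t u x ^ 2) :=
    hi.mono' ((measurable_heatSemigroup t hu).pow_const 2).aestronglyMeasurable
      (.of_forall fun x => by rw [Real.norm_of_nonneg (sq_nonneg _)]; exact hle x)
  exact ⟨hi2, he ▸ integral_mono hi2 hi hle⟩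

namespace IsHeatPerturbation

variable {K T : ℝ} {w : ℝ → EuclideanSpace ℝ (Fin n) → ℝ}

theorem translate (hw : IsHeatPerturbation K T w) (a : EuclideanSpace ℝ (Fin n)) :
    IsHeatPerturbation K T (fun t x => w t (a + x)) where
  measurable t ht := (hw.measurable t ht).comp (measurable_const_add a)
  bounded := by
    obtain ⟨M, hM⟩ := hw.bounded
    exact ⟨M, fun t ht x => hM t ht _⟩
  abs_sub_le s t hs hst ht x := by
    rw [heatSemigroup_translate, heatSemigroup_translate (t - s) (fun z => |w s z|)]
    exact hw.abs_sub_le s t hs hst ht (a + x)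

theorem integrable_sq (hw : IsHeatPerturbation K T w) (h0 : Integrable (fun x => w 0 x ^ 2))
    {t : ℝ} (ht : t ∈ Icc 0 T) : Integrable (fun x => w t x ^ 2) := by
  rcases ht.1.eq_or_lt with rfl | ht0
  · exact h0
  obtain ⟨M, hM⟩ := hw.bounded
  have h0I : (0 : ℝ) ∈ Icc 0 T := ⟨le_rfl, ht.1.trans ht.2⟩
  have hi := (integrable_sq_heatSemigroup ht0 (hw.measurable 0 h0I).abs (M := M)
    (fun x => by rw [abs_abs]; exact hM 0 h0I x) (by simpa using h0)).1
  refine (hi.const_mul (Real.exp (K * t) ^ 2)).mono'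
    ((hw.measurable t ht).pow_const 2).aestronglyMeasurable (.of_forall fun x => ?_)
  rw [Real.norm_of_nonneg (sq_nonneg _), ← mul_pow, ← sq_abs]
  have := hw.abs_le_exp_mul_heatSemigroup le_rfl ht0 ht.2 x
  rw [sub_zero] at this
  exact pow_le_pow_left₀ (abs_nonneg _) this 2

/-- One step of the perturbed flow differs from the heat flow by little in `L²`. -/
theorem integral_sub_sq_le (hw : IsHeatPerturbation K T w)
    (h0 : Integrable (fun x => w 0 x ^ 2)) {s t : ℝ} (hs : 0 ≤ s) (hst : s < t) (ht : t ≤ T) :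
    ∫ x, (w t x - heatSemigroup (t - s) (w s) x) ^ 2 ≤
      (Real.exp (K * (t - s)) - 1) ^ 2 * ∫ x, w s x ^ 2 := by
  obtain ⟨M, hM⟩ := hw.bounded
  have hts : 0 < t - s := sub_pos.2 hst
  have hsI : s ∈ Icc 0 T := ⟨hs, hst.le.trans ht⟩
  have ms := hw.measurable s hsI
  have h := integrable_sq_heatSemigroup hts ms.abs (M := M)
    (fun x => by rw [abs_abs]; exact hM s hsI x) (by simpa using hw.integrable_sq h0 hsI)
  simp_rw [sq_abs] at h
  refine le_trans ?_ (mul_le_mul_of_nonneg_left h.2 (sq_nonneg _))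
  rw [← integral_const_mul]
  refine integral_mono_of_nonneg (.of_forall fun x => sq_nonneg _) (h.1.const_mul _)
    (.of_forall fun x => ?_)
  have h1 := hw.abs_sub_le s t hs hst ht x
  have := pow_le_pow_left₀ (abs_nonneg _) h1 2
  rwa [sq_abs, mul_pow] at this

end IsHeatPerturbation

/-- Gaussians centered at the centers of disjoint balls have a bounded sum. -/
theorem tsum_heatKernel_sub_le {l r : ℝ} (hl : 0 < l) (hr : 0 < r)
    {c : ℕ+ → EuclideanSpace ℝ (Fin n)}
    (hc : Pairwise fun i j => Disjoint (Metric.ball (c i) r) (Metric.ball (c j) r))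
    (x : EuclideanSpace ℝ (Fin n)) :
    ∑' j, ENNReal.ofReal (heatKernel l (x - c j)) ≤
      ENNReal.ofReal (2 ^ ((n : ℝ) / 2) * Real.exp (r ^ 2 / (4 * l))) *
        (volume (Metric.ball (0 : EuclideanSpace ℝ (Fin n)) r))⁻¹ := by
  set A := 2 ^ ((n : ℝ) / 2) * Real.exp (r ^ 2 / (4 * l)) with hA
  set v := volume (Metric.ball (0 : EuclideanSpace ℝ (Fin n)) r) with hv
  have hv0 : v ≠ 0 := (Metric.measure_ball_pos volume _ hr).ne'
  have hvt : v ≠ ∞ := Metric.isBounded_ball.measure_lt_top.ne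
  -- The Gaussian at a center is at most a constant times the wider Gaussian at any point of the
  -- ball, hence times its mean over the ball. The balls are disjoint and the wider Gaussian has
  -- integral 1.
  have key : ∀ y z : EuclideanSpace ℝ (Fin n), z ∈ Metric.ball y r →
      heatKernel l (x - y) ≤ A * heatKernel (2 * l) (x - z) := by
    intro y z hz
    have f1 : (4 * Real.pi * l) ^ (-(n : ℝ) / 2) =
        2 ^ ((n : ℝ) / 2) * (4 * Real.pi * (2 * l)) ^ (-(n : ℝ) / 2) := by
      rw [show (n : ℝ) / 2 = -(-(n : ℝ) / 2) by ring, Real.rpow_neg (by positivity),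
        ← Real.inv_rpow (by positivity), ← Real.mul_rpow (by positivity) (by positivity)]
      congr 1
      ring
    have f2 : Real.exp (-‖x - y‖ ^ 2 / (4 * l)) ≤
        Real.exp (r ^ 2 / (4 * l)) * Real.exp (-‖x - z‖ ^ 2 / (4 * (2 * l))) := by
      rw [← Real.exp_add]
      refine Real.exp_le_exp.2 ?_
      have h1 : ‖x - z‖ ≤ ‖x - y‖ + r := by
        have h2 : ‖y - z‖ < r := by rwa [mem_ball_iff_norm'] at hz
        calc ‖x - z‖ = ‖(x - y) + (y - z)‖ := by congr 1; abel
          _ ≤ ‖x - y‖ + ‖y - z‖ := norm_add_le _ _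
          _ ≤ _ := by linarith
      have h2 : ‖x - z‖ ^ 2 ≤ 2 * ‖x - y‖ ^ 2 + 2 * r ^ 2 := by
        nlinarith [norm_nonneg (x - z), norm_nonneg (x - y), sq_nonneg (‖x - y‖ - r)]
      rw [show r ^ 2 / (4 * l) + -‖x - z‖ ^ 2 / (4 * (2 * l)) =
        (2 * r ^ 2 - ‖x - z‖ ^ 2) / (2 * (4 * l)) by field_simp; ring,
        show -‖x - y‖ ^ 2 / (4 * l) = -(2 * ‖x - y‖ ^ 2) / (2 * (4 * l)) by field_simp]
      gcongr
      linarith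
    unfold heatKernel
    rw [f1, hA]
    calc _ ≤ 2 ^ ((n : ℝ) / 2) * (4 * Real.pi * (2 * l)) ^ (-(n : ℝ) / 2) *
        (Real.exp (r ^ 2 / (4 * l)) * Real.exp (-‖x - z‖ ^ 2 / (4 * (2 * l)))) := by gcongr
      _ = _ := by ring
  have hj : ∀ j, ENNReal.ofReal (heatKernel l (x - c j)) ≤ ENNReal.ofReal A * v⁻¹ *
      ∫⁻ z in Metric.ball (c j) r, ENNReal.ofReal (heatKernel (2 * l) (x - z)) := by
    intro j
    have hvj : volume (Metric.ball (c j) r) = v := Measure.addHaar_ball_center _ _ _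
    have h1 : ENNReal.ofReal (heatKernel l (x - c j)) * v ≤
        ∫⁻ z in Metric.ball (c j) r, ENNReal.ofReal A *
          ENNReal.ofReal (heatKernel (2 * l) (x - z)) := by
      rw [← hvj, ← setLIntegral_const]
      refine setLIntegral_mono' Metric.isOpen_ball.measurableSet fun z hz => ?_
      rw [← ENNReal.ofReal_mul (by positivity)]
      exact ENNReal.ofReal_le_ofReal (key _ z hz)
    rw [lintegral_const_mul' _ _ ENNReal.ofReal_ne_top] at h1
    rw [mul_right_comm, ← div_eq_mul_inv]
    exact (ENNReal.le_div_iff_mul_le (.inl hv0) (.inl hvt)).2 h1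
  calc _ ≤ ∑' j, ENNReal.ofReal A * v⁻¹ *
      ∫⁻ z in Metric.ball (c j) r, ENNReal.ofReal (heatKernel (2 * l) (x - z)) :=
        ENNReal.tsum_le_tsum hj
    _ = ENNReal.ofReal A * v⁻¹ *
      ∫⁻ z in ⋃ j, Metric.ball (c j) r, ENNReal.ofReal (heatKernel (2 * l) (x - z)) := by
        rw [ENNReal.tsum_mul_left, lintegral_iUnion (fun j => Metric.isOpen_ball.measurableSet) hc]
    _ ≤ ENNReal.ofReal A * v⁻¹ * 1 := by
        gcongr
        refine (setLIntegral_le_lintegral _ _).trans_eq ?_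
        rw [← ofReal_integral_eq_lintegral_ofReal (integrable_heatKernel_sub (by positivity) x)
          (.of_forall fun z => heatKernel_nonneg (by positivity) _),
          integral_heatKernel_sub (by positivity), ENNReal.ofReal_one]
    _ = _ := mul_one _

/-- Hölder's inequality for sums, with exponents that sum to one. -/
theorem tsum_rpow_mul_rpow_le {ι : Type*} [Countable ι] (e y : ι → ℝ≥0∞) {p q : ℝ} (hp : 0 ≤ p)
    (hq : 0 ≤ q) (hpq : p + q = 1) :
    ∑' j, e j ^ p * y j ^ q ≤ (∑' j, e j) ^ p * (∑' j, y j) ^ q := by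
  let _ : MeasurableSpace ι := ⊤
  have := ENNReal.lintegral_mul_norm_pow_le (μ := Measure.count) (f := e) (g := y)
    measurable_from_top.aemeasurable measurable_from_top.aemeasurable hp hq hpq
  simpa only [lintegral_count] using this

/-- The interpolation inequality for a set that contains disjoint balls of radius `r` such that the
concentric balls of radius `R` cover the space. -/
theorem IsHeatPerturbation.exists_interpolation (n : ℕ) {R r : ℝ} (hR : 0 < R) (hr : 0 < r) :
    ∃ β ∈ Ioo (0 : ℝ) 1, ∀ K T : ℝ, 0 ≤ K → 0 < T → ∃ C : ℝ, 0 < C ∧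
      ∀ (w : ℝ → EuclideanSpace ℝ (Fin n) → ℝ) (ω : Set (EuclideanSpace ℝ (Fin n)))
        (c : ℕ+ → EuclideanSpace ℝ (Fin n)), IsHeatPerturbation K T w →
        Integrable (fun x => w 0 x ^ 2) →
        (Pairwise fun i j => Disjoint (Metric.ball (c i) r) (Metric.ball (c j) r)) →
        (∀ j, Metric.ball (c j) r ⊆ ω) → (∀ x, ∃ j, x ∈ Metric.ball (c j) R) →
        ∫ x, w T x ^ 2 ≤
          C * (∫ x, w 0 x ^ 2) ^ (1 - β) * (∫ x in ω, w T x ^ 2) ^ β := by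
  obtain ⟨β, hβ, H⟩ := exists_local_interpolation n hR hr
  refine ⟨β, hβ, fun K T hK hT => ?_⟩
  obtain ⟨C, hC, HC⟩ := H K T hK hT
  have hβ1 : 0 < 1 - β := sub_pos.2 hβ.2
  have hT17 : 0 < 17 * T := by positivity
  set B := ENNReal.ofReal (2 ^ ((n : ℝ) / 2) * Real.exp (r ^ 2 / (4 * (17 * T)))) *
        (volume (Metric.ball (0 : EuclideanSpace ℝ (Fin n)) r))⁻¹ with hB
  have hBt : B ≠ ∞ := ENNReal.mul_ne_top ENNReal.ofReal_ne_top
    (ENNReal.inv_ne_top.2 (Metric.measure_ball_pos volume _ hr).ne')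
  have hB0 : 0 < B.toReal := ENNReal.toReal_pos (mul_ne_zero
    (ENNReal.ofReal_pos.2 (by positivity)).ne'
    (ENNReal.inv_ne_zero.2 Metric.isBounded_ball.measure_lt_top.ne)) hBt
  refine ⟨C * B.toReal ^ (1 - β), by positivity, fun w ω c hw h0 hdisj hω hcov => ?_⟩
  have hTI : T ∈ Icc 0 T := ⟨hT.le, le_rfl⟩
  have h0I : (0 : ℝ) ∈ Icc 0 T := ⟨le_rfl, hT.le⟩
  obtain ⟨M, hM⟩ := hw.bounded
  have hwT := hw.integrable_sq h0 hTI
  have hloc : ∀ j, ∫ x in Metric.ball (c j) R, w T x ^ 2 ≤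
      C * (∫ x, heatKernel (17 * T) (x - c j) * w 0 x ^ 2) ^ (1 - β) *
        (∫ x in Metric.ball (c j) r, w T x ^ 2) ^ β := by
    intro j
    have h := HC _ (hw.translate (c j))
    have eb : ∀ ρ, ∫ x in Metric.ball 0 ρ, w T (c j + x) ^ 2 =
        ∫ x in Metric.ball (c j) ρ, w T x ^ 2 := fun ρ => by
      rw [← integral_indicator Metric.isOpen_ball.measurableSet,
        ← integral_indicator Metric.isOpen_ball.measurableSet,
        ← integral_add_left_eq_self (indicator (Metric.ball (c j) ρ) _) (c j)]
      congr 1; ext x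
      simp [indicator, Metric.mem_ball, dist_eq_norm]
    have ek : ∫ x, heatKernel (17 * T) x * w 0 (c j + x) ^ 2 =
        ∫ x, heatKernel (17 * T) (x - c j) * w 0 x ^ 2 := by
      rw [← integral_add_left_eq_self (fun x => heatKernel (17 * T) (x - c j) * w 0 x ^ 2) (c j)]
      simp only [add_sub_cancel_left]
    rwa [eb, eb, ek] at h
  -- From here on in extended nonnegative reals, where sums over the balls need no summability.
  set e : ℕ+ → ℝ≥0∞ := fun j => ∫⁻ x, ENNReal.ofReal (heatKernel (17 * T) (x - c j)) *
    ENNReal.ofReal (w 0 x ^ 2) with he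
  set y : ℕ+ → ℝ≥0∞ := fun j => ∫⁻ x in Metric.ball (c j) r, ENNReal.ofReal (w T x ^ 2) with hy
  have hlocE : ∀ j, ∫⁻ x in Metric.ball (c j) R, ENNReal.ofReal (w T x ^ 2) ≤
      ENNReal.ofReal C * (e j ^ (1 - β) * y j ^ β) := by
    intro j
    have hk : ∀ x, 0 ≤ heatKernel (17 * T) (x - c j) := fun x => heatKernel_nonneg hT17 _
    have e1 : ENNReal.ofReal (∫ x, heatKernel (17 * T) (x - c j) * w 0 x ^ 2) = e j := by
      rw [ofReal_integral_eq_lintegral_ofReal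
        (integrable_mul_of_abs_le ((integrable_heatKernel hT17).comp_sub_right (c j))
          ((hw.measurable 0 h0I).pow_const 2) fun x => abs_sq_le_of_abs_le (hM 0 h0I x))
        (.of_forall fun x => mul_nonneg (hk x) (sq_nonneg _))]
      simp_rw [ENNReal.ofReal_mul (hk _), he]
    have e2 : ∀ ρ, ENNReal.ofReal (∫ x in Metric.ball (c j) ρ, w T x ^ 2) =
        ∫⁻ x in Metric.ball (c j) ρ, ENNReal.ofReal (w T x ^ 2) := fun ρ =>
      ofReal_integral_eq_lintegral_ofReal hwT.integrableOn (.of_forall fun x => sq_nonneg _)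
    have hy0 : 0 ≤ ∫ x in Metric.ball (c j) r, w T x ^ 2 := integral_nonneg fun x => sq_nonneg _
    have he0 : 0 ≤ ∫ x, heatKernel (17 * T) (x - c j) * w 0 x ^ 2 :=
      integral_nonneg fun x => mul_nonneg (hk x) (sq_nonneg _)
    have := ENNReal.ofReal_le_ofReal (hloc j)
    rw [mul_assoc, ENNReal.ofReal_mul hC.le, ENNReal.ofReal_mul (by positivity),
      ← ENNReal.ofReal_rpow_of_nonneg he0 hβ1.le, ← ENNReal.ofReal_rpow_of_nonneg hy0 hβ.1.le,
      e1, e2, e2] at this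
    exact this
  have hsumE : ∑' j, e j ≤ B * ∫⁻ x, ENNReal.ofReal (w 0 x ^ 2) := by
    have hm0 : Measurable fun x => ENNReal.ofReal (w 0 x ^ 2) :=
      ((hw.measurable 0 h0I).pow_const 2).ennreal_ofReal
    have hmk : ∀ j, AEMeasurable (fun x => ENNReal.ofReal (heatKernel (17 * T) (x - c j)) *
        ENNReal.ofReal (w 0 x ^ 2)) volume := fun j => ((((measurable_heatKernel (17 * T)).comp
      (measurable_id.sub_const (c j))).ennreal_ofReal).mul hm0).aemeasurable
    rw [he, ← lintegral_tsum hmk, ← lintegral_const_mul' _ _ hBt]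
    refine lintegral_mono fun x => ?_
    rw [ENNReal.tsum_mul_right]
    gcongr
    exact tsum_heatKernel_sub_le hT17 hr hdisj x
  have hsumY : ∑' j, y j ≤ ∫⁻ x in ω, ENNReal.ofReal (w T x ^ 2) := by
    rw [hy, ← lintegral_iUnion (fun j => Metric.isOpen_ball.measurableSet) hdisj]
    exact lintegral_mono_set (iUnion_subset hω)
  have hmain : ∫⁻ x, ENNReal.ofReal (w T x ^ 2) ≤ ENNReal.ofReal C *
      ((B * ∫⁻ x, ENNReal.ofReal (w 0 x ^ 2)) ^ (1 - β) *
        (∫⁻ x in ω, ENNReal.ofReal (w T x ^ 2)) ^ β) := by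
    have hU : ⋃ j, Metric.ball (c j) R = univ := eq_univ_of_forall fun x => mem_iUnion.2 (hcov x)
    -- Covering by the large balls, the local inequality for each, Hölder's inequality with
    -- exponents 1 - β and β, and then disjointness of the small balls.
    calc _ = ∫⁻ x in ⋃ j, Metric.ball (c j) R, ENNReal.ofReal (w T x ^ 2) := by
          rw [hU, Measure.restrict_univ]
      _ ≤ ∑' j, ∫⁻ x in Metric.ball (c j) R, ENNReal.ofReal (w T x ^ 2) :=
          lintegral_iUnion_le _ _
      _ ≤ ∑' j, ENNReal.ofReal C * (e j ^ (1 - β) * y j ^ β) := ENNReal.tsum_le_tsum hlocE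
      _ = ENNReal.ofReal C * ∑' j, e j ^ (1 - β) * y j ^ β := ENNReal.tsum_mul_left
      _ ≤ ENNReal.ofReal C * ((∑' j, e j) ^ (1 - β) * (∑' j, y j) ^ β) := by
          gcongr
          exact tsum_rpow_mul_rpow_le e y hβ1.le hβ.1.le (by ring)
      _ ≤ _ := by
          have := hβ.1.le
          gcongr
  have hi0 : 0 ≤ ∫ x, w 0 x ^ 2 := integral_nonneg fun x => sq_nonneg _
  have hiω : 0 ≤ ∫ x in ω, w T x ^ 2 := integral_nonneg fun x => sq_nonneg _
  rw [← ofReal_integral_eq_lintegral_ofReal hwT (.of_forall fun x => sq_nonneg _),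
    ← ofReal_integral_eq_lintegral_ofReal h0 (.of_forall fun x => sq_nonneg _),
    ← ofReal_integral_eq_lintegral_ofReal hwT.integrableOn (.of_forall fun x => sq_nonneg _),
    ← ENNReal.ofReal_toReal hBt, ← ENNReal.ofReal_mul hB0.le,
    ENNReal.ofReal_rpow_of_nonneg (by positivity) hβ1.le,
    ENNReal.ofReal_rpow_of_nonneg hiω hβ.1.le, ← ENNReal.ofReal_mul (by positivity),
    ← ENNReal.ofReal_mul hC.le, ENNReal.ofReal_le_ofReal_iff (by positivity),
    Real.mul_rpow hB0.le hi0] at hmain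
  linarith

/-! ### The heat semigroup on the Fourier side -/

section Fourier

variable {u : EuclideanSpace ℝ (Fin n) → ℝ} {M t : ℝ}

theorem fourier_heatKernel (ht : 0 < t) (ξ : EuclideanSpace ℝ (Fin n)) :
    𝓕 (fun z : EuclideanSpace ℝ (Fin n) => (heatKernel t z : ℂ)) ξ =
      (Real.exp (-(t * (4 * Real.pi ^ 2 * ‖ξ‖ ^ 2))) : ℂ) := by
  have h := fourier_gaussian_innerProductSpace (V := EuclideanSpace ℝ (Fin n))
    (b := ((1 / (4 * t) : ℝ) : ℂ)) (by rw [Complex.ofReal_re]; positivity) ξ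
  have e : (fun z : EuclideanSpace ℝ (Fin n) => (heatKernel t z : ℂ)) =
      (((4 * Real.pi * t) ^ (-(n : ℝ) / 2) : ℝ) : ℂ) •
        fun v : EuclideanSpace ℝ (Fin n) => Complex.exp (-((1 / (4 * t) : ℝ) : ℂ) * ‖v‖ ^ 2) := by
    ext z
    simp only [heatKernel, Pi.smul_apply, smul_eq_mul]
    push_cast
    congr 2
    field_simp
  have hp : ((Real.pi : ℂ) / ((1 / (4 * t) : ℝ) : ℂ)) ^
      (Module.finrank ℝ (EuclideanSpace ℝ (Fin n)) / 2 : ℂ) =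
      (((4 * Real.pi * t) ^ ((n : ℝ) / 2) : ℝ) : ℂ) := by
    rw [Complex.ofReal_cpow (by positivity), finrank_euclideanSpace_fin, ← Complex.ofReal_div]
    congr 2
    · field_simp
    · push_cast; rfl
  have hs (c : ℂ) (g : EuclideanSpace ℝ (Fin n) → ℂ) : 𝓕 (c • g) ξ = c * 𝓕 g ξ := by
    simp only [Real.fourier_eq, Pi.smul_apply, smul_eq_mul, ← integral_const_mul]
    congr 1; ext v
    rw [Circle.smul_def, Circle.smul_def, smul_eq_mul, smul_eq_mul]; ring
  rw [e, hs, h, hp, ← mul_assoc, ← Complex.ofReal_mul,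
    ← Real.rpow_add (by positivity), show -(n : ℝ) / 2 + n / 2 = 0 by ring, Real.rpow_zero,
    Complex.ofReal_one, one_mul]
  push_cast
  congr 1
  have : (t : ℂ) ≠ 0 := by exact_mod_cast ht.ne'
  field_simp

/-- The heat semigroup applied to a Fourier transform. -/
theorem integral_heatKernel_sub_mul_fourier (ht : 0 < t) {g : EuclideanSpace ℝ (Fin n) → ℂ}
    (hg : Integrable g) (x : EuclideanSpace ℝ (Fin n)) :
    ∫ z, (heatKernel t (x - z) : ℂ) * 𝓕 g z =
      𝓕 (fun ξ => (Real.exp (-(t * (4 * Real.pi ^ 2 * ‖ξ‖ ^ 2))) : ℂ) * g ξ) x := by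
  have h := VectorFourier.integral_fourierIntegral_smul_eq_flip (L := innerₗ _)
    (μ := volume) (ν := volume) Real.continuous_fourierChar continuous_inner
    (f := fun z => (heatKernel t (x - z) : ℂ)) (g := g) (integrable_heatKernel_sub ht x).ofReal hg
  rw [flip_innerₗ] at h
  simp only [smul_eq_mul] at h
  refine (h.symm.trans ?_ : _)
  rw [Real.fourier_eq]
  congr 1; ext ξ
  rw [Circle.smul_def, smul_eq_mul, ← mul_assoc]
  congr 1
  rw [← fourier_heatKernel ht ξ, Real.fourier_eq, ← integral_const_mul]
  change ∫ z, Real.fourierChar (-inner ℝ z ξ) • (heatKernel t (x - z) : ℂ) = _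
  rw [← integral_add_right_eq_self _ x]
  congr 1; ext z
  rw [inner_add_left, neg_add, AddChar.map_add_eq_mul, real_inner_comm x ξ, sub_add_cancel_right,
    heatKernel_neg, Circle.smul_def, Circle.smul_def, Circle.coe_mul, smul_eq_mul, smul_eq_mul]
  ring

theorem integral_mul_heatSemigroup_complex (ht : 0 < t) (hu : Measurable u) (hM : ∀ x, |u x| ≤ M)
    {h : EuclideanSpace ℝ (Fin n) → ℂ} (hh : Integrable h) :
    ∫ x, h x * (heatSemigroup t u x : ℂ) =
      ∫ z, (∫ x, (heatKernel t (z - x) : ℂ) * h x) * (u z : ℂ) := by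
  have key (x z : EuclideanSpace ℝ (Fin n)) : h x * ((heatKernel t (x - z) * u z : ℝ) : ℂ) =
      ((h x).re * (heatKernel t (x - z) * u z) : ℝ) +
      ((h x).im * (heatKernel t (x - z) * u z) : ℝ) * Complex.I := by
    conv_lhs => rw [← Complex.re_add_im (h x)]
    push_cast; ring
  have hi : Integrable (fun p : EuclideanSpace ℝ (Fin n) × EuclideanSpace ℝ (Fin n) =>
      h p.1 * ((heatKernel t (p.1 - p.2) * u p.2 : ℝ) : ℂ)) := by
    simp_rw [key]
    exact (integrable_prod_mul_heatKernel_mul hh.re ht hu hM).ofReal.add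
      ((integrable_prod_mul_heatKernel_mul hh.im ht hu hM).ofReal.mul_const _)
  unfold heatSemigroup
  simp_rw [← integral_complex_ofReal, ← integral_const_mul, ← integral_mul_const]
  rw [integral_integral_swap hi]
  congr 1; ext z; congr 1; ext x
  rw [heatKernel_sub_comm]; push_cast; ring

open scoped ContDiff in
/-- On the Fourier side the heat semigroup is multiplication by `exp (-4π²t|ξ|²)`. -/
theorem fourier_toLp_heatSemigroup (ht : 0 < t) (hu : Measurable u) (hM : ∀ x, |u x| ≤ M)
    (h2 : MemLp (fun x => (u x : ℂ)) 2 volume)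
    (h2' : MemLp (fun x => (heatSemigroup t u x : ℂ)) 2 volume) :
    (𝓕 (h2'.toLp _) : Lp ℂ 2 (volume : Measure (EuclideanSpace ℝ (Fin n)))) =ᵐ[volume] fun ξ =>
      (Real.exp (-(t * (4 * Real.pi ^ 2 * ‖ξ‖ ^ 2))) : ℂ) *
        (𝓕 (h2.toLp _) : Lp ℂ 2 (volume : Measure (EuclideanSpace ℝ (Fin n)))) ξ := by
  set E : EuclideanSpace ℝ (Fin n) → ℝ := fun ξ =>
    Real.exp (-(t * (4 * Real.pi ^ 2 * ‖ξ‖ ^ 2))) with hE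
  have hEs : ContDiff ℝ ∞ E :=
    (contDiff_const.mul (contDiff_const.mul (contDiff_id.norm_sq ℝ))).neg.exp
  have loc (f : Lp ℂ 2 (volume : Measure (EuclideanSpace ℝ (Fin n)))) :
      LocallyIntegrable f volume := (Lp.memLp f).locallyIntegrable (by norm_num)
  -- The multiplication formula against a Schwartz function, read off from the Fourier transform of
  -- tempered distributions.
  have pair (f : Lp ℂ 2 (volume : Measure (EuclideanSpace ℝ (Fin n))))
      (G : SchwartzMap (EuclideanSpace ℝ (Fin n)) ℂ) :
      ∫ x, G x * (𝓕 f : Lp ℂ 2 (volume : Measure (EuclideanSpace ℝ (Fin n)))) x =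
        ∫ x, 𝓕 (G : EuclideanSpace ℝ (Fin n) → ℂ) x * f x := by
    have h := congrArg (fun D => D G) (Lp.fourier_toTemperedDistribution_eq f)
    simp only [TemperedDistribution.fourier_apply, Lp.toTemperedDistribution_apply,
      smul_eq_mul, SchwartzMap.fourier_coe] at h
    exact h.symm
  -- The identity is tested against smooth compactly supported g; the multiplier E is smooth, so E g
  -- is again such a function.
  refine ae_eq_of_integral_contDiff_smul_eq (loc _) ?_ fun g hg hgs => ?_
  · exact (loc (𝓕 (h2.toLp _))).continuous_mul (Complex.continuous_ofReal.comp hEs.continuous)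
  have hgc : ContDiff ℝ ∞ (fun x => (g x : ℂ)) := Complex.ofRealCLM.contDiff.comp hg
  have hgsc : HasCompactSupport (fun x => (g x : ℂ)) := hgs.comp_left Complex.ofReal_zero
  have hEc : ContDiff ℝ ∞ (fun x => (E x : ℂ)) := Complex.ofRealCLM.contDiff.comp hEs
  let G := hgsc.toSchwartzMap hgc
  let G' := (hgsc.mul_left (f := fun x => (E x : ℂ))).toSchwartzMap (hEc.mul hgc)
  have e1 : ∫ x, g x • (𝓕 (h2'.toLp _) : Lp ℂ 2 (volume : Measure (EuclideanSpace ℝ (Fin n)))) x =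
      ∫ x, 𝓕 (G : EuclideanSpace ℝ (Fin n) → ℂ) x * (heatSemigroup t u x : ℂ) := by
    simp_rw [Complex.real_smul]
    refine (pair _ G).trans (integral_congr_ae ?_)
    filter_upwards [h2'.coeFn_toLp] with x hx
    rw [hx]
  have e2 : ∫ x, g x • ((E x : ℂ) *
      (𝓕 (h2.toLp _) : Lp ℂ 2 (volume : Measure (EuclideanSpace ℝ (Fin n)))) x) =
      ∫ x, 𝓕 (G' : EuclideanSpace ℝ (Fin n) → ℂ) x * (u x : ℂ) := by
    simp_rw [Complex.real_smul]
    trans ∫ x, G' x * (𝓕 (h2.toLp _) : Lp ℂ 2 (volume : Measure (EuclideanSpace ℝ (Fin n)))) x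
    · congr 1; ext x
      change _ = ((E x : ℂ) * (g x : ℂ)) * _
      ring
    refine (pair _ G').trans (integral_congr_ae ?_)
    filter_upwards [h2.coeFn_toLp] with x hx
    rw [hx]
  have hFi : Integrable (𝓕 (G : EuclideanSpace ℝ (Fin n) → ℂ)) := by
    rw [← SchwartzMap.fourier_coe]; exact (𝓕 G).integrable
  rw [e1, e2, integral_mul_heatSemigroup_complex ht hu hM hFi]
  congr 1; ext z
  rw [integral_heatKernel_sub_mul_fourier ht G.integrable]
  rfl

end Fourier

/-! ### Evolution of the frequency quotient in one step -/

section Backward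

/-- Pointwise inequality on the Fourier side behind the monotonicity of the frequency quotient. -/
theorem mul_sq_norm_exp_mul_add_le {δ R s : ℝ} (hδ : 0 < δ) (hR : 1 ≤ R) (hs : 0 ≤ s) (u f : ℂ) :
    (1 - R / (1 + s)) * ‖(Real.exp (-(δ * s)) : ℂ) * u + f‖ ^ 2 ≤
      Real.exp (-(2 * δ * (R - 1))) * ((1 - R / (1 + s)) * ‖u‖ ^ 2) +
        (1 + 1 / (2 * δ)) * ‖f‖ ^ 2 := by
  set θ := Real.exp (-(δ * s))
  set q := Real.exp (-(2 * δ * (R - 1)))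
  set X := θ * ‖u‖ with hX
  have hXu : ‖(θ : ℂ) * u‖ = X := by
    rw [norm_mul, Complex.norm_real, Real.norm_of_nonneg (Real.exp_pos _).le]
  have hX0 : 0 ≤ X := by positivity
  have hB0 := norm_nonneg f
  have up : ‖(θ : ℂ) * u + f‖ ≤ X + ‖f‖ := (norm_add_le _ _).trans_eq (by rw [hXu])
  have low : |X - ‖f‖| ≤ ‖(θ : ℂ) * u + f‖ := by
    have := abs_norm_sub_norm_le ((θ : ℂ) * u) (-f)
    rwa [hXu, norm_neg, sub_neg_eq_add] at this
  have hs1 : 0 < 1 + s := by linarith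
  have hc : 1 - R / (1 + s) = (s - (R - 1)) / (1 + s) := by field_simp; ring
  have h2δ : 0 < 1 / (2 * δ) := by positivity
  set B := ‖f‖
  set N := ‖(θ : ℂ) * u + f‖
  have hN0 : 0 ≤ N := norm_nonneg _
  have hθq : θ ^ 2 * Real.exp (2 * δ * (s - (R - 1))) = q := by
    simp only [θ, q]
    rw [← Real.exp_nat_mul, ← Real.exp_add]
    congr 1; push_cast; ring
  -- After multiplication by 1 + s the weight is s - (R - 1). Without f, the factor e^{-2δs} lies
  -- below e^{-2δ(R-1)} where the weight is positive and above it where the weight is negative; both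
  -- cases favor the claim.
  suffices h : (s - (R - 1)) * N ^ 2 ≤ q * ((s - (R - 1)) * ‖u‖ ^ 2) +
      (1 + s) * ((1 + 1 / (2 * δ)) * B ^ 2) by
    rw [hc]
    have := div_le_div_of_nonneg_right h hs1.le
    rw [add_div, mul_div_cancel_left₀ _ hs1.ne'] at this
    calc _ = (s - (R - 1)) * N ^ 2 / (1 + s) := by ring
      _ ≤ _ := this
      _ = _ := by ring
  rcases le_total (R - 1) s with h | h
  · set σ := s - (R - 1) with hσ
    have hσ0 : 0 ≤ σ := by linarith
    have hρ : 1 + 2 * δ * σ ≤ Real.exp (2 * δ * σ) := by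
      linarith [Real.add_one_le_exp (2 * δ * σ)]
    have hq : q * ‖u‖ ^ 2 = X ^ 2 * Real.exp (2 * δ * σ) := by rw [← hθq, hX]; ring
    have h1 : N ^ 2 ≤ (X + B) ^ 2 := pow_le_pow_left₀ hN0 up 2
    -- The slack e^{2δσ} - 1 ≥ 2δσ pays for the cross term, at the price B²/(2δ). This price is
    -- affordable since B² integrates to order δ².
    have h2 : 2 * σ * X * B ≤ 2 * δ * σ ^ 2 * X ^ 2 + 1 / (2 * δ) * B ^ 2 := by
      have : 2 * δ * σ ^ 2 * X ^ 2 + 1 / (2 * δ) * B ^ 2 - 2 * σ * X * B =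
          1 / (2 * δ) * (2 * δ * σ * X - B) ^ 2 := by field_simp; ring
      have h3 : 0 ≤ 1 / (2 * δ) * (2 * δ * σ * X - B) ^ 2 := by positivity
      linarith
    have h4 : (1 + 2 * δ * σ) * (σ * X ^ 2) ≤ Real.exp (2 * δ * σ) * (σ * X ^ 2) :=
      mul_le_mul_of_nonneg_right hρ (by positivity)
    have h5 : σ * N ^ 2 ≤ σ * (X + B) ^ 2 := mul_le_mul_of_nonneg_left h1 hσ0
    have h6 : (σ + 1 / (2 * δ)) * B ^ 2 ≤ (1 + s) * (1 + 1 / (2 * δ)) * B ^ 2 :=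
      mul_le_mul_of_nonneg_right (by nlinarith) (by positivity)
    have h7 : q * (σ * ‖u‖ ^ 2) = Real.exp (2 * δ * σ) * (σ * X ^ 2) := by
      linear_combination σ * hq
    linarith
  · set τ := (R - 1) - s with hτ
    have hτ0 : 0 ≤ τ := by linarith
    have hst : s - (R - 1) = -τ := by ring
    rw [hst] at hθq ⊢
    have hρ : (1 + 2 * δ * τ) * q ≤ θ ^ 2 := by
      have : θ ^ 2 = Real.exp (2 * δ * τ) * q := by
        rw [← hθq, mul_comm, mul_assoc, ← Real.exp_add]; simp
      rw [this]
      exact mul_le_mul_of_nonneg_right (by linarith [Real.add_one_le_exp (2 * δ * τ)])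
        (Real.exp_pos _).le
    have h1 : (X - B) ^ 2 ≤ N ^ 2 := by
      rw [← sq_abs (X - B)]; exact pow_le_pow_left₀ (abs_nonneg _) low 2
    have hp : 0 < 1 + 2 * δ * τ := by positivity
    -- For low frequencies the slack is the factor 1 + 2δτ, which again completes a square at the
    -- price B²/(2δ).
    have h2 : τ * X ^ 2 ≤ (1 + 2 * δ * τ) * (τ * (X - B) ^ 2 + 1 / (2 * δ) * B ^ 2) := by
      have : (1 + 2 * δ * τ) * (τ * (X - B) ^ 2 + 1 / (2 * δ) * B ^ 2) - τ * X ^ 2 =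
          1 / (2 * δ) * (2 * δ * τ * X - (1 + 2 * δ * τ) * B) ^ 2 := by field_simp; ring
      have h3 : 0 ≤ 1 / (2 * δ) * (2 * δ * τ * X - (1 + 2 * δ * τ) * B) ^ 2 := by positivity
      linarith
    have h3 : (1 + 2 * δ * τ) * (τ * (q * ‖u‖ ^ 2)) ≤ τ * X ^ 2 := by
      have := mul_le_mul_of_nonneg_right hρ (by positivity : 0 ≤ τ * ‖u‖ ^ 2)
      calc _ = (1 + 2 * δ * τ) * q * (τ * ‖u‖ ^ 2) := by ring
        _ ≤ _ := this
        _ = _ := by rw [hX]; ring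
    have h4 := le_of_mul_le_mul_left (h3.trans h2) hp
    have h5 : τ * (X - B) ^ 2 ≤ τ * N ^ 2 := mul_le_mul_of_nonneg_left h1 hτ0
    have h6 : 1 / (2 * δ) * B ^ 2 ≤ (1 + s) * (1 + 1 / (2 * δ)) * B ^ 2 :=
      mul_le_mul_of_nonneg_right (by nlinarith) (by positivity)
    linarith

theorem sq_norm_add_ge {η : ℝ} (hη : 0 < η) (a f : ℂ) :
    (1 - η) * ‖a‖ ^ 2 - 1 / η * ‖f‖ ^ 2 ≤ ‖a + f‖ ^ 2 := by
  have low : |‖a‖ - ‖f‖| ≤ ‖a + f‖ := by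
    simpa using abs_norm_sub_norm_le a (-f)
  have h1 : (‖a‖ - ‖f‖) ^ 2 ≤ ‖a + f‖ ^ 2 := by
    rw [← sq_abs (‖a‖ - ‖f‖)]; exact pow_le_pow_left₀ (abs_nonneg _) low 2
  have : (‖a‖ - ‖f‖) ^ 2 - ((1 - η) * ‖a‖ ^ 2 - 1 / η * ‖f‖ ^ 2) =
      1 / η * (η * ‖a‖ - ‖f‖) ^ 2 + ‖f‖ ^ 2 := by field_simp; ring
  have h3 : 0 ≤ 1 / η * (η * ‖a‖ - ‖f‖) ^ 2 + ‖f‖ ^ 2 := by positivity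
  linarith

variable {Ω : Type*} [MeasurableSpace Ω] {μ : Measure Ω} {U V : Ω → ℂ} {s : Ω → ℝ}

theorem integrable_sq_norm_div (hs : Measurable s) (hs0 : ∀ x, 0 ≤ s x)
    (hU : Integrable (fun x => ‖U x‖ ^ 2) μ) :
    Integrable (fun x => ‖U x‖ ^ 2 / (1 + s x)) μ := by
  refine hU.mono' (hU.aemeasurable.div
    (measurable_const.add hs).aemeasurable).aestronglyMeasurable (.of_forall fun x => ?_)
  have := hs0 x
  rw [Real.norm_of_nonneg (by positivity)]
  exact div_le_self (by positivity) (by linarith)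

/-- One time step of the frequency-quotient estimate on the Fourier side. -/
theorem frequency_step {δ K R ε : ℝ} (hs : Measurable s) (hs0 : ∀ x, 0 ≤ s x) (hδ : 0 < δ)
    (hK : 0 ≤ K) (hR : 1 ≤ R) (hε : 0 ≤ ε) (hεK : ε ≤ 2 * (K * δ))
    (hsmall : 10 * (δ * R * (1 + K)) ≤ 1)
    (hU : Integrable (fun x => ‖U x‖ ^ 2) μ) (hV : Integrable (fun x => ‖V x‖ ^ 2) μ)
    (hF : Integrable (fun x => ‖V x - (Real.exp (-(δ * s x)) : ℂ) * U x‖ ^ 2) μ)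
    (hFε : ∫ x, ‖V x - (Real.exp (-(δ * s x)) : ℂ) * U x‖ ^ 2 ∂μ ≤ ε ^ 2 * ∫ x, ‖U x‖ ^ 2 ∂μ)
    (hUR : ∫ x, ‖U x‖ ^ 2 ∂μ ≤ R * ∫ x, ‖U x‖ ^ 2 / (1 + s x) ∂μ) :
    (∫ x, ‖U x‖ ^ 2 / (1 + s x) ∂μ) * Real.exp (-(10 * (δ * R * (1 + K)))) ≤
        ∫ x, ‖V x‖ ^ 2 / (1 + s x) ∂μ ∧
      (∫ x, ‖V x‖ ^ 2 ∂μ) ≤ R * Real.exp (8 * K ^ 2 * δ) * ∫ x, ‖V x‖ ^ 2 / (1 + s x) ∂μ := by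
  have hUj := integrable_sq_norm_div hs hs0 hU
  have hVj := integrable_sq_norm_div hs hs0 hV
  set F : Ω → ℂ := fun x => V x - (Real.exp (-(δ * s x)) : ℂ) * U x with hFdef
  have hVF (x : Ω) : V x = (Real.exp (-(δ * s x)) : ℂ) * U x + F x := by rw [hFdef]; ring
  set a := ∫ x, ‖U x‖ ^ 2 ∂μ
  set j := ∫ x, ‖U x‖ ^ 2 / (1 + s x) ∂μ
  set a' := ∫ x, ‖V x‖ ^ 2 ∂μ
  set j' := ∫ x, ‖V x‖ ^ 2 / (1 + s x) ∂μ
  set φ := ∫ x, ‖F x‖ ^ 2 ∂μ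
  have hj0 : 0 ≤ j := integral_nonneg fun x => div_nonneg (by positivity) (by linarith [hs0 x])
  have ha0 : 0 ≤ a := integral_nonneg fun x => by positivity
  have hδR : δ ≤ δ * R * (1 + K) := by
    have h1 : δ * 1 ≤ δ * R := mul_le_mul_of_nonneg_left hR hδ.le
    have h2 : 0 ≤ δ * R * K := by positivity
    linarith
  have hε2 : ε ^ 2 ≤ 4 * K ^ 2 * δ ^ 2 := by
    calc ε ^ 2 ≤ (2 * (K * δ)) ^ 2 := pow_le_pow_left₀ hε hεK 2
      _ = _ := by ring
  have hφ : φ ≤ 4 * K ^ 2 * δ ^ 2 * (R * j) :=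
    hFε.trans (mul_le_mul hε2 hUR ha0 (by positivity))
  -- The parameter η = δ(1 + K) balances Young's inequality: the error φ is of order K²δ²Rj, so φ/η
  -- is of order KδRj. The free decay e^{-2δs} ≥ 1 - 2δs costs 2δa ≤ 2δRj, as s/(1 + s) ≤ 1.
  have hmass : j * (1 - 5 * (δ * R * (1 + K))) ≤ j' := by
    have hη : 0 < δ * (1 + K) := by positivity
    have hpt (x : Ω) : (1 - δ * (1 + K)) * (‖U x‖ ^ 2 / (1 + s x) - 2 * δ * ‖U x‖ ^ 2) -
        1 / (δ * (1 + K)) * ‖F x‖ ^ 2 ≤ ‖V x‖ ^ 2 / (1 + s x) := by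
      have h0 := hs0 x
      have h1 := sq_norm_add_ge hη ((Real.exp (-(δ * s x)) : ℂ) * U x) (F x)
      rw [← hVF, norm_mul, Complex.norm_real, Real.norm_of_nonneg (Real.exp_pos _).le, mul_pow,
        ← Real.exp_nat_mul] at h1
      have h2 : 1 - 2 * δ * s x ≤ Real.exp ((2 : ℕ) * -(δ * s x)) := by
        push_cast
        linarith [Real.add_one_le_exp (2 * -(δ * s x))]
      have h3 : (1 - 2 * δ * s x) * ‖U x‖ ^ 2 ≤ Real.exp ((2 : ℕ) * -(δ * s x)) * ‖U x‖ ^ 2 :=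
        mul_le_mul_of_nonneg_right h2 (by positivity)
      have h4 : 0 ≤ 1 - δ * (1 + K) := by nlinarith
      have h5 := (sub_le_sub_right (mul_le_mul_of_nonneg_left h3 h4) _).trans h1
      have h6 := div_le_div_of_nonneg_right h5 (by linarith : 0 ≤ 1 + s x)
      refine le_trans ?_ h6
      rw [sub_div]
      refine sub_le_sub ?_ (div_le_self (by positivity) (by linarith))
      rw [mul_div_assoc]
      refine mul_le_mul_of_nonneg_left ?_ h4
      rw [le_div_iff₀ (by linarith), sub_mul, div_mul_cancel₀ _ (by linarith)]
      have : 0 ≤ δ * ‖U x‖ ^ 2 := by positivity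
      linarith
    have i1 : Integrable (fun x => (1 - δ * (1 + K)) *
        (‖U x‖ ^ 2 / (1 + s x) - 2 * δ * ‖U x‖ ^ 2)) μ :=
      (hUj.sub (hU.const_mul (2 * δ))).const_mul _
    have i2 : Integrable (fun x => 1 / (δ * (1 + K)) * ‖F x‖ ^ 2) μ := hF.const_mul _
    have h1 := integral_mono (i1.sub i2) hVj hpt
    simp only [Pi.sub_apply] at h1
    rw [integral_sub i1 i2, integral_const_mul, integral_const_mul,
      integral_sub hUj (hU.const_mul (2 * δ)), integral_const_mul] at h1
    change (1 - δ * (1 + K)) * (j - 2 * δ * a) - 1 / (δ * (1 + K)) * φ ≤ j' at h1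
    have h2 : 1 / (δ * (1 + K)) * φ ≤ 4 * K * δ * (R * j) := by
      rw [one_div, inv_mul_le_iff₀ hη]
      refine hφ.trans ?_
      have : 0 ≤ K * δ ^ 2 * (R * j) := by positivity
      nlinarith
    have h4 : 0 ≤ 1 - δ * (1 + K) := by nlinarith
    have h5 : (1 - δ * (1 + K)) * (j - 2 * δ * (R * j)) ≤ (1 - δ * (1 + K)) * (j - 2 * δ * a) :=
      mul_le_mul_of_nonneg_left (by nlinarith) h4
    have h6 : 0 ≤ δ * (1 + K) * (2 * δ * (R * j)) := by positivity
    have h7 : δ * (1 + K) * j ≤ δ * (1 + K) * (R * j) :=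
      mul_le_mul_of_nonneg_left (by nlinarith) hη.le
    have h8 : 0 ≤ δ * (R * j) := by positivity
    nlinarith
  have hhalf : j ≤ 2 * j' := by nlinarith
  have hj'0 : 0 ≤ j' := by linarith
  refine ⟨?_, ?_⟩
  · refine le_trans (mul_le_mul_of_nonneg_left ?_ hj0) hmass
    set y := 5 * (δ * R * (1 + K)) with hy
    have hy0 : 0 ≤ y := by positivity
    rw [show 10 * (δ * R * (1 + K)) = 2 * y by rw [hy]; ring, Real.exp_neg]
    refine inv_le_of_inv_le₀ (by linarith) ?_
    rw [inv_le_iff_one_le_mul₀ (by linarith)]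
    nlinarith [Real.add_one_le_exp (2 * y)]
  -- Integrated, the pointwise inequality keeps a - Rj ≤ 0 up to an error of at most 4K²δRj ≤
  -- 8K²δRj', which is the growth of the quotient.
  · have hpt (x : Ω) : ‖V x‖ ^ 2 - R * (‖V x‖ ^ 2 / (1 + s x)) ≤
        Real.exp (-(2 * δ * (R - 1))) * (‖U x‖ ^ 2 - R * (‖U x‖ ^ 2 / (1 + s x))) +
          (1 + 1 / (2 * δ)) * ‖F x‖ ^ 2 := by
      have := mul_sq_norm_exp_mul_add_le hδ hR (hs0 x) (U x) (F x)
      rw [← hVF] at this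
      convert this using 1
      · ring
      · ring
    have i1 : Integrable (fun x => Real.exp (-(2 * δ * (R - 1))) *
        (‖U x‖ ^ 2 - R * (‖U x‖ ^ 2 / (1 + s x)))) μ := (hU.sub (hUj.const_mul R)).const_mul _
    have i2 : Integrable (fun x => (1 + 1 / (2 * δ)) * ‖F x‖ ^ 2) μ := hF.const_mul _
    have h1 := integral_mono (hV.sub (hVj.const_mul R)) (i1.add i2) hpt
    simp only [Pi.sub_apply, Pi.add_apply] at h1
    rw [integral_sub hV (hVj.const_mul R), integral_const_mul, integral_add i1 i2, integral_const_mul,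
      integral_const_mul, integral_sub hU (hUj.const_mul R), integral_const_mul] at h1
    change a' - R * j' ≤ Real.exp (-(2 * δ * (R - 1))) * (a - R * j) + (1 + 1 / (2 * δ)) * φ at h1
    have h2 : Real.exp (-(2 * δ * (R - 1))) * (a - R * j) ≤ 0 :=
      mul_nonpos_of_nonneg_of_nonpos (Real.exp_pos _).le (by linarith)
    have h3 : (1 + 1 / (2 * δ)) * φ ≤ 4 * K ^ 2 * δ * (R * j) := by
      have e1 : 1 + 1 / (2 * δ) ≤ 1 / δ := by
        have e2 : 1 / δ = 1 / (2 * δ) + 1 / (2 * δ) := by field_simp; norm_num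
        have e3 : 1 ≤ 1 / (2 * δ) := (one_le_div (by positivity)).2 (by linarith)
        linarith
      calc (1 + 1 / (2 * δ)) * φ ≤ 1 / δ * (4 * K ^ 2 * δ ^ 2 * (R * j)) :=
            mul_le_mul e1 hφ (integral_nonneg fun x => by positivity) (by positivity)
        _ = _ := by field_simp
    have h4 : 4 * K ^ 2 * δ * (R * j) ≤ 4 * K ^ 2 * δ * (R * (2 * j')) := by gcongr
    have h5 : R * j' * (1 + 8 * K ^ 2 * δ) ≤ R * j' * Real.exp (8 * K ^ 2 * δ) :=
      mul_le_mul_of_nonneg_left (by linarith [Real.add_one_le_exp (8 * K ^ 2 * δ)]) (by positivity)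
    nlinarith

end Backward

/-! ### Plancherel's identity and the H^{-1} norm -/

section FourierL2

variable {u v : EuclideanSpace ℝ (Fin n) → ℝ} {M t : ℝ}

open Classical in
/-- A representative of the `L²` Fourier transform of a square integrable real function. -/
noncomputable def fourierL2 (u : EuclideanSpace ℝ (Fin n) → ℝ) : EuclideanSpace ℝ (Fin n) → ℂ :=
  if h : MemLp (fun x => (u x : ℂ)) 2 volume then
    (𝓕 (h.toLp _) : Lp ℂ 2 (volume : Measure (EuclideanSpace ℝ (Fin n)))) else 0

theorem fourierL2_eq (h : MemLp (fun x => (u x : ℂ)) 2 volume) :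
    fourierL2 u = (𝓕 (h.toLp _) : Lp ℂ 2 (volume : Measure (EuclideanSpace ℝ (Fin n)))) :=
  dif_pos h

theorem memLp_ofReal_of_integrable_sq (hu : Measurable u) (h2 : Integrable (fun x => u x ^ 2)) :
    MemLp (fun x => (u x : ℂ)) 2 volume :=
  ((memLp_two_iff_integrable_sq hu.aestronglyMeasurable).2 h2).ofReal

theorem integrable_sq_norm_Lp (g : Lp ℂ 2 (volume : Measure (EuclideanSpace ℝ (Fin n)))) :
    Integrable (fun ξ => ‖g ξ‖ ^ 2) :=
  (memLp_two_iff_integrable_sq_norm (Lp.aestronglyMeasurable g)).1 (Lp.memLp g)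

theorem integral_sq_norm_Lp (g : Lp ℂ 2 (volume : Measure (EuclideanSpace ℝ (Fin n)))) :
    ∫ ξ, ‖g ξ‖ ^ 2 = ‖g‖ ^ 2 := by
  have := L2.inner_def (𝕜 := ℂ) g g
  rw [inner_self_eq_norm_sq_to_K] at this
  simp_rw [inner_self_eq_norm_sq_to_K] at this
  have h2 : ((∫ ξ, ‖g ξ‖ ^ 2 : ℝ) : ℂ) = ((‖g‖ ^ 2 : ℝ) : ℂ) := by
    rw [← integral_complex_ofReal]
    push_cast
    exact this.symm
  exact_mod_cast h2

theorem integrable_sq_norm_fourierL2 (h : MemLp (fun x => (u x : ℂ)) 2 volume) :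
    Integrable (fun ξ => ‖fourierL2 u ξ‖ ^ 2) := by
  rw [fourierL2_eq h]; exact integrable_sq_norm_Lp _

/-- Plancherel's identity. -/
theorem integral_sq_norm_fourierL2 (h : MemLp (fun x => (u x : ℂ)) 2 volume) :
    ∫ ξ, ‖fourierL2 u ξ‖ ^ 2 = ∫ x, u x ^ 2 := by
  rw [fourierL2_eq h, integral_sq_norm_Lp, Lp.norm_fourier_eq, ← integral_sq_norm_Lp]
  refine integral_congr_ae ?_
  filter_upwards [h.coeFn_toLp] with x hx
  rw [hx, Complex.norm_real, Real.norm_eq_abs, sq_abs]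

theorem fourierL2_sub (hu : MemLp (fun x => (u x : ℂ)) 2 volume)
    (hv : MemLp (fun x => (v x : ℂ)) 2 volume) :
    fourierL2 (fun x => u x - v x) =ᵐ[volume] fun ξ => fourierL2 u ξ - fourierL2 v ξ := by
  have huv : MemLp (fun x => ((u x - v x : ℝ) : ℂ)) 2 volume := by
    simpa only [Complex.ofReal_sub] using! hu.sub hv
  have e : huv.toLp _ = hu.toLp _ - hv.toLp _ := by
    rw [← MemLp.toLp_sub]
    exact MemLp.toLp_congr _ _ (.of_forall fun x => by simp)
  have e' : 𝓕 (hu.toLp _ - hv.toLp _) = 𝓕 (hu.toLp _) - 𝓕 (hv.toLp _) :=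
    (Lp.fourierTransformₗᵢ _ ℂ).map_sub _ _
  rw [fourierL2_eq huv, fourierL2_eq hu, fourierL2_eq hv, e, e']
  exact Lp.coeFn_sub _ _

theorem fourierL2_congr (h : u =ᵐ[volume] v) : fourierL2 u = fourierL2 v := by
  have hc : (fun x => (u x : ℂ)) =ᵐ[volume] fun x => (v x : ℂ) := by
    filter_upwards [h] with x hx
    rw [hx]
  by_cases hu : MemLp (fun x => (u x : ℂ)) 2 volume
  · have hv := hu.ae_eq hc
    rw [fourierL2_eq hu, fourierL2_eq hv, (MemLp.toLp_eq_toLp_iff hu hv).2 hc]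
  · have hv : ¬ MemLp (fun x => (v x : ℂ)) 2 volume := fun hv => hu (hv.ae_eq hc.symm)
    rw [fourierL2, fourierL2, dif_neg hu, dif_neg hv]

theorem sq_hNegOneNorm (hu : MemLp u 2 volume) :
    hNegOneNorm hu ^ 2 =
      ∫ ξ, ‖fourierL2 u ξ‖ ^ 2 / (1 + 4 * Real.pi ^ 2 * ‖ξ‖ ^ 2) := by
  rw [hNegOneNorm, Real.sq_sqrt (integral_nonneg fun ξ => by positivity),
    fourierL2_eq (u := u) hu.ofReal]

end FourierL2

/-! ### The backward estimate -/

namespace IsHeatPerturbation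

variable {K T : ℝ} {w : ℝ → EuclideanSpace ℝ (Fin n) → ℝ}

theorem memLp_ofReal (hw : IsHeatPerturbation K T w) (h0 : Integrable (fun x => w 0 x ^ 2))
    {t : ℝ} (ht : t ∈ Icc 0 T) : MemLp (fun x => (w t x : ℂ)) 2 volume :=
  memLp_ofReal_of_integrable_sq (hw.measurable t ht) (hw.integrable_sq h0 ht)

/-- Plancherel's identity carries the one-step L² estimate to the Fourier side, in the form that
`frequency_step` takes. -/
theorem fourier_sub_exp_mul (hw : IsHeatPerturbation K T w)
    (h0 : Integrable (fun x => w 0 x ^ 2)) {s t : ℝ} (hs : 0 ≤ s) (hst : s < t) (ht : t ≤ T) :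
    Integrable (fun ξ => ‖fourierL2 (w t) ξ -
        (Real.exp (-((t - s) * (4 * Real.pi ^ 2 * ‖ξ‖ ^ 2))) : ℂ) * fourierL2 (w s) ξ‖ ^ 2) ∧
      ∫ ξ, ‖fourierL2 (w t) ξ -
        (Real.exp (-((t - s) * (4 * Real.pi ^ 2 * ‖ξ‖ ^ 2))) : ℂ) * fourierL2 (w s) ξ‖ ^ 2 ≤
      (Real.exp (K * (t - s)) - 1) ^ 2 * ∫ ξ, ‖fourierL2 (w s) ξ‖ ^ 2 := by
  obtain ⟨M, hM⟩ := hw.bounded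
  have hsI : s ∈ Icc 0 T := ⟨hs, (hst.trans_le ht).le⟩
  have htI : t ∈ Icc 0 T := ⟨hs.trans hst.le, ht⟩
  have hs2 := hw.memLp_ofReal h0 hsI
  have ht2 := hw.memLp_ofReal h0 htI
  have hS2 : MemLp (fun x => (heatSemigroup (t - s) (w s) x : ℂ)) 2 volume :=
    memLp_ofReal_of_integrable_sq (measurable_heatSemigroup _ (hw.measurable s hsI))
      (integrable_sq_heatSemigroup (sub_pos.2 hst) (hw.measurable s hsI) (hM s hsI)
        (hw.integrable_sq h0 hsI)).1
  have hd : MemLp (fun x => ((w t x - heatSemigroup (t - s) (w s) x : ℝ) : ℂ)) 2 volume := by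
    simpa only [Complex.ofReal_sub] using! ht2.sub hS2
  have hF := fourier_toLp_heatSemigroup (sub_pos.2 hst) (hw.measurable s hsI) (hM s hsI) hs2 hS2
  rw [← fourierL2_eq hS2, ← fourierL2_eq hs2] at hF
  have e : (fun ξ => ‖fourierL2 (fun x => w t x - heatSemigroup (t - s) (w s) x) ξ‖ ^ 2)
      =ᵐ[volume] fun ξ => ‖fourierL2 (w t) ξ -
        (Real.exp (-((t - s) * (4 * Real.pi ^ 2 * ‖ξ‖ ^ 2))) : ℂ) * fourierL2 (w s) ξ‖ ^ 2 := by
    filter_upwards [hF, fourierL2_sub ht2 hS2] with ξ h1 h2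
    rw [h2, h1]
  refine ⟨(integrable_sq_norm_fourierL2 hd).congr e, ?_⟩
  rw [← integral_congr_ae e, integral_sq_norm_fourierL2 hd, integral_sq_norm_fourierL2 hs2]
  exact hw.integral_sub_sq_le h0 hs hst ht

/-- A lower bound for the `L²` norm at the final time in terms of the initial frequency quotient. -/
theorem integral_sq_zero_le (hw : IsHeatPerturbation K T w)
    (h0 : Integrable (fun x => w 0 x ^ 2)) (hK : 0 ≤ K) (hT : 0 < T) {R : ℝ} (hR : 1 ≤ R)
    (hwR : ∫ x, w 0 x ^ 2 ≤
      R * ∫ ξ, ‖fourierL2 (w 0) ξ‖ ^ 2 / (1 + 4 * Real.pi ^ 2 * ‖ξ‖ ^ 2)) :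
    ∫ x, w 0 x ^ 2 ≤
      Real.exp ((1 + 10 * (1 + K) * T * Real.exp (8 * K ^ 2 * T)) * R) * ∫ x, w T x ^ 2 := by
  set s : EuclideanSpace ℝ (Fin n) → ℝ := fun ξ => 4 * Real.pi ^ 2 * ‖ξ‖ ^ 2 with hsdef
  have hs : Measurable s := by fun_prop
  have hs0 (ξ : EuclideanSpace ℝ (Fin n)) : 0 ≤ s ξ := by positivity
  set A : ℝ → ℝ := fun t => ∫ ξ, ‖fourierL2 (w t) ξ‖ ^ 2 with hA
  set J : ℝ → ℝ := fun t => ∫ ξ, ‖fourierL2 (w t) ξ‖ ^ 2 / (1 + s ξ) with hJ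
  have hI (t : ℝ) (ht : t ∈ Icc 0 T) : Integrable fun ξ => ‖fourierL2 (w t) ξ‖ ^ 2 :=
    integrable_sq_norm_fourierL2 (hw.memLp_ofReal h0 ht)
  -- The quotient bound cannot exceed R' up to time T, whatever the number of steps; hence m can be
  -- chosen afterwards so large that every step is short enough for `frequency_step`.
  set R' := R * Real.exp (8 * K ^ 2 * T) with hR'
  have hR'1 : 1 ≤ R' := by
    have := Real.one_le_exp (by positivity : 0 ≤ 8 * K ^ 2 * T)
    nlinarith
  obtain ⟨m, hm⟩ := exists_nat_gt (10 * (T * R' * (1 + K)))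
  have hm0 : (0 : ℝ) < m := lt_of_le_of_lt (by positivity) hm
  set δ := T / m with hδdef
  have hδ : 0 < δ := by positivity
  have hmδ : m * δ = T := by rw [hδdef]; field_simp
  have hsmall : 10 * (δ * R' * (1 + K)) ≤ 1 := by
    rw [hδdef, show 10 * (T / m * R' * (1 + K)) = 10 * (T * R' * (1 + K)) / m by ring]
    exact (div_le_one hm0).2 hm.le
  have hsmallK : K * δ ≤ 1 := by
    have h1 : δ * (1 + K) * 1 ≤ δ * (1 + K) * R' := mul_le_mul_of_nonneg_left hR'1 (by positivity)
    nlinarith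
  have hA0 : A 0 = ∫ x, w 0 x ^ 2 := integral_sq_norm_fourierL2 (hw.memLp_ofReal h0 ⟨le_rfl, hT.le⟩)
  have hAT : A T = ∫ x, w T x ^ 2 := integral_sq_norm_fourierL2 (hw.memLp_ofReal h0 ⟨hT.le, le_rfl⟩)
  have hJ0 (t : ℝ) : 0 ≤ J t := integral_nonneg fun ξ => by have := hs0 ξ; positivity
  have key (k : ℕ) (hk : k ≤ m) :
      A (k * δ) ≤ R * Real.exp (8 * K ^ 2 * (k * δ)) * J (k * δ) ∧
        J 0 * Real.exp (-(10 * (R' * (1 + K)) * (k * δ))) ≤ J (k * δ) := by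
    induction k with
    | zero => simpa [hA0] using hwR
    | succ k ih =>
      obtain ⟨ih1, ih2⟩ := ih (by omega)
      have hkm : ((k + 1 : ℕ) : ℝ) ≤ m := by exact_mod_cast hk
      have hlt : (k : ℝ) * δ < ((k + 1 : ℕ) : ℝ) * δ := by push_cast; linarith
      have hle : ((k + 1 : ℕ) : ℝ) * δ ≤ T := by
        rw [← hmδ]; exact mul_le_mul_of_nonneg_right hkm hδ.le
      have hk0 : 0 ≤ (k : ℝ) * δ := by positivity
      have hdiff : ((k + 1 : ℕ) : ℝ) * δ - k * δ = δ := by push_cast; ring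
      obtain ⟨f1, f2⟩ := hw.fourier_sub_exp_mul h0 hk0 hlt hle
      rw [hdiff] at f1 f2
      set Rk := R * Real.exp (8 * K ^ 2 * (k * δ)) with hRk
      have hRk1 : 1 ≤ Rk := by
        have := Real.one_le_exp (by positivity : 0 ≤ 8 * K ^ 2 * (k * δ))
        nlinarith
      have hRkR : Rk ≤ R' := by
        rw [hRk, hR']
        gcongr
        linarith
      have hprod : δ * Rk * (1 + K) ≤ δ * R' * (1 + K) := by gcongr
      obtain ⟨g1, g2⟩ := frequency_step hs hs0 hδ hK hRk1
        (sub_nonneg.2 (Real.one_le_exp (by positivity)))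
        (exp_sub_one_le_two_mul (by positivity) hsmallK)
        (by linarith)
        (hI _ ⟨hk0, (hlt.trans_le hle).le⟩) (hI _ ⟨hk0.trans hlt.le, hle⟩) f1 f2 ih1
      refine ⟨g2.trans_eq ?_, le_trans ?_ g1⟩
      · rw [hRk, mul_assoc R, ← Real.exp_add]
        congr 3
        push_cast; ring
      · refine le_trans ?_ (mul_le_mul_of_nonneg_right ih2 (Real.exp_pos _).le)
        rw [mul_assoc (J 0), ← Real.exp_add]
        refine mul_le_mul_of_nonneg_left (Real.exp_le_exp.2 ?_) (hJ0 0)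
        push_cast
        linarith
  obtain ⟨-, hfin⟩ := key m le_rfl
  rw [hmδ] at hfin
  have hJA : J T ≤ A T := by
    refine integral_mono (integrable_sq_norm_div hs hs0 (hI T ⟨hT.le, le_rfl⟩))
      (hI T ⟨hT.le, le_rfl⟩) fun ξ => div_le_self (by positivity) ?_
    linarith [hs0 ξ]
  rw [← hAT]
  calc ∫ x, w 0 x ^ 2 ≤ R * J 0 := hwR
    -- The factor R is absorbed as R ≤ e^R; this is the summand 1 in the final exponent.
    _ ≤ Real.exp R * J 0 :=
      mul_le_mul_of_nonneg_right (by linarith [Real.add_one_le_exp R]) (hJ0 0)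
    _ = Real.exp ((1 + 10 * (1 + K) * T * Real.exp (8 * K ^ 2 * T)) * R) *
        (J 0 * Real.exp (-(10 * (R' * (1 + K)) * T))) := by
      rw [mul_left_comm, ← Real.exp_add, mul_comm]
      congr 2
      rw [hR']; ring
    _ ≤ _ := mul_le_mul_of_nonneg_left (hfin.trans hJA) (Real.exp_pos _).le

end IsHeatPerturbation

/-! ### From bounded solutions and cubes to perturbations and balls -/

section Reduction

theorem heatSemigroup_congr_ae {u v : EuclideanSpace ℝ (Fin n) → ℝ} (h : u =ᵐ[volume] v) (t : ℝ) :
    heatSemigroup t u = heatSemigroup t v := by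
  ext x
  refine integral_congr_ae ?_
  filter_upwards [h] with z hz
  rw [hz]

theorem heatSemigroup_sub {u v : EuclideanSpace ℝ (Fin n) → ℝ} {A B t : ℝ} (ht : 0 < t)
    (hu : Measurable u) (hA : ∀ x, |u x| ≤ A) (hv : Measurable v) (hB : ∀ x, |v x| ≤ B)
    (x : EuclideanSpace ℝ (Fin n)) :
    heatSemigroup t (fun z => u z - v z) x = heatSemigroup t u x - heatSemigroup t v x := by
  unfold heatSemigroup
  simp_rw [mul_sub]
  exact integral_sub (integrable_mul_of_abs_le (integrable_heatKernel_sub ht x) hu hA)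
    (integrable_mul_of_abs_le (integrable_heatKernel_sub ht x) hv hB)

theorem ae_abs_le_toReal_eLpNorm {u : EuclideanSpace ℝ (Fin n) → ℝ} {N : ℝ≥0∞}
    (h : eLpNorm u ∞ volume ≤ N) (hN : N ≠ ∞) : ∀ᵐ x, |u x| ≤ N.toReal := by
  rw [eLpNorm_exponent_top] at h
  filter_upwards [enorm_ae_le_eLpNormEssSup u volume] with x hx
  have := ENNReal.toReal_mono hN (hx.trans h)
  simpa using this

theorem ae_abs_le_of_timeSpaceSupNorm_le {T : ℝ} {y : ℝ → EuclideanSpace ℝ (Fin n) → ℝ} {N : ℝ≥0∞}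
    (h : timeSpaceSupNorm T y ≤ N) (hN : N ≠ ∞) :
    ∀ᵐ s ∂volume.restrict (Ioo 0 T), ∀ᵐ z, |y s z| ≤ N.toReal := by
  filter_upwards [ENNReal.ae_le_essSup (μ := volume.restrict (Ioo 0 T))
    (fun t => eLpNorm (y t) ∞ volume)] with s hs
  exact ae_abs_le_toReal_eLpNorm (hs.trans h) hN

theorem exists_measurable_bounded_ae_eq {u : EuclideanSpace ℝ (Fin n) → ℝ}
    (hu : MemLp u ∞ volume) :
    ∃ v : EuclideanSpace ℝ (Fin n) → ℝ, Measurable v ∧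
      (∀ x, |v x| ≤ (eLpNorm u ∞ volume).toReal) ∧ v =ᵐ[volume] u := by
  set B := (eLpNorm u ∞ volume).toReal
  have hB : 0 ≤ B := ENNReal.toReal_nonneg
  refine ⟨fun x => max (-B) (min (hu.1.mk u x) B),
    measurable_const.max (hu.1.stronglyMeasurable_mk.measurable.min measurable_const),
    fun x => abs_le.2 ⟨le_max_left _ _, max_le (by linarith) (min_le_right _ _)⟩, ?_⟩
  filter_upwards [hu.1.ae_eq_mk, ae_abs_le_toReal_eLpNorm le_rfl hu.2.ne] with x h1 h2
  rw [← h1, min_eq_left (abs_le.1 h2).2, max_eq_right (abs_le.1 h2).1]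

/-- A jointly measurable representative truncated at ±B: the Duhamel flow asks for measurability and
bounds everywhere, and the heat semigroup does not see null sets. -/
theorem exists_measurable_bounded_source {T B : ℝ} {g : ℝ → EuclideanSpace ℝ (Fin n) → ℝ}
    (hg : AEStronglyMeasurable (fun p : ℝ × EuclideanSpace ℝ (Fin n) => g p.1 p.2)
      ((volume.restrict (Ioo 0 T)).prod volume)) (hB : 0 ≤ B)
    (hgB : ∀ᵐ s ∂volume.restrict (Ioo 0 T), ∀ᵐ z, |g s z| ≤ B) :
    ∃ F : ℝ → EuclideanSpace ℝ (Fin n) → ℝ,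
      Measurable (fun p : ℝ × EuclideanSpace ℝ (Fin n) => F p.1 p.2) ∧ (∀ s x, |F s x| ≤ B) ∧
      ∀ᵐ s ∂volume.restrict (Ioo 0 T), F s =ᵐ[volume] g s := by
  refine ⟨fun s x => max (-B) (min (hg.mk _ (s, x)) B),
    measurable_const.max (hg.stronglyMeasurable_mk.measurable.min measurable_const),
    fun s x => abs_le.2 ⟨le_max_left _ _, max_le (by linarith) (min_le_right _ _)⟩, ?_⟩
  filter_upwards [Measure.ae_ae_of_ae_prod hg.ae_eq_mk, hgB] with s h1 h2
  filter_upwards [h1, h2] with z h3 h4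
  rw [← h3, min_eq_left (abs_le.1 h4).2, max_eq_right (abs_le.1 h4).1]

/-- The difference of two bounded solutions is a perturbation of the heat flow. -/
theorem exists_isHeatPerturbation_sub {f : ℝ → ℝ} {T : ℝ} {LM : ℝ≥0}
    {y₁0 y₂0 : EuclideanSpace ℝ (Fin n) → ℝ} {y₁ y₂ : ℝ → EuclideanSpace ℝ (Fin n) → ℝ}
    (hT : 0 < T) (hf : Continuous f) (hf0 : f 0 = 0)
    (h₁ : MemLp y₁0 ∞ volume) (h₂ : MemLp y₂0 ∞ volume)
    (hy₁ : IsBoundedSolution f T y₁0 y₁) (hy₂ : IsBoundedSolution f T y₂0 y₂)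
    (hL : LipschitzOnWith LM f
      {s | |s| ≤ (max (timeSpaceSupNorm T y₁) (timeSpaceSupNorm T y₂)).toReal}) :
    ∃ w, IsHeatPerturbation LM T w ∧ (w 0 =ᵐ[volume] fun x => y₁0 x - y₂0 x) ∧
      (w T =ᵐ[volume] fun x => y₁ T x - y₂ T x) := by
  set N := max (timeSpaceSupNorm T y₁) (timeSpaceSupNorm T y₂)
  have hN : N ≠ ∞ := (max_lt hy₁.bounded hy₂.bounded).ne
  have hM : 0 ≤ N.toReal := ENNReal.toReal_nonneg
  have hfb (a : ℝ) (ha : |a| ≤ N.toReal) : |f a| ≤ LM * N.toReal := by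
    have := hL.norm_sub_le (x := a) (y := 0) ha (by simp)
    rw [hf0, sub_zero, sub_zero, Real.norm_eq_abs, Real.norm_eq_abs] at this
    exact this.trans (by gcongr)
  have b₁ := ae_abs_le_of_timeSpaceSupNorm_le (le_max_left _ _ : timeSpaceSupNorm T y₁ ≤ N) hN
  have b₂ := ae_abs_le_of_timeSpaceSupNorm_le (le_max_right _ _ : timeSpaceSupNorm T y₂ ≤ N) hN
  obtain ⟨v₁, mv₁, bv₁, ev₁⟩ := exists_measurable_bounded_ae_eq h₁
  obtain ⟨v₂, mv₂, bv₂, ev₂⟩ := exists_measurable_bounded_ae_eq h₂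
  obtain ⟨F₁, mF₁, bF₁, eF₁⟩ := exists_measurable_bounded_source
    (g := fun s z => f (y₁ s z)) (hf.comp_aestronglyMeasurable hy₁.aestronglyMeasurable)
    (mul_nonneg LM.coe_nonneg hM)
    (b₁.mono fun s hs => hs.mono fun z hz => hfb _ hz)
  obtain ⟨F₂, mF₂, bF₂, eF₂⟩ := exists_measurable_bounded_source
    (g := fun s z => f (y₂ s z)) (hf.comp_aestronglyMeasurable hy₂.aestronglyMeasurable)
    (mul_nonneg LM.coe_nonneg hM)
    (b₂.mono fun s hs => hs.mono fun z hz => hfb _ hz)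
  set v : EuclideanSpace ℝ (Fin n) → ℝ := fun x => v₁ x - v₂ x with hv
  -- The order is reversed because f(y) enters Duhamel's formula with a minus sign.
  set F : ℝ → EuclideanSpace ℝ (Fin n) → ℝ := fun s x => F₂ s x - F₁ s x with hF
  have src {g F : ℝ → EuclideanSpace ℝ (Fin n) → ℝ}
      (e : ∀ᵐ s ∂volume.restrict (Ioo 0 T), F s =ᵐ[volume] g s) {t : ℝ} (ht : t ∈ Ioc 0 T)
      (x : EuclideanSpace ℝ (Fin n)) :
      ∫ s in (0 : ℝ)..t, heatSemigroup (t - s) (g s) x =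
        ∫ s in Ioo 0 t, heatSemigroup (t - s) (F s) x := by
    rw [integral_source_eq_setIntegral ht.1.le]
    refine integral_congr_ae ?_
    filter_upwards [ae_restrict_of_ae_restrict_of_subset (Ioo_subset_Ioo_right ht.2) e] with s hs
    rw [heatSemigroup_congr_ae hs]
  have flow {t : ℝ} (ht : t ∈ Ioc 0 T) :
      duhamelFlow v F t =ᵐ[volume] fun x => y₁ t x - y₂ t x := by
    filter_upwards [hy₁.duhamel t ht, hy₂.duhamel t ht] with x hx₁ hx₂
    rw [hx₁, hx₂, duhamelFlow_of_pos ht.1, heatSemigroup_sub ht.1 mv₁ bv₁ mv₂ bv₂,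
      heatSemigroup_congr_ae ev₁, heatSemigroup_congr_ae ev₂, src eF₁ ht, src eF₂ ht,
      integral_source_eq_setIntegral ht.1.le]
    have : ∫ s in Ioo 0 t, heatSemigroup (t - s) (F s) x =
        (∫ s in Ioo 0 t, heatSemigroup (t - s) (F₂ s) x) -
          ∫ s in Ioo 0 t, heatSemigroup (t - s) (F₁ s) x := by
      rw [← integral_sub (integrableOn_source mF₂ bF₂ le_rfl x)
        (integrableOn_source mF₁ bF₁ le_rfl x)]
      refine setIntegral_congr_fun measurableSet_Ioo fun s hs => ?_
      exact heatSemigroup_sub (sub_pos.2 hs.2) (mF₂.comp measurable_prodMk_left) (bF₂ s)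
        (mF₁.comp measurable_prodMk_left) (bF₁ s) x
    rw [this]; ring
  refine ⟨duhamelFlow v F, ?_, ?_, flow ⟨hT, le_rfl⟩⟩
  · refine isHeatPerturbation_duhamelFlow (mv₁.sub mv₂)
      (fun x => (abs_sub _ _).trans (add_le_add (bv₁ x) (bv₂ x))) (mF₂.sub mF₁)
      (fun s x => (abs_sub _ _).trans (add_le_add (bF₂ s x) (bF₁ s x))) LM.coe_nonneg ?_
    -- For almost every s both solutions take values in the range where f is Lipschitz, and the flow
    -- at s is a representative of y₁ - y₂; so the source is at most L_M times the flow.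
    filter_upwards [b₁, b₂, eF₁, eF₂, ae_restrict_mem measurableSet_Ioo] with s c₁ c₂ d₁ d₂ hs
    filter_upwards [c₁, c₂, d₁, d₂, flow ⟨hs.1, hs.2.le⟩] with z p₁ p₂ q₁ q₂ hz
    rw [hz, hF]
    simp only
    rw [q₁, q₂, abs_sub_comm (y₁ s z)]
    exact hL.norm_sub_le p₂ p₁
  · rw [duhamelFlow_zero]
    filter_upwards [ev₁, ev₂] with x e₁ e₂
    rw [hv]
    simp only
    rw [e₁, e₂]

theorem IsOpenCube.dist_le {L : ℝ} {I : Set (EuclideanSpace ℝ (Fin n))} (hI : IsOpenCube L I)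
    {x y : EuclideanSpace ℝ (Fin n)} (hx : x ∈ I) (hy : y ∈ I) : dist x y ≤ Real.sqrt n * L := by
  obtain ⟨e, rfl⟩ := hI
  obtain ⟨a, ha, rfl⟩ := hx
  obtain ⟨b, hb, rfl⟩ := hy
  -- In dimension 0 the cube condition is empty and says nothing about the sign of L.
  rcases Nat.eq_zero_or_pos n with rfl | hn
  · simp [Subsingleton.elim a b]
  have hL : 0 ≤ L := ((ha ⟨0, hn⟩).1.trans (ha ⟨0, hn⟩).2).le
  rw [e.dist_eq, EuclideanSpace.dist_eq, ← Real.sqrt_sq hL, ← Real.sqrt_mul (by positivity)]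
  refine Real.sqrt_le_sqrt ?_
  calc ∑ i, dist (a i) (b i) ^ 2 ≤ ∑ _i : Fin n, L ^ 2 := by
        refine Finset.sum_le_sum fun i _ => pow_le_pow_left₀ dist_nonneg ?_ 2
        have h1 := ha i
        have h2 := hb i
        rw [Real.dist_eq, abs_le]
        constructor <;> linarith
    _ = n * L ^ 2 := by simp

/-- The covering radius is the diameter √n L of a cube plus 1, as the cubes are only dense and a
point may lie in none of them. -/
theorem IsObservationSet.exists_centers {L r : ℝ} {ω : Set (EuclideanSpace ℝ (Fin n))}
    (h : IsObservationSet L r ω) : ∃ c : ℕ+ → EuclideanSpace ℝ (Fin n),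
      (Pairwise fun i j => Disjoint (Metric.ball (c i) r) (Metric.ball (c j) r)) ∧
      (∀ j, Metric.ball (c j) r ⊆ ω) ∧ ∀ x, ∃ j, x ∈ Metric.ball (c j) (Real.sqrt n * L + 1) := by
  obtain ⟨-, I, hI, hd, hcl, hb⟩ := h
  choose c hc hcb using hb
  refine ⟨c, fun i j hij => ?_, fun j => (hcb j).trans inter_subset_right, fun x => ?_⟩
  · exact (disjoint_iff_inter_eq_empty.2 (hd i j hij)).mono
      ((hcb i).trans inter_subset_left) ((hcb j).trans inter_subset_left)
  · have hx : x ∈ closure (⋃ j, I j) := hcl ▸ mem_univ x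
    obtain ⟨y, hy, hxy⟩ := Metric.mem_closure_iff.1 hx 1 one_pos
    obtain ⟨j, hj⟩ := mem_iUnion.1 hy
    refine ⟨j, ?_⟩
    rw [Metric.mem_ball]
    linarith [dist_triangle x y (c j), (hI j).dist_le hj (hc j)]

end Reduction

/-! ### Conclusion -/

/-- For a nonzero function the `H^{-1}` norm is positive and at most the `L²` norm. -/
theorem sq_hNegOneNorm_pos_and_le {u : EuclideanSpace ℝ (Fin n) → ℝ} (hu : MemLp u 2 volume)
    (h0 : ¬ u =ᵐ[volume] 0) :
    0 < hNegOneNorm hu ^ 2 ∧ hNegOneNorm hu ^ 2 ≤ ∫ x, u x ^ 2 := by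
  have hs : Measurable fun ξ : EuclideanSpace ℝ (Fin n) => 4 * Real.pi ^ 2 * ‖ξ‖ ^ 2 := by fun_prop
  have hs0 (ξ : EuclideanSpace ℝ (Fin n)) : 0 ≤ 4 * Real.pi ^ 2 * ‖ξ‖ ^ 2 := by positivity
  have hi := integrable_sq_norm_fourierL2 (u := u) hu.ofReal
  have hj := integrable_sq_norm_div hs hs0 hi
  rw [sq_hNegOneNorm, ← integral_sq_norm_fourierL2 (u := u) hu.ofReal]
  refine ⟨lt_of_le_of_ne (integral_nonneg fun ξ => by positivity) fun h => h0 ?_,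
    integral_mono hj hi fun ξ => div_le_self (by positivity) (by linarith [hs0 ξ])⟩
  have hz := (integral_eq_zero_iff_of_nonneg (fun ξ => by positivity) hj).1 h.symm
  have ha : ∫ ξ, ‖fourierL2 u ξ‖ ^ 2 = 0 := by
    refine integral_eq_zero_of_ae ?_
    filter_upwards [hz] with ξ hξ
    have h1 : 0 < 1 + 4 * Real.pi ^ 2 * ‖ξ‖ ^ 2 := by linarith [hs0 ξ]
    simpa [h1.ne'] using hξ
  rw [integral_sq_norm_fourierL2 (u := u) hu.ofReal,
    integral_eq_zero_iff_of_nonneg (fun x => sq_nonneg _) hu.integrable_sq] at ha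
  filter_upwards [ha] with x hx
  simpa using hx

theorem le_rpow_mul_of_le_mul_rpow {E Y A β : ℝ} (hE : 0 < E) (hY : 0 ≤ Y) (hA : 0 ≤ A)
    (hβ : 0 < β) (h : E ≤ A * E ^ (1 - β) * Y ^ β) : E ≤ A ^ (1 / β) * Y := by
  have h1 : E ^ β ≤ A * Y ^ β := by
    have hp : 0 < E ^ (1 - β) := Real.rpow_pos_of_pos hE _
    refine le_of_mul_le_mul_left ?_ hp
    rw [← Real.rpow_add hE, sub_add_cancel, Real.rpow_one]
    linarith
  have h2 := Real.rpow_le_rpow (by positivity) h1 (by positivity : 0 ≤ 1 / β)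
  rwa [← Real.rpow_mul hE.le, mul_one_div_cancel hβ.ne', Real.rpow_one,
    Real.mul_rpow hA (by positivity), ← Real.rpow_mul hY, mul_one_div_cancel hβ.ne',
    Real.rpow_one] at h2

theorem theorem1 (n : ℕ) (L r : ℝ) (hL : 0 < L) (hr : 0 < r) :
    ∃ β ∈ Ioo (0 : ℝ) 1, ∀ (T : ℝ) (LM : ℝ≥0), 0 < T → ∃ C : ℝ, 0 < C ∧
      ∀ (ω : Set (EuclideanSpace ℝ (Fin n))) (f : ℝ → ℝ)
        (y₁0 y₂0 : EuclideanSpace ℝ (Fin n) → ℝ) (y₁ y₂ : ℝ → EuclideanSpace ℝ (Fin n) → ℝ)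
        (h₁ : MemLp y₁0 2 volume) (h₂ : MemLp y₂0 2 volume),
        IsObservationSet L r ω →
        LocallyLipschitz f → f 0 = 0 →
        MemLp y₁0 ∞ volume → MemLp y₂0 ∞ volume →
        IsBoundedSolution f T y₁0 y₁ → IsBoundedSolution f T y₂0 y₂ →
        LipschitzOnWith LM f
          {s | |s| ≤ (max (timeSpaceSupNorm T y₁) (timeSpaceSupNorm T y₂)).toReal} →
        MemLp (fun x => y₁ T x - y₂ T x) 2 volume ∧
        (∫ x, |y₁ T x - y₂ T x| ^ 2) ≤
          C * (∫ x, |y₁0 x - y₂0 x| ^ 2) ^ (1 - β) * (∫ x in ω, |y₁ T x - y₂ T x| ^ 2) ^ β ∧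
        (¬ y₁0 =ᵐ[volume] y₂0 →
          (∫ x, |y₁0 x - y₂0 x| ^ 2) ≤
            C * Real.exp (C * ((∫ x, |y₁0 x - y₂0 x| ^ 2) / hNegOneNorm (h₁.sub h₂) ^ 2)) *
              ∫ x in ω, |y₁ T x - y₂ T x| ^ 2) := by
  obtain ⟨β, hβ, H⟩ := IsHeatPerturbation.exists_interpolation n
    (by positivity : 0 < Real.sqrt n * L + 1) hr
  refine ⟨β, hβ, fun T LM hT => ?_⟩
  obtain ⟨C, hC, H⟩ := H LM T LM.coe_nonneg hT
  set D := 1 + 10 * (1 + (LM : ℝ)) * T * Real.exp (8 * (LM : ℝ) ^ 2 * T) with hD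
  have hD0 : 0 < D := by positivity
  have hβ0 := hβ.1
  -- The three summands dominate the constant in (i), the prefactor in (ii) and the exponent D/β in
  -- (ii).
  set C' := C + C ^ (1 / β) + D * (1 / β) with hC'
  have hCβ : 0 < C ^ (1 / β) := by positivity
  have hDβ : 0 < D * (1 / β) := by positivity
  refine ⟨C', by positivity, ?_⟩
  intro ω f y₁0 y₂0 y₁ y₂ h₁ h₂ hω hf hf0 hb₁ hb₂ hy₁ hy₂ hLip
  obtain ⟨w, hw, hw0, hwT⟩ :=
    exists_isHeatPerturbation_sub hT hf.continuous hf0 hb₁ hb₂ hy₁ hy₂ hLip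
  obtain ⟨c, hc, hcω, hcov⟩ := hω.exists_centers
  have hi0 : Integrable fun x => w 0 x ^ 2 := by
    refine (h₁.sub h₂).integrable_sq.congr ?_
    filter_upwards [hw0] with x hx
    rw [hx]; rfl
  have e0 : ∫ x, |y₁0 x - y₂0 x| ^ 2 = ∫ x, w 0 x ^ 2 := by
    refine integral_congr_ae ?_
    filter_upwards [hw0] with x hx
    rw [hx, sq_abs]
  have eT : ∫ x, |y₁ T x - y₂ T x| ^ 2 = ∫ x, w T x ^ 2 := by
    refine integral_congr_ae ?_
    filter_upwards [hwT] with x hx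
    rw [hx, sq_abs]
  have eω : ∫ x in ω, |y₁ T x - y₂ T x| ^ 2 = ∫ x in ω, w T x ^ 2 := by
    refine integral_congr_ae ?_
    filter_upwards [ae_restrict_of_ae hwT] with x hx
    rw [hx, sq_abs]
  have hTI : T ∈ Icc 0 T := ⟨hT.le, le_rfl⟩
  have hmain := H w ω c hw hi0 hc hcω hcov
  rw [e0, eT, eω]
  have hE0 : 0 ≤ ∫ x, w 0 x ^ 2 := integral_nonneg fun x => sq_nonneg _
  have hY0 : 0 ≤ ∫ x in ω, w T x ^ 2 := integral_nonneg fun x => sq_nonneg _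
  refine ⟨?_, hmain.trans ?_, fun hne => ?_⟩
  · exact ((memLp_two_iff_integrable_sq (hw.measurable T hTI).aestronglyMeasurable).2
      (hw.integrable_sq hi0 hTI)).ae_eq hwT
  · gcongr
    linarith
  · have hne' : ¬ (y₁0 - y₂0) =ᵐ[volume] 0 := fun h => hne <| by
      filter_upwards [h] with x hx
      exact sub_eq_zero.1 hx
    obtain ⟨hpos, hle⟩ := sq_hNegOneNorm_pos_and_le (h₁.sub h₂) hne'
    have e0' : ∫ x, (y₁0 - y₂0) x ^ 2 = ∫ x, w 0 x ^ 2 := by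
      rw [← e0]; simp only [Pi.sub_apply, sq_abs]
    rw [e0'] at hle
    set J := hNegOneNorm (h₁.sub h₂) ^ 2 with hJ
    set R := (∫ x, w 0 x ^ 2) / J with hR
    have hR1 : 1 ≤ R := (one_le_div hpos).2 hle
    have hback := hw.integral_sq_zero_le hi0 LM.coe_nonneg hT hR1 (by
      rw [fourierL2_congr (v := y₁0 - y₂0) hw0, ← sq_hNegOneNorm (h₁.sub h₂), ← hJ, hR,
        div_mul_cancel₀ _ hpos.ne'])
    rw [← hD] at hback
    -- The backward estimate followed by (i) bounds the initial energy E by e^{DR} C E^{1-β} Y^β; E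
    -- is positive, so it can be solved for.
    have hfin := le_rpow_mul_of_le_mul_rpow (A := Real.exp (D * R) * C) (hpos.trans_le hle) hY0
      (by positivity) hβ0 (by
        refine hback.trans ?_
        rw [mul_assoc (Real.exp (D * R)), mul_assoc (Real.exp (D * R))]
        exact mul_le_mul_of_nonneg_left hmain (Real.exp_pos _).le)
    refine hfin.trans (mul_le_mul_of_nonneg_right ?_ hY0)
    rw [Real.mul_rpow (Real.exp_pos _).le hC.le, ← Real.exp_mul, mul_comm]
    refine mul_le_mul (by linarith) (Real.exp_le_exp.2 ?_) (Real.exp_pos _).le (by positivity)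
    rw [mul_right_comm]
    exact mul_le_mul_of_nonneg_right (by linarith) (by linarith)
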